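/- **Setting.** Let $K\ge 2$, $\mathcal T=\{0,\dots,K-1\}$, and fix $t\in\mathcal T$. A population carries potential outcomes $Y^{(k)}$ ($k\in\mathcal T$), a treatment $T\in\mathcal T$ and covariates $X\in\mathbb R^d$; put $R^{(k)}=1\{T=k\}$, and $Y=Y^{(k)}$ if $T=k$. Assume unconfoundedness: $R^{(t)}$ and $Y^{(t)}$ are conditionally independent given $X$. Let $f(X)=(f_0(X),\dots,f_p(X))^{\mathrm T}$ be known regressors with $f_0\equiv 1$, and let $(Y_i,T_i,X_i)$, $i=1,\dots,n$ ($n\ge1$), be i.i.d. copies of $(Y,T,X)$; $\tilde{\mathrm E}$ is the sample average. For $(p+1)\times(K-1)$ matrices $\gamma=(\gamma_k)_{k\ne t}$, $\alpha=(\alpha^{(k)})_{k\neq t}$ let $\gamma_{j\cdot}$, $\alpha_{j\cdot}$ ($0\le j\le p$) be their rows. With $\gamma_t:=0$ let $$\pi(k,X;\gamma)=\frac{e^{\gamma_k^{\mathrm T}f(X)}}{\sum_{s\in\mathcal T}e^{\gamma_s^{\mathrm T}f(X)}},\qquad \omega(k,X;\gamma)=\frac{\pi(k,X;\gamma)}{\pi(t,X;\gamma)}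 .$$ Define the losses, the latter for the linear outcome model $m(t,X;\alpha^{(k)})=\alpha^{(k)\mathrm T}f(X)$, $$\ell_{\rm CAL}(\gamma)=\tilde{\mathrm E}\sum_{k\ne t}\{R^{(t)}e^{\gamma_k^{\mathrm T}f(X)}-R^{(k)}\gamma_k^{\mathrm T}f(X)\},\quad \ell_{\rm WL}(\alpha;\gamma)=\tfrac12\tilde{\mathrm E}\sum_{k\ne t}R^{(t)}e^{\gamma_k^{\mathrm T}f(X)}\{Y-\alpha^{(k)\mathrm T}f(X)\}^2 .$$ Let $\bar\gamma$ be a minimizer of $\mathrm E\,\ell_{\rm CAL}(\gamma)$ and $\bar\alpha$ a minimizer of $\mathrm E\,\ell_{\rm WL}(\alpha;\bar\gamma)$. With $\lambda_1=A_1\tilde\lambda_1$, $\lambda_2=A_2\tilde\lambda_2$, let $\hat\gamma$ be a minimizer of $\ell_{\rm CAL}(\gamma)+\lambda_1\sum_{j=1}^p\|\gamma_{j\cdot}\|_2$ and $\hat\alpha$ a minimizer of $\ell_{\rm WL}(\alpha;\hat\gamma)+\lambda_2\sum_{j=1}^p\|\alpha_{j\cdot}\|_2$. Put $$\hat\mu_t(\alpha,\gamma)=\tilde{\mathrm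 E}\Big[R^{(t)}Y+\sum_{k\ne t}\big\{R^{(t)}\omega(k,X;\gamma)Y-(R^{(t)}\omega(k,X;\gamma)-R^{(k)})\,\alpha^{(k)\mathrm T}f(X)\big\}\Big],$$ so that $\hat\mu_t(\hat m^\#_{\rm RWL},\hat\pi_{\rm RCAL})=\hat\mu_t(\hat\alpha,\hat\gamma)$ and $\hat\mu_t(\bar m^\#_{\rm WL},\bar\pi_{\rm CAL})=\hat\mu_t(\bar\alpha,\bar\gamma)$. Neither the propensity score model nor the outcome model is assumed to be correctly specified. Put $S_\gamma=\{0\}\cup\{j\ge1:\bar\gamma_{j\cdot}\ne0\}$, $S_{\alpha_t}=\{0\}\cup\{j\ge1:\bar\alpha_{j\cdot}\ne0\}$, and, for $0<\epsilon<1$, $$\tilde\lambda_1=4\sqrt2B_0^2B_1\sqrt{\tfrac{K-1}{n}+\tfrac{\log\{(p+1)/\epsilon\}}{n}},\qquad \tilde\lambda_2=\max\Big[\tilde\lambda_1,\ \sqrt3B_0(B_1-1)\sigma_0\sqrt{\tfrac{K-1}{n}+\tfrac{\log\{(p+1)/\epsilon\}}{n}}\Big].$$ **Assumptions**, for constants $B_0\ge1$,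 $B_1,\xi_1,\xi_2>1$, $\nu_1,\nu_2,\sigma_0>0$, $\eta_{1,1},\eta_{1,2},\eta_2\in(0,1)$. 1. (i) $|f_j(X)|\le B_0$ a.s. for $1\le j\le p$; (ii) $1/\pi(t,X;\bar\gamma)\le B_1$ a.s.; (iii) the compatibility condition holds for $(S,\nu,\xi)=(S_\gamma,\nu_1,\xi_1)$: every matrix $b$ with $\sum_{j\notin S}\|b_{j\cdot}\|_2\le\xi\sum_{j\in S}\|b_{j\cdot}\|_2$ satisfies $\nu^2(\sum_{j\in S}\|b_{j\cdot}\|_2)^2\le|S|\sum_{k\ne t}b_k^{\mathrm T}\mathrm E\{R^{(t)}\omega(k,X;\bar\gamma)f(X)f^{\mathrm T}(X)\}b_k$; (iv) $(\xi_1+1)^2\nu_1^{-2}|S_\gamma|\tilde\lambda_1\le\eta_{1,1}$ and $B_0(\xi_1+1)^2(A_1-1)(1-\eta_{1,1})^{-1}\nu_1^{-2}|S_\gamma|\tilde\lambda_1\le\eta_{1,2}$. 2. (i) for every $k\ne t$, $Y^{(t)}-\bar\alpha^{(k)\mathrm T}f(X)$ is sub-gaussian given $X$ with parameter $\sigma_0^2$,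 in the sense that $\mathrm E[\exp\{(Y^{(t)}-\bar\alpha^{(k)\mathrm T}f(X))^2/\sigma_0^2\}\mid X]\le2$ a.s.; (ii) the compatibility condition holds for $(S_{\alpha_t},\nu_2,\xi_2)$; (vi)(a) $(1+\xi_2^2)\nu_2^{-2}|S_{\alpha_t}|\tilde\lambda_2\le\eta_2$. (Condition (iii), boundedness of the derivative of the inverse link, is automatic for the linear model.) Also suppose $\log\{(K-1)+\log(p+1)/\epsilon\}/n\le1$, $A_1>(\xi_1+1)/(\xi_1-1)$, $A_2>(\xi_2+1)/(\xi_2-1)$, and let $\eta_1$ be a constant with $|S_\gamma|\tilde\lambda_1\le\eta_1$. **Constants.** $\xi_{1,1}=(\xi_1+1)(A_1-1)$, $\nu_{1,1}=\nu_1(1-\eta_{1,1})^{1/2}(1-\eta_{1,2})^{1/2}$, $M_1=\xi_{1,1}^2\nu_{1,1}^{-2}$, $\eta_{1,3}=(A_1-1)^{-1}M_1\eta_1B_0$, $\eta_{1,4}=(A_1-1)^{-2}M_1^2\eta_1$, $M_{1,1}=3\sigma_0^2(A_1-1)^{-2}M_1^2\eta_1+2\sigma_0^2e^{\eta_{1,3}}M_1$,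 $\xi_{2,2}=(\xi_2+1)(A_2-1)$, $\xi_{2,1}=1-2A_2/\xi_{2,2}$, $\nu_{2,1}=\nu_2(1-\eta_2)^{1/2}$. Let $M_2$ be any constant with $$e^{4\eta_{1,3}}\xi_{2,1}^{-2}M_{1,1}|S_\gamma|\tilde\lambda_1^2+e^{2\eta_{1,3}}\xi_{2,2}^2\nu_{2,1}^{-2}|S_{\alpha_t}|\tilde\lambda_2^2\le e^{\eta_{1,3}}M_2(|S_\gamma|\tilde\lambda_1\tilde\lambda_2+|S_{\alpha_t}|\tilde\lambda_2^2),$$ and put $M_{2,3}=A_1(A_2-1)^{-1}M_2$, $M_{2,2}=(A_1-1)^{-1}M_1$, $M_{2,1}=(\sqrt2+1)\sigma_0\eta_{1,4}e^{\eta_{1,3}}/2+M_{2,3}+\sqrt2\sigma_0M_1e^{2\eta_{1,3}}/2$. **Theorem.** (a) With probability at least $1-8\epsilon$, the minimizers $\hat\gamma$ and $\hat\alpha$ exist and, for every choice of them, $$|\hat\mu_t(\hat m^\#_{\rm RWL},\hat\pi_{\rm RCAL})-\hat\mu_t(\bar m^\#_{\rm WL},\bar\pi_{\rm CAL})|\le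 M_{2,1}|S_\gamma|\tilde\lambda_1^2+M_{2,2}|S_\gamma|\tilde\lambda_1\tilde\lambda_2+M_{2,3}|S_{\alpha_t}|\tilde\lambda_1\tilde\lambda_2 .$$ (b) Consequently, consider a sequence of such problems indexed by the sample size $n$ ($K$, $p$, $d$, the population and $\epsilon=\epsilon_n\to0$ may vary with $n$) that for all large $n$ satisfy the assumptions with the same constants $(A_1,A_2,B_0,B_1,\sigma_0,\xi_1,\xi_2,\nu_1,\nu_2,\eta_1,\eta_{1,1},\eta_{1,2},\eta_2)$. If $n^{1/2}(|S_\gamma|+|S_{\alpha_t}|)\tilde\lambda_1^2\to0$, then $\hat\mu_t(\hat m^\#_{\rm RWL},\hat\pi_{\rm RCAL})=\hat\mu_t(\bar m^\#_{\rm WL},\bar\pi_{\rm CAL})+o_p(n^{-1/2})$, with possible misspecification of both models. -/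

import Mathlib

open MeasureTheory ProbabilityTheory Filter Topology

universe u v

noncomputable section

namespace RCAL

/-! ### Models, losses and the augmented IPW score (fixed treatment `t`) -/

/-- One observation `(Y, T, X)`: outcome, treatment in `{0, …, K-1}`, covariates in `ℝ^d`. -/
abbrev Obs (d K : ℕ) := ℝ × Fin K × (Fin d → ℝ)

/-- `(p+1) × (K-1)` coefficient matrices with columns indexed by `k ≠ t`; `b j` is the row attached
to the regressor `f_j`, with the Euclidean norm. The constraint `γ_t ≡ 0` is built in. -/
abbrev Coef (K p : ℕ) (t : Fin K) := Fin (p + 1) → EuclideanSpace ℝ {k : Fin K // k ≠ t}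

section Model

variable {d K p : ℕ} {t : Fin K}

/-- The indicator `R^{(k)} = 1{T = k}`. -/
def ind (T k : Fin K) : ℝ := if T = k then 1 else 0

/-- The linear predictor `γ_kᵀ f`, for `k ≠ t`; `v` is the regressor vector `f(X)`. -/
def lin (γ : Coef K p t) (v : Fin (p + 1) → ℝ) (k : {k : Fin K // k ≠ t}) : ℝ :=
  ∑ j, γ j k * v j

open Classical in
/-- The linear predictors for all treatments, with `γ_t = 0`. -/
def linAll (γ : Coef K p t) (v : Fin (p + 1) → ℝ) (k : Fin K) : ℝ :=
  if h : k ≠ t then lin γ v ⟨k, h⟩ else 0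

/-- The multi-class logistic propensity score `π(k, X; γ)`. -/
def propScore (γ : Coef K p t) (v : Fin (p + 1) → ℝ) (k : Fin K) : ℝ :=
  Real.exp (linAll γ v k) / ∑ s : Fin K, Real.exp (linAll γ v s)

/-- The ratio `ω(k, X; γ) = π(k, X; γ) / π(t, X; γ)`. -/
def ratio (γ : Coef K p t) (v : Fin (p + 1) → ℝ) (k : Fin K) : ℝ :=
  propScore γ v k / propScore γ v t

/-- The calibration loss of a single observation. -/
def calLoss (f : (Fin d → ℝ) → Fin (p + 1) → ℝ) (γ : Coef K p t) (o : Obs d K) : ℝ :=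
  ∑ k : {k : Fin K // k ≠ t},
    (ind o.2.1 t * Real.exp (lin γ (f o.2.2) k) - ind o.2.1 k * lin γ (f o.2.2) k)

/-- The weighted least squares loss of a single observation, summed over `k ≠ t`, for the linear
outcome model `m(t, X; α) = αᵀ f(X)`. -/
def wlLoss (f : (Fin d → ℝ) → Fin (p + 1) → ℝ) (γ α : Coef K p t) (o : Obs d K) : ℝ :=
  ∑ k : {k : Fin K // k ≠ t},
    ind o.2.1 t * Real.exp (lin γ (f o.2.2) k) * (o.1 - lin α (f o.2.2) k) ^ 2 / 2

/-- The generalized augmented IPW score `φ_t(Y, T, X; α^#, γ)`. -/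
def phi (f : (Fin d → ℝ) → Fin (p + 1) → ℝ) (α γ : Coef K p t) (o : Obs d K) : ℝ :=
  ind o.2.1 t * o.1 +
    ∑ k : {k : Fin K // k ≠ t},
      (ind o.2.1 t * o.1 * ratio γ (f o.2.2) k -
        (ind o.2.1 t * ratio γ (f o.2.2) k - ind o.2.1 k) * lin α (f o.2.2) k)

/-- The sample average. -/
def avg {n : ℕ} (D : Fin n → Obs d K) (g : Obs d K → ℝ) : ℝ := (∑ i, g (D i)) / n

/-- The group Lasso penalty `∑_{j=1}^p ‖b_{j·}‖₂`; intercepts are not penalized. -/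
def penalty (b : Coef K p t) : ℝ := ∑ j : Fin p, ‖b j.succ‖

/-- `γ` is a regularized calibrated estimate `γ̂_RCAL` with tuning parameter `lam`. -/
def IsRCAL {n : ℕ} (f : (Fin d → ℝ) → Fin (p + 1) → ℝ) (D : Fin n → Obs d K) (lam : ℝ)
    (γ : Coef K p t) : Prop :=
  ∀ γ' : Coef K p t,
    avg D (calLoss f γ) + lam * penalty γ ≤ avg D (calLoss f γ') + lam * penalty γ'

/-- `α` is a regularized weighted least squares estimate `α̂^#_RWL` with weights given by `γ` and
tuning parameter `lam`. -/
def IsRWL {n : ℕ} (f : (Fin d → ℝ) → Fin (p + 1) → ℝ) (D : Fin n → Obs d K) (lam : ℝ)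
    (γ α : Coef K p t) : Prop :=
  ∀ α' : Coef K p t,
    avg D (wlLoss f γ α) + lam * penalty α ≤ avg D (wlLoss f γ α') + lam * penalty α'

open Classical in
/-- `S = {0} ∪ {j : b_{j·} ≠ 0, j = 1, …, p}`. -/
def supp (b : Coef K p t) : Finset (Fin (p + 1)) :=
  Finset.univ.filter fun j => j = 0 ∨ b j ≠ 0

end Model

/-! ### Conditions on random variables -/

section Prob

variable {Ω₀ : Type u} [MeasurableSpace Ω₀] {d : ℕ}

/-- `Z` is sub-gaussian given `X` with parameter `σ²`: `E{exp(Z²/σ²) | X} ≤ 2` almost surely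
(no centering, so the conditional mean of `Z` need not be zero). -/
def CondSubGaussian (P : Measure Ω₀) (X : Ω₀ → Fin d → ℝ) (Z : Ω₀ → ℝ) (σ : ℝ) : Prop :=
  Integrable (fun w => Real.exp (Z w ^ 2 / σ ^ 2)) P ∧
    ∀ᵐ w ∂P, (P[fun w => Real.exp (Z w ^ 2 / σ ^ 2) | MeasurableSpace.comap X inferInstance]) w ≤ 2

/-- The event `A` and the variable `Z` are conditionally independent given `X`. -/
def CondIndepGiven (P : Measure Ω₀) (X : Ω₀ → Fin d → ℝ) (A : Set Ω₀) (Z : Ω₀ → ℝ) : Prop :=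
  ∀ s : Set ℝ, MeasurableSet s →
    P[(A ∩ Z ⁻¹' s).indicator (fun _ => (1 : ℝ)) | MeasurableSpace.comap X inferInstance]
      =ᵐ[P] fun w =>
        (P[A.indicator (fun _ => (1 : ℝ)) | MeasurableSpace.comap X inferInstance]) w *
        (P[(Z ⁻¹' s).indicator (fun _ => (1 : ℝ)) | MeasurableSpace.comap X inferInstance]) w

end Prob

/-! ### Constants and rates -/

/-- The numerical constants of the assumptions. -/
structure Constants where
  (A1 A2 B0 B1 σ0 ξ1 ξ2 ν1 ν2 η1 η11 η12 η2 : ℝ)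

namespace Constants

variable (c : Constants)

/-- The ranges of the constants. -/
structure Admissible : Prop where
  B0 : 1 ≤ c.B0
  B1 : 1 < c.B1
  σ0 : 0 < c.σ0
  ξ1 : 1 < c.ξ1
  ξ2 : 1 < c.ξ2
  ν1 : 0 < c.ν1
  ν2 : 0 < c.ν2
  η11 : 0 < c.η11 ∧ c.η11 < 1
  η12 : 0 < c.η12 ∧ c.η12 < 1
  η2 : 0 < c.η2 ∧ c.η2 < 1
  A1 : (c.ξ1 + 1) / (c.ξ1 - 1) < c.A1
  A2 : (c.ξ2 + 1) / (c.ξ2 - 1) < c.A2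

def xi11 : ℝ := (c.ξ1 + 1) * (c.A1 - 1)
def nu11 : ℝ := c.ν1 * √(1 - c.η11) * √(1 - c.η12)
def M1 : ℝ := c.xi11 ^ 2 * (c.nu11 ^ 2)⁻¹
def eta13 : ℝ := (c.A1 - 1)⁻¹ * c.M1 * c.η1 * c.B0
def eta14 : ℝ := ((c.A1 - 1) ^ 2)⁻¹ * c.M1 ^ 2 * c.η1
def M11 : ℝ :=
  3 * c.σ0 ^ 2 * ((c.A1 - 1) ^ 2)⁻¹ * c.M1 ^ 2 * c.η1 + 2 * c.σ0 ^ 2 * Real.exp c.eta13 * c.M1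
def xi22 : ℝ := (c.ξ2 + 1) * (c.A2 - 1)
def xi21 : ℝ := 1 - 2 * c.A2 / ((c.ξ2 + 1) * (c.A2 - 1))
def nu21 : ℝ := c.ν2 * √(1 - c.η2)

/-- `M_{2,3}`, as a function of `M_2`. -/
def M23 (M2 : ℝ) : ℝ := c.A1 * (c.A2 - 1)⁻¹ * M2

/-- `M_{2,2}`. -/
def M22 : ℝ := (c.A1 - 1)⁻¹ * c.M1

/-- `M_{2,1}`, as a function of `M_2`. -/
def M21 (M2 : ℝ) : ℝ :=
  (√2 + 1) * c.σ0 * c.eta14 * Real.exp c.eta13 / 2 + c.M23 M2 +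
    √2 * c.σ0 * c.M1 * Real.exp (2 * c.eta13) / 2

/-- The rate `λ̃₁`. -/
def lam1 (K p n : ℕ) (ε : ℝ) : ℝ :=
  4 * √2 * c.B0 ^ 2 * c.B1 * √(((K : ℝ) - 1) / n + Real.log (((p : ℝ) + 1) / ε) / n)

/-- The rate `λ̃₂`. -/
def lam2 (K p n : ℕ) (ε : ℝ) : ℝ :=
  max (c.lam1 K p n ε)
    (√3 * c.B0 * (c.B1 - 1) * c.σ0 *
      √(((K : ℝ) - 1) / n + Real.log (((p : ℝ) + 1) / ε) / n))

end Constants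

/-! ### The estimation problem -/

/-- A population, regressors, a treatment `t` of interest, an i.i.d. sample of size `n`, and the
target values of the two regression estimators. -/
structure Problem (Ω₀ : Type u) (Ω : Type v) [MeasurableSpace Ω₀] [MeasurableSpace Ω]
    (d K p n : ℕ) where
  /-- the population -/
  P : Measure Ω₀
  isProb_P : IsProbabilityMeasure P
  /-- potential outcomes, treatment, covariates -/
  Ypot : Fin K → Ω₀ → ℝ
  T : Ω₀ → Fin K
  X : Ω₀ → Fin d → ℝ
  measurable_Ypot : ∀ k, Measurable (Ypot k)
  measurable_T : Measurable T
  measurable_X : Measurable X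
  /-- the known regressors `f = (f_0, …, f_p)`, with `f_0 ≡ 1` -/
  f : (Fin d → ℝ) → Fin (p + 1) → ℝ
  measurable_f : Measurable f
  f_zero : ∀ x, f x 0 = 1
  /-- the treatment whose mean outcome is estimated -/
  t : Fin K
  /-- the sample: i.i.d. copies of `(Y, T, X)`, where `Y = Y^{(k)}` if `T = k` -/
  μ : Measure Ω
  isProb_μ : IsProbabilityMeasure μ
  obs : Fin n → Ω → Obs d K
  measurable_obs : ∀ i, Measurable (obs i)
  indep : iIndepFun obs μ
  law : ∀ i, μ.map (obs i) = P.map (fun w => ((Ypot (T w) w, T w, X w) : Obs d K))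
  /-- the target value `γ̄_CAL`: a minimizer of the expected calibration loss -/
  γbar : Coef K p t
  γbar_min : ∀ γ : Coef K p t,
    ∫ w, calLoss f γbar (Ypot (T w) w, T w, X w) ∂P ≤
      ∫ w, calLoss f γ (Ypot (T w) w, T w, X w) ∂P
  /-- the target value `ᾱ^#_WL`: a minimizer of the expected weighted least squares loss -/
  αbar : Coef K p t
  αbar_min : ∀ α : Coef K p t,
    ∫ w, wlLoss f γbar αbar (Ypot (T w) w, T w, X w) ∂P ≤
      ∫ w, wlLoss f γbar α (Ypot (T w) w, T w, X w) ∂P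

namespace Problem

variable {Ω₀ : Type u} {Ω : Type v} [MeasurableSpace Ω₀] [MeasurableSpace Ω] {d K p n : ℕ}
  (Q : Problem Ω₀ Ω d K p n)

/-- The observed sample. -/
def sample (ω : Ω) : Fin n → Obs d K := fun i => Q.obs i ω

/-- `S_γ` -/
def Sγ : Finset (Fin (p + 1)) := supp Q.γbar

/-- `S_{α_t}` -/
def Sα : Finset (Fin (p + 1)) := supp Q.αbar

/-- The matrix `E{R^{(t)} ω(k, X; γ̄_CAL) f(X) f(X)ᵀ}`. -/
def gram (k : {k : Fin K // k ≠ Q.t}) : Matrix (Fin (p + 1)) (Fin (p + 1)) ℝ :=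
  Matrix.of fun i j =>
    ∫ w, ind (Q.T w) Q.t * ratio Q.γbar (Q.f (Q.X w)) k * (Q.f (Q.X w) i * Q.f (Q.X w) j) ∂Q.P

/-- The theoretical compatibility condition for the index set `S` with constants `ν` and `ξ`. -/
def Compat (S : Finset (Fin (p + 1))) (ν ξ : ℝ) : Prop :=
  ∀ b : Coef K p Q.t, ∑ j ∈ Sᶜ, ‖b j‖ ≤ ξ * ∑ j ∈ S, ‖b j‖ →
    ν ^ 2 * (∑ j ∈ S, ‖b j‖) ^ 2 ≤
      (S.card : ℝ) * ∑ k : {k : Fin K // k ≠ Q.t},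
        (fun j => b j k) ⬝ᵥ (Q.gram k).mulVec (fun j => b j k)

/-- The hypotheses, with tail probability `ε`. -/
structure Conditions (c : Constants) (ε : ℝ) : Prop where
  two_le_K : 2 ≤ K
  one_le_n : 1 ≤ n
  ε_pos : 0 < ε
  ε_lt_one : ε < 1
  /-- unconfoundedness -/
  unconfounded : CondIndepGiven Q.P Q.X {w | Q.T w = Q.t} (Q.Ypot Q.t)
  /-- bounded regressors -/
  bounded : ∀ᵐ w ∂Q.P, ∀ j : Fin p, |Q.f (Q.X w) j.succ| ≤ c.B0
  /-- target propensity scores for `t` bounded away from zero -/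
  overlap : ∀ᵐ w ∂Q.P, (propScore Q.γbar (Q.f (Q.X w)) Q.t)⁻¹ ≤ c.B1
  compat_γ : Q.Compat Q.Sγ c.ν1 c.ξ1
  sparse_γ_a : (c.ξ1 + 1) ^ 2 * (c.ν1 ^ 2)⁻¹ * Q.Sγ.card * c.lam1 K p n ε ≤ c.η11
  sparse_γ_b : c.B0 * (c.ξ1 + 1) ^ 2 * (c.A1 - 1) * (1 - c.η11)⁻¹ * (c.ν1 ^ 2)⁻¹ * Q.Sγ.card *
    c.lam1 K p n ε ≤ c.η12
  /-- sub-gaussian outcome residuals at the target value -/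
  subGaussian : ∀ k : {k : Fin K // k ≠ Q.t},
    CondSubGaussian Q.P Q.X (fun w => Q.Ypot Q.t w - lin Q.αbar (Q.f (Q.X w)) k) c.σ0
  compat_α : Q.Compat Q.Sα c.ν2 c.ξ2
  sparse_α : (1 + c.ξ2 ^ 2) * (c.ν2 ^ 2)⁻¹ * Q.Sα.card * c.lam2 K p n ε ≤ c.η2
  sample_size : Real.log (((K : ℝ) - 1) + Real.log ((p : ℝ) + 1) / ε) / n ≤ 1
  /-- the constant `η₁` -/
  η1_bound : Q.Sγ.card * c.lam1 K p n ε ≤ c.η1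

/-- The error bound for `α̂^#_RWL` in the linear outcome model, by which `M_2` is defined. -/
def outcomeBound (c : Constants) (ε : ℝ) : ℝ :=
  Real.exp (4 * c.eta13) * (c.xi21 ^ 2)⁻¹ * (c.M11 * Q.Sγ.card * c.lam1 K p n ε ^ 2) +
    Real.exp (2 * c.eta13) * c.xi22 ^ 2 * ((c.nu21 ^ 2)⁻¹ * Q.Sα.card * c.lam2 K p n ε ^ 2)

/-- The estimator `μ̂_t` as a function of the coefficients: the sample average of `φ_t`. -/
def muHat (α γ : Coef K p Q.t) (ω : Ω) : ℝ := avg (Q.sample ω) (phi Q.f α γ)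

/-- In the sample `ω`, estimates `γ̂_RCAL` (tuning parameter `A₁λ̃₁`) and then `α̂^#_RWL` (tuning
parameter `A₂λ̃₂`) exist, and, whichever minimizers are taken, the estimator of the treatment mean
lies within `r` of its version at the target values. -/
def DeviationLE (c : Constants) (ε r : ℝ) (ω : Ω) : Prop :=
  (∃ γ : Coef K p Q.t, IsRCAL Q.f (Q.sample ω) (c.A1 * c.lam1 K p n ε) γ) ∧
  ∀ γ : Coef K p Q.t, IsRCAL Q.f (Q.sample ω) (c.A1 * c.lam1 K p n ε) γ →
    (∃ α : Coef K p Q.t, IsRWL Q.f (Q.sample ω) (c.A2 * c.lam2 K p n ε) γ α) ∧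
    ∀ α : Coef K p Q.t, IsRWL Q.f (Q.sample ω) (c.A2 * c.lam2 K p n ε) γ α →
      |Q.muHat α γ ω - Q.muHat Q.αbar Q.γbar ω| ≤ r

end Problem

end RCAL

end

namespace RCAL

/-! ### Exponential inequalities -/

/-! Write a = α̂ − ᾱ and b = γ̂ − γ̄. The change of the estimator of the mean is an exact sum of
three terms (`avg_phi_sub`): minus the derivative of the empirical calibration loss at γ̂ in
direction a, minus the derivative of the empirical least squares loss at (ᾱ, γ̄) in direction b, and
a Taylor remainder of the exponential, quadratic in b. The first is at most A₁λ̃₁ Σ‖a_j‖ by the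
optimality conditions of the penalized estimate γ̂. The second is at most λ̃₂ Σ‖b_j‖, because the
gradient at the target has mean zero and concentrates. The third is a weighted squared size of b.
Each term is thus a product of two small quantities. The target values enter through their
first-order conditions, so no correctness of either model is needed.

The sizes of b and a come from two group Lasso arguments. For b (`cal_error_bound`) the exponential
loss is only locally strongly convex, but the basic inequality together with the sparsity condition
shows that the error already lies where the curvature is controlled. For a (`wl_error_bound`) the
loss is quadratic, but its weights use γ̂; the resulting perturbation is bounded by Cauchy–Schwarz
and the first-stage error. The same estimates confine minimizers over a ball to its interior, so
convexity turns them into global minimizers and existence follows.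

The empirical inputs, collected in `IsGoodSample`, concern the Euclidean norms over k ≠ t of
averaged vectors. They hold with high probability by a dimension-free inequality
(`measure_norm_sum_ge_le`): for centered independent increments, cosh of the norm of the partial
sums has mean growing by at most a fixed factor at each step. A union bound over regressors or pairs
of regressors finishes the proof. The number of treatments costs nothing beyond the rate, since
overlap bounds the sum of all the weights. Unconfoundedness serves to bound the quadratic form
weighted by squared residuals. -/

lemma exp_sub_one_sub_le_half_sq_mul_exp {y : ℝ} (hy : 0 ≤ y) :
    Real.exp y - 1 - y ≤ y ^ 2 / 2 * Real.exp y := by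
  -- After division by e^y the claim reads 1 ≤ y²/2 + (1 + y)e^{-y}. The right side is 1 at 0 and
  -- has derivative y(1 − e^{-y}).
  have hd : ∀ x : ℝ, HasDerivAt (fun x : ℝ => x ^ 2 / 2 + (1 + x) * Real.exp (-x))
      (x - x * Real.exp (-x)) x := by
    intro x
    have h1 : HasDerivAt (fun x : ℝ => Real.exp (-x)) (-Real.exp (-x)) x := by
      simpa using (hasDerivAt_neg x).exp
    have h2 := ((hasDerivAt_id x).pow 2).div_const 2 |>.add
      (((hasDerivAt_id x).const_add 1).mul h1)
    refine HasDerivAt.congr_deriv h2 ?_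
    simp only [id_eq]; push_cast; ring
  have hm : MonotoneOn (fun x : ℝ => x ^ 2 / 2 + (1 + x) * Real.exp (-x)) (Set.Ici 0) := by
    refine monotoneOn_of_deriv_nonneg (convex_Ici 0)
      (fun x _ => (hd x).continuousAt.continuousWithinAt)
      (fun x _ => (hd x).differentiableAt.differentiableWithinAt) fun x hx => ?_
    rw [interior_Ici, Set.mem_Ioi] at hx
    rw [(hd x).deriv]
    have : Real.exp (-x) ≤ 1 := Real.exp_le_one_iff.2 (by linarith)
    nlinarith
  have h0 := hm (Set.self_mem_Ici) (Set.mem_Ici.2 hy) hy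
  simp only [Real.exp_neg] at h0
  norm_num at h0
  have he := Real.exp_pos y
  have h1 : Real.exp y * 1 ≤ Real.exp y * (y ^ 2 / 2 + (1 + y) * (Real.exp y)⁻¹) :=
    mul_le_mul_of_nonneg_left h0 he.le
  have h2 : Real.exp y * ((1 + y) * (Real.exp y)⁻¹) = 1 + y := by field_simp
  rw [mul_add, h2] at h1
  linarith

/-- A negative x reduces to its reflection: e^x − x ≤ e^{-x} + x amounts to −x ≤ sinh(−x). -/
lemma abs_exp_sub_one_sub_le_half_sq_mul_exp (x : ℝ) :
    |Real.exp x - 1 - x| ≤ x ^ 2 / 2 * Real.exp |x| := by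
  have h0 : 0 ≤ Real.exp x - 1 - x := by linarith [Real.add_one_le_exp x]
  rw [abs_of_nonneg h0]
  rcases le_total 0 x with h | h
  · rw [abs_of_nonneg h]; exact exp_sub_one_sub_le_half_sq_mul_exp h
  · have h1 := exp_sub_one_sub_le_half_sq_mul_exp (neg_nonneg.2 h)
    rw [abs_of_nonpos h]
    have h2 : -x ≤ Real.sinh (-x) := Real.self_le_sinh_iff.2 (by linarith)
    rw [Real.sinh_eq, neg_neg] at h2
    have h3 : (-x) ^ 2 = x ^ 2 := by ring
    rw [h3] at h1
    linarith

lemma abs_exp_sub_one_le_mul_exp (x : ℝ) : |Real.exp x - 1| ≤ |x| * Real.exp |x| := by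
  rcases le_total 0 x with h | h
  · have h1 : (1 : ℝ) ≤ Real.exp x := Real.one_le_exp h
    rw [abs_of_nonneg h, abs_of_nonneg (by linarith)]
    have h2 := Real.add_one_le_exp (-x)
    have h3 : Real.exp x * Real.exp (-x) = 1 := by rw [← Real.exp_add]; simp
    nlinarith [Real.exp_pos x]
  · have h1 : Real.exp x ≤ 1 := Real.exp_le_one_iff.2 h
    rw [abs_of_nonpos h, abs_of_nonpos (by linarith)]
    have h2 := Real.add_one_le_exp x
    have h3 : (1 : ℝ) ≤ Real.exp (-x) := Real.one_le_exp (by linarith)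
    nlinarith

/-- Up to 1, combine e^x ≤ 1 + x + x² with 1 + x² ≤ e^{x²}; beyond 1, x ≤ x². It removes the linear
term from an exponential moment and leaves a squared exponent, which sub-gaussianity controls. -/
lemma exp_le_add_exp_sq {x : ℝ} (hx : 0 ≤ x) : Real.exp x ≤ x + Real.exp (x ^ 2) := by
  rcases le_total x 1 with h | h
  · have h1 := Real.abs_exp_sub_one_sub_id_le (x := x) (by rwa [abs_of_nonneg hx])
    have h2 := Real.add_one_le_exp (x ^ 2)
    linarith [abs_le.1 h1]
  · have : Real.exp x ≤ Real.exp (x ^ 2) := Real.exp_le_exp.2 (by nlinarith)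
    linarith

/-- The slope (e^x − 1)/x is increasing, so on |x| ≤ δ it is smallest at −δ. For negative x this is
the chord of exp over [−δ, 0]. -/
lemma sq_mul_le_mul_exp_sub_one {x δ : ℝ} (hδ : 0 < δ) (hx : |x| ≤ δ) :
    x ^ 2 * ((1 - Real.exp (-δ)) / δ) ≤ x * (Real.exp x - 1) := by
  rcases le_total 0 x with h | h
  · have h1 : (1 - Real.exp (-δ)) / δ ≤ 1 := by
      rw [div_le_one hδ]; linarith [Real.add_one_le_exp (-δ)]
    have h2 := Real.add_one_le_exp x
    nlinarith [sq_nonneg x]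
  · rw [abs_of_nonpos h] at hx
    have hc := convexOn_exp.2 (Set.mem_univ (-δ)) (Set.mem_univ 0)
      (show 0 ≤ -x / δ from div_nonneg (by linarith) hδ.le)
      (by rw [← neg_le_iff_add_nonneg', ← neg_div, div_le_one hδ]; exact hx) (by ring)
    have h1 : (-x / δ) • (-δ) + (x / δ + 1) • (0 : ℝ) = x := by
      simp only [smul_eq_mul]; field_simp; ring
    rw [h1] at hc
    simp only [smul_eq_mul, Real.exp_zero] at hc
    have h2 : x ^ 2 * ((1 - Real.exp (-δ)) / δ) =
        x * ((-x / δ) * Real.exp (-δ) + (1 + x / δ) * 1 - 1) := by field_simp; ring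
    rw [h2]
    exact mul_le_mul_of_nonpos_left (by linarith) h

lemma exp_neg_le_one_sub_exp_neg_div {δ : ℝ} (hδ : 0 < δ) :
    Real.exp (-δ) ≤ (1 - Real.exp (-δ)) / δ := by
  rw [le_div_iff₀ hδ]
  have h2 := Real.add_one_le_exp δ
  have h3 : Real.exp δ * Real.exp (-δ) = 1 := by rw [← Real.exp_add]; simp
  nlinarith [Real.exp_pos (-δ)]

/-- Trades the chord slope for e^{-η}, which also covers η = 0. -/
lemma sq_mul_exp_neg_le_mul_exp_sub_one {x η : ℝ} (hx : |x| ≤ η) :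
    x ^ 2 * Real.exp (-η) ≤ x * (Real.exp x - 1) := by
  rcases (abs_nonneg x).trans hx |>.eq_or_lt with h | h
  · have : x = 0 := by rw [← h] at hx; exact abs_nonpos_iff.1 hx
    simp [this]
  · exact (mul_le_mul_of_nonneg_left (exp_neg_le_one_sub_exp_neg_div h) (sq_nonneg x)).trans
      (sq_mul_le_mul_exp_sub_one h hx)

/-- Convexity of exp between y − log 2 and 0. The bound is affine in e^y, so it integrates to at
most 2^θ once the mean of e^y is at most 2. -/
lemma exp_mul_le_one_sub_add {θ y : ℝ} (h0 : 0 ≤ θ) (h1 : θ ≤ 1) :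
    Real.exp (θ * y) ≤ 2 ^ θ * (1 - θ + θ * (Real.exp y / 2)) := by
  have hc := convexOn_exp.2 (Set.mem_univ (y - Real.log 2)) (Set.mem_univ 0)
      h0 (show 0 ≤ 1 - θ by linarith) (by ring)
  simp only [smul_eq_mul, Real.exp_zero, mul_zero, add_zero, mul_one, Real.exp_sub,
    Real.exp_log (show (0 : ℝ) < 2 by norm_num)] at hc
  have : Real.exp (θ * y) = 2 ^ θ * Real.exp (θ * (y - Real.log 2)) := by
    rw [Real.rpow_def_of_pos (by norm_num), ← Real.exp_add]; congr 1; ring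
  rw [this]
  exact mul_le_mul_of_nonneg_left (by linarith) (by positivity)

/-! ### A dimension-free exponential inequality -/

/-- As a function of u, cosh √u is the power series Σ uⁿ/(2n)! with nonnegative coefficients, hence
convex on the half-line. -/
lemma cosh_sqrt_convex {u v a b : ℝ} (hu : 0 ≤ u) (hv : 0 ≤ v) (ha : 0 ≤ a) (hb : 0 ≤ b)
    (hab : a + b = 1) :
    Real.cosh (√(a * u + b * v)) ≤ a * Real.cosh √u + b * Real.cosh √v := by
  have h1 := Real.hasSum_cosh √(a * u + b * v)
  have h2 := ((Real.hasSum_cosh √u).mul_left a).add ((Real.hasSum_cosh √v).mul_left b)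
  refine hasSum_le (fun n => ?_) h1 h2
  simp only [pow_mul]
  rw [Real.sq_sqrt (by positivity), Real.sq_sqrt hu, Real.sq_sqrt hv]
  have := (convexOn_pow n).2 (Set.mem_Ici.2 hu) (Set.mem_Ici.2 hv) ha hb hab
  simp only [smul_eq_mul] at this
  rw [← mul_div_assoc, ← mul_div_assoc, ← add_div]
  gcongr

/-- Here a = ‖x‖, r = ‖z‖ and c = ⟨x, z⟩, so the radicand is ‖x + z‖². It is a convex combination of
(a + r)² and (a − r)², whence the bound cosh a cosh r + (c/(ar)) sinh a sinh r. In the last term,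
the part r of sinh r gives the linear term in c; the part sinh r − r is absorbed using sinh a ≤ cosh
a. -/
lemma cosh_sqrt_le {a r c : ℝ} (ha : 0 < a) (hr : 0 ≤ r) (hc : |c| ≤ a * r) :
    Real.cosh √(a ^ 2 + 2 * c + r ^ 2) ≤
      Real.cosh a + c * (Real.sinh a / a) + Real.cosh a * (Real.exp r - 1 - r) := by
  have hs : r ≤ Real.sinh r := Real.self_le_sinh_iff.2 hr
  have hsa : Real.sinh a ≤ Real.cosh a := (Real.sinh_lt_cosh a).le
  have hsa0 : 0 ≤ Real.sinh a := Real.sinh_nonneg_iff.2 ha.le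
  have hexp : Real.exp r = Real.cosh r + Real.sinh r := (Real.cosh_add_sinh r).symm
  rcases hr.eq_or_lt with h | h
  · subst h
    have : c = 0 := by simpa using hc
    simp [this, Real.sqrt_sq ha.le]
  obtain ⟨h1, h2⟩ := abs_le.1 hc
  have har : 0 < a * r := mul_pos ha h
  set s : ℝ := (1 + c / (a * r)) / 2 with hsdef
  have hq1 : -1 ≤ c / (a * r) := by rw [le_div_iff₀ har]; linarith
  have hq2 : c / (a * r) ≤ 1 := by rw [div_le_one har]; exact h2
  have hcs : c = (2 * s - 1) * (a * r) := by rw [hsdef]; field_simp; ring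
  have key := cosh_sqrt_convex (sq_nonneg (a + r)) (sq_nonneg (a - r)) (a := s) (b := 1 - s)
    (by rw [hsdef]; linarith) (by rw [hsdef]; linarith) (by ring)
  rw [Real.sqrt_sq_eq_abs, Real.sqrt_sq_eq_abs, Real.cosh_abs, Real.cosh_abs, Real.cosh_add,
    Real.cosh_sub] at key
  have e1 : s * (a + r) ^ 2 + (1 - s) * (a - r) ^ 2 = a ^ 2 + 2 * c + r ^ 2 := by
    rw [hcs]; ring
  rw [e1] at key
  have e2 : c * (Real.sinh a / a) = (2 * s - 1) * r * Real.sinh a := by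
    rw [hcs]; field_simp
  rw [e2, hexp]
  have hs0 : 0 ≤ s := by rw [hsdef]; linarith
  have hs1 : s ≤ 1 := by rw [hsdef]; linarith
  have e3 : (2 * s - 1) * (Real.sinh a * (Real.sinh r - r)) ≤
      Real.cosh a * (Real.sinh r - r) := by
    have : 0 ≤ Real.sinh a * (Real.sinh r - r) := mul_nonneg hsa0 (by linarith)
    have : Real.sinh a * (Real.sinh r - r) ≤ Real.cosh a * (Real.sinh r - r) :=
      mul_le_mul_of_nonneg_right hsa (by linarith)
    nlinarith
  nlinarith

section Hilbert

variable {E : Type*} [NormedAddCommGroup E] [InnerProductSpace ℝ E]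

/-- The vector v is the gradient of cosh‖·‖ at x, zero at the origin. It does not depend on z, so
its term disappears when a centered z is averaged, and the remaining factor does not see the
dimension. -/
lemma exists_cosh_norm_add_le (x : E) :
    ∃ v : E, ∀ z : E, Real.cosh ‖x + z‖ ≤
      inner ℝ v z + Real.cosh ‖x‖ * (Real.exp ‖z‖ - ‖z‖) := by
  rcases eq_or_ne x 0 with rfl | hx
  · refine ⟨0, fun z => ?_⟩
    have hs : ‖z‖ ≤ Real.sinh ‖z‖ := Real.self_le_sinh_iff.2 (norm_nonneg z)
    have : Real.exp ‖z‖ = Real.cosh ‖z‖ + Real.sinh ‖z‖ := (Real.cosh_add_sinh _).symm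
    simp; linarith
  · refine ⟨(Real.sinh ‖x‖ / ‖x‖) • x, fun z => ?_⟩
    have h := cosh_sqrt_le (norm_pos_iff.2 hx) (norm_nonneg z) (abs_real_inner_le_norm x z)
    rw [← norm_add_sq_real, Real.sqrt_sq (norm_nonneg _)] at h
    rw [real_inner_smul_left]
    linarith

variable {Ω₀ Ω A : Type*} [MeasurableSpace Ω₀] [MeasurableSpace Ω] [MeasurableSpace A]
  [FiniteDimensional ℝ E] [MeasurableSpace E] [BorelSpace E]

/-- A supermartingale argument: conditionally on the earlier terms, adding one centered increment
multiplies the mean of cosh of the norm by at most e^c. Independence is used as factorization of the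
joint law, and integration in `ENNReal` makes integrability of the partial sums unnecessary. -/
lemma lintegral_cosh_norm_sum_le {ι : Type*} {μ : Measure Ω} [IsProbabilityMeasure μ]
    {ν : Measure E} {W : ι → Ω → E} (hW : ∀ i, Measurable (W i)) (hind : iIndepFun W μ)
    (hlaw : ∀ i, μ.map (W i) = ν) {c : ℝ} (hint : Integrable (fun z => Real.exp ‖z‖) ν)
    (hmean : ∀ v : E, ∫ z, inner ℝ v z ∂ν = 0)
    (hc : ∫ z, (Real.exp ‖z‖ - ‖z‖) ∂ν ≤ Real.exp c) (s : Finset ι) :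
    ∫⁻ ω, ENNReal.ofReal (Real.cosh ‖∑ i ∈ s, W i ω‖) ∂μ ≤
      ENNReal.ofReal (Real.exp (s.card * c)) := by
  classical
  have hnorm : Integrable (fun z : E => ‖z‖) ν := by
    refine hint.mono measurable_norm.aestronglyMeasurable (ae_of_all _ fun z => ?_)
    simp only [Real.norm_eq_abs, Real.abs_exp, abs_norm]
    linarith [Real.add_one_le_exp ‖z‖]
  have hid : Integrable (fun z : E => z) ν := (integrable_norm_iff (by fun_prop)).1 hnorm
  induction s using Finset.induction_on with
  | empty => simp
  | insert i s his ih =>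
    have hS : Measurable (∑ j ∈ s, W j) := by
      rw [Finset.sum_fn]; exact Finset.measurable_sum _ fun j _ => hW j
    have hI := hind.indepFun_finsetSum_of_notMem hW his
    have hmap := (indepFun_iff_map_prod_eq_prod_map_map hS.aemeasurable (hW i).aemeasurable).1 hI
    rw [hlaw i] at hmap
    have hν : IsProbabilityMeasure ν := by
      rw [← hlaw i]; exact Measure.isProbabilityMeasure_map (hW i).aemeasurable
    have hinner : ∀ x : E, ∫⁻ z, ENNReal.ofReal (Real.cosh ‖x + z‖) ∂ν ≤
        ENNReal.ofReal (Real.exp c) * ENNReal.ofReal (Real.cosh ‖x‖) := by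
      intro x
      obtain ⟨v, hv⟩ := exists_cosh_norm_add_le x
      have hi1 : Integrable (fun z : E => inner ℝ v z) ν := hid.const_inner v
      have hi2 : Integrable (fun z : E => Real.cosh ‖x‖ * (Real.exp ‖z‖ - ‖z‖)) ν :=
        (hint.sub hnorm).const_mul _
      calc ∫⁻ z, ENNReal.ofReal (Real.cosh ‖x + z‖) ∂ν
          ≤ ∫⁻ z, ENNReal.ofReal (inner ℝ v z + Real.cosh ‖x‖ * (Real.exp ‖z‖ - ‖z‖)) ∂ν :=
            lintegral_mono fun z => ENNReal.ofReal_le_ofReal (hv z)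
        _ = ENNReal.ofReal (∫ z, (inner ℝ v z + Real.cosh ‖x‖ * (Real.exp ‖z‖ - ‖z‖)) ∂ν) :=
            (ofReal_integral_eq_lintegral_ofReal (hi1.add hi2)
              (ae_of_all _ fun z => (Real.cosh_pos _).le.trans (hv z))).symm
        _ ≤ ENNReal.ofReal (Real.exp c * Real.cosh ‖x‖) := by
            refine ENNReal.ofReal_le_ofReal ?_
            rw [integral_add hi1 hi2, hmean, zero_add, integral_const_mul, mul_comm]
            exact mul_le_mul_of_nonneg_right hc (Real.cosh_pos _).le
        _ = _ := ENNReal.ofReal_mul (Real.exp_pos _).le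
    have hF : Measurable fun q : E × E => ENNReal.ofReal (Real.cosh ‖q.1 + q.2‖) :=
      (Real.continuous_cosh.measurable.comp (measurable_fst.add measurable_snd).norm).ennreal_ofReal
    calc ∫⁻ ω, ENNReal.ofReal (Real.cosh ‖∑ j ∈ insert i s, W j ω‖) ∂μ
        = ∫⁻ q, ENNReal.ofReal (Real.cosh ‖q.1 + q.2‖)
            ∂(μ.map fun ω => ((∑ j ∈ s, W j) ω, W i ω)) := by
          rw [lintegral_map hF (hS.prodMk (hW i))]
          refine lintegral_congr fun ω => ?_
          rw [Finset.sum_insert his, add_comm, Finset.sum_apply]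
      _ = ∫⁻ x, ∫⁻ z, ENNReal.ofReal (Real.cosh ‖x + z‖) ∂ν ∂(μ.map (∑ j ∈ s, W j)) := by
          rw [hmap, lintegral_prod _ hF.aemeasurable]
      _ ≤ ∫⁻ x, ENNReal.ofReal (Real.exp c) * ENNReal.ofReal (Real.cosh ‖x‖)
            ∂(μ.map (∑ j ∈ s, W j)) := lintegral_mono hinner
      _ = ENNReal.ofReal (Real.exp c) *
            ∫⁻ ω, ENNReal.ofReal (Real.cosh ‖∑ j ∈ s, W j ω‖) ∂μ := by
          have hm : Measurable fun x : E => ENNReal.ofReal (Real.cosh ‖x‖) :=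
            (Real.continuous_cosh.measurable.comp measurable_norm).ennreal_ofReal
          rw [lintegral_const_mul _ hm, lintegral_map hm hS]
          simp only [Finset.sum_apply]
      _ ≤ ENNReal.ofReal (Real.exp c) * ENNReal.ofReal (Real.exp (s.card * c)) := by gcongr
      _ = _ := by
          rw [← ENNReal.ofReal_mul (Real.exp_pos _).le, ← Real.exp_add,
            Finset.card_insert_of_notMem his]
          congr 2; push_cast; ring

/-- Exponential tail bound for a sum of i.i.d. centered random vectors. -/
lemma measure_norm_sum_ge_le {n : ℕ} {P : Measure Ω₀} {μ : Measure Ω} [IsProbabilityMeasure μ]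
    {obs : Fin n → Ω → A} {O : Ω₀ → A} (hobs : ∀ i, Measurable (obs i)) (hind : iIndepFun obs μ)
    (hO : Measurable O) (hlaw : ∀ i, μ.map (obs i) = P.map O) {g : A → E} (hg : Measurable g)
    {l c : ℝ} (hl : 0 < l) (hint : Integrable (fun w => Real.exp (l * ‖g (O w)‖)) P)
    (hmean : ∀ v : E, ∫ w, inner ℝ v (g (O w)) ∂P = 0)
    (hc : ∫ w, (Real.exp (l * ‖g (O w)‖) - l * ‖g (O w)‖) ∂P ≤ Real.exp c) (τ : ℝ) :
    μ {ω | τ ≤ ‖∑ i, g (obs i ω)‖} ≤ ENNReal.ofReal (2 * Real.exp (n * c - l * τ)) := by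
  have hlg : Measurable fun a => l • g a := hg.const_smul l
  have hnl : ∀ z : E, ‖l • z‖ = l * ‖z‖ := fun z => by
    rw [norm_smul, Real.norm_of_nonneg hl.le]
  have hmeas : Measurable fun w => l • g (O w) := hlg.comp hO
  have key := lintegral_cosh_norm_sum_le (μ := μ) (ν := P.map fun w => l • g (O w))
    (W := fun i ω => l • g (obs i ω)) (c := c) (fun i => hlg.comp (hobs i))
    (hind.comp (fun _ a => l • g a) fun _ => hlg) (fun i => by
      have h1 : (fun ω => l • g (obs i ω)) = (fun a => l • g a) ∘ obs i := rfl
      have h2 : (fun w => l • g (O w)) = (fun a => l • g a) ∘ O := rfl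
      rw [h1, h2, ← Measure.map_map hlg (hobs i), hlaw, Measure.map_map hlg hO])
    (by
      rw [integrable_map_measure (by fun_prop) hmeas.aemeasurable]
      simpa [Function.comp_def, hnl] using hint)
    (fun v => by
      rw [integral_map hmeas.aemeasurable (by fun_prop)]
      simp [real_inner_smul_right, integral_const_mul, hmean])
    (by
      rw [integral_map hmeas.aemeasurable (by fun_prop)]
      simpa only [hnl] using hc) Finset.univ
  have hsum : ∀ ω, ‖∑ i, l • g (obs i ω)‖ = l * ‖∑ i, g (obs i ω)‖ := fun ω => by
    rw [← Finset.smul_sum, hnl]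
  simp only [hsum, Finset.card_univ, Fintype.card_fin] at key
  -- Markov's inequality is applied to cosh; cosh u ≥ e^u/2 is the origin of the factor 2 in the
  -- tail bound.
  have hsub : {ω | τ ≤ ‖∑ i, g (obs i ω)‖} ⊆ {ω | ENNReal.ofReal (Real.exp (l * τ) / 2) ≤
      ENNReal.ofReal (Real.cosh (l * ‖∑ i, g (obs i ω)‖))} := by
    intro ω hω
    refine ENNReal.ofReal_le_ofReal ?_
    have h1 : Real.exp (l * τ) ≤ Real.exp (l * ‖∑ i, g (obs i ω)‖) :=
      Real.exp_le_exp.2 (mul_le_mul_of_nonneg_left hω hl.le)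
    rw [Real.cosh_eq]
    linarith [Real.exp_pos (-(l * ‖∑ i, g (obs i ω)‖))]
  have hmk := mul_meas_ge_le_lintegral (μ := μ)
    (f := fun ω => ENNReal.ofReal (Real.cosh (l * ‖∑ i, g (obs i ω)‖)))
    (by
      have : Measurable fun ω => ∑ i, g (obs i ω) :=
        Finset.measurable_sum _ fun i _ => hg.comp (hobs i)
      exact (Real.continuous_cosh.measurable.comp (this.norm.const_mul l)).ennreal_ofReal)
    (ENNReal.ofReal (Real.exp (l * τ) / 2))
  have h3 := (mul_le_mul_right (measure_mono hsub) (ENNReal.ofReal (Real.exp (l * τ) / 2))).trans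
    (hmk.trans key)
  have h4 : ENNReal.ofReal (2 * Real.exp (n * c - l * τ)) =
      ENNReal.ofReal (Real.exp (n * c)) / ENNReal.ofReal (Real.exp (l * τ) / 2) := by
    rw [← ENNReal.ofReal_div_of_pos (by positivity), Real.exp_sub]
    congr 1; field_simp
  rw [h4, ENNReal.le_div_iff_mul_le (Or.inl (by simp [Real.exp_pos])) (Or.inl (by simp)), mul_comm]
  exact h3

end Hilbert

/-! ### Sample averages and linear predictors -/

section Basic

variable {d K p n : ℕ} {t : Fin K}

lemma avg_add (D : Fin n → Obs d K) (g h : Obs d K → ℝ) :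
    avg D (fun o => g o + h o) = avg D g + avg D h := by
  simp only [avg, Finset.sum_add_distrib, add_div]

lemma avg_sub (D : Fin n → Obs d K) (g h : Obs d K → ℝ) :
    avg D (fun o => g o - h o) = avg D g - avg D h := by
  simp only [avg, Finset.sum_sub_distrib, sub_div]

lemma avg_const_mul (D : Fin n → Obs d K) (a : ℝ) (g : Obs d K → ℝ) :
    avg D (fun o => a * g o) = a * avg D g := by
  simp only [avg, ← Finset.mul_sum, mul_div_assoc]

lemma avg_neg (D : Fin n → Obs d K) (g : Obs d K → ℝ) :
    avg D (fun o => -g o) = -avg D g := by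
  simp only [avg, Finset.sum_neg_distrib, neg_div]

lemma avg_sum {ι : Type*} (D : Fin n → Obs d K) (s : Finset ι) (g : ι → Obs d K → ℝ) :
    avg D (fun o => ∑ k ∈ s, g k o) = ∑ k ∈ s, avg D (g k) := by
  simp only [avg, Finset.sum_div]
  rw [Finset.sum_comm]

lemma avg_mono {D : Fin n → Obs d K} {g h : Obs d K → ℝ} (H : ∀ i, g (D i) ≤ h (D i)) :
    avg D g ≤ avg D h :=
  div_le_div_of_nonneg_right (Finset.sum_le_sum fun i _ => H i) (Nat.cast_nonneg n)

lemma avg_nonneg {D : Fin n → Obs d K} {g : Obs d K → ℝ} (H : ∀ i, 0 ≤ g (D i)) : 0 ≤ avg D g :=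
  div_nonneg (Finset.sum_nonneg fun i _ => H i) (Nat.cast_nonneg n)

lemma abs_avg_le (D : Fin n → Obs d K) (g : Obs d K → ℝ) : |avg D g| ≤ avg D fun o => |g o| := by
  rw [abs_le, ← avg_neg]
  exact ⟨avg_mono fun i => neg_abs_le _, avg_mono fun i => le_abs_self _⟩

lemma lin_add (b b' : Coef K p t) (v : Fin (p + 1) → ℝ) (k : {k : Fin K // k ≠ t}) :
    lin (b + b') v k = lin b v k + lin b' v k := by
  simp [lin, add_mul, Finset.sum_add_distrib]

lemma lin_sub (b b' : Coef K p t) (v : Fin (p + 1) → ℝ) (k : {k : Fin K // k ≠ t}) :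
    lin (b - b') v k = lin b v k - lin b' v k := by
  simp [lin, sub_mul, Finset.sum_sub_distrib]

lemma lin_smul (s : ℝ) (b : Coef K p t) (v : Fin (p + 1) → ℝ) (k : {k : Fin K // k ≠ t}) :
    lin (s • b) v k = s * lin b v k := by
  simp [lin, Finset.mul_sum, mul_assoc]

lemma lin_neg (b : Coef K p t) (v : Fin (p + 1) → ℝ) (k : {k : Fin K // k ≠ t}) :
    lin (-b) v k = -lin b v k := by
  simp [lin]

lemma continuous_lin (v : Fin (p + 1) → ℝ) (k : {k : Fin K // k ≠ t}) :
    Continuous fun b : Coef K p t => lin b v k := by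
  unfold lin; fun_prop

/-- The sum of the Euclidean norms of all rows. -/
noncomputable def groupNorm (b : Coef K p t) : ℝ := ∑ j, ‖b j‖

lemma groupNorm_nonneg (b : Coef K p t) : 0 ≤ groupNorm b :=
  Finset.sum_nonneg fun _ _ => norm_nonneg _

lemma norm_le_groupNorm (b : Coef K p t) : ‖b‖ ≤ groupNorm b :=
  (pi_norm_le_iff_of_nonneg (groupNorm_nonneg b)).2 fun j =>
    Finset.single_le_sum (f := fun j => ‖b j‖) (fun _ _ => norm_nonneg _) (Finset.mem_univ j)

lemma penalty_le_groupNorm (b : Coef K p t) : penalty b ≤ groupNorm b := by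
  rw [groupNorm, Fin.sum_univ_succ]
  exact le_add_of_nonneg_left (norm_nonneg _)

lemma penalty_add_le (b b' : Coef K p t) : penalty (b + b') ≤ penalty b + penalty b' := by
  rw [penalty, penalty, penalty, ← Finset.sum_add_distrib]
  exact Finset.sum_le_sum fun j _ => norm_add_le _ _

lemma penalty_smul {s : ℝ} (hs : 0 ≤ s) (b : Coef K p t) : penalty (s • b) = s * penalty b := by
  simp [penalty, Finset.mul_sum, norm_smul, abs_of_nonneg hs]

lemma penalty_neg (b : Coef K p t) : penalty (-b) = penalty b := by simp [penalty]

lemma continuous_penalty : Continuous (penalty : Coef K p t → ℝ) := by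
  unfold penalty; fun_prop

lemma abs_lin_le {B : ℝ} {v : Fin (p + 1) → ℝ} (hv : ∀ j, |v j| ≤ B) (b : Coef K p t)
    (k : {k : Fin K // k ≠ t}) : |lin b v k| ≤ B * groupNorm b := by
  rw [lin, groupNorm, Finset.mul_sum]
  refine (Finset.abs_sum_le_sum_abs _ _).trans (Finset.sum_le_sum fun j _ => ?_)
  rw [abs_mul, mul_comm]
  exact mul_le_mul (hv j) (by simpa using PiLp.norm_apply_le (b j) k) (abs_nonneg _)
    ((abs_nonneg _).trans (hv j))

/-- The penalty decreases by at most the error on the support minus the error off the support. -/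
lemma penalty_sub_penalty_le (b b' : Coef K p t) :
    penalty b - penalty b' ≤
      ∑ j ∈ supp b, ‖(b' - b) j‖ - ∑ j ∈ (supp b)ᶜ, ‖(b' - b) j‖ := by
  classical
  have h0 : (0 : Fin (p + 1)) ∈ supp b := by simp [supp]
  have key : ∀ j, (if j = 0 then 0 else ‖b j‖ - ‖b' j‖) ≤
      if j ∈ supp b then ‖(b' - b) j‖ else -‖(b' - b) j‖ := by
    intro j
    by_cases hj : j = 0
    · simp [hj, h0]
    · by_cases hs : j ∈ supp b
      · simp only [hj, hs, if_true, if_false, Pi.sub_apply]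
        rw [norm_sub_rev]; exact norm_sub_norm_le _ _
      · have hb : b j = 0 := by
          by_contra hne
          exact hs (by simp [supp, hne])
        simp [hj, hs, hb]
  have hsum := Finset.sum_le_sum fun j (_ : j ∈ Finset.univ) => key j
  have e1 : ∑ j, (if j = 0 then 0 else ‖b j‖ - ‖b' j‖) = penalty b - penalty b' := by
    rw [Fin.sum_univ_succ]
    simp [penalty, Finset.sum_sub_distrib]
  have e2 : ∑ j, (if j ∈ supp b then ‖(b' - b) j‖ else -‖(b' - b) j‖) =
      ∑ j ∈ supp b, ‖(b' - b) j‖ - ∑ j ∈ (supp b)ᶜ, ‖(b' - b) j‖ := by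
    rw [← Finset.sum_add_sum_compl (supp b), sub_eq_add_neg (∑ j ∈ supp b, ‖(b' - b) j‖),
      ← Finset.sum_neg_distrib]
    exact congrArg₂ _ (Finset.sum_congr rfl fun j hj => by simp [hj])
      (Finset.sum_congr rfl fun j hj => by simp [Finset.mem_compl.1 hj])
  rw [← e1, ← e2]; exact hsum

lemma groupNorm_eq_sum_add_sum_compl (S : Finset (Fin (p + 1))) (b : Coef K p t) :
    groupNorm b = ∑ j ∈ S, ‖b j‖ + ∑ j ∈ Sᶜ, ‖b j‖ :=
  (Finset.sum_add_sum_compl S _).symm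

/-! ### Weights, residuals and propensity ratios -/

lemma ind_nonneg (T k : Fin K) : 0 ≤ ind T k := by unfold ind; split_ifs <;> norm_num

lemma ind_le_one (T k : Fin K) : ind T k ≤ 1 := by unfold ind; split_ifs <;> norm_num

/-- The weight `R^{(t)} exp(γ_kᵀ f(X))`. -/
noncomputable def weight (f : (Fin d → ℝ) → Fin (p + 1) → ℝ) (γ : Coef K p t) (o : Obs d K)
    (k : {k : Fin K // k ≠ t}) : ℝ :=
  ind o.2.1 t * Real.exp (lin γ (f o.2.2) k)

/-- The residual `Y - α_kᵀ f(X)`. -/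
noncomputable def resid (f : (Fin d → ℝ) → Fin (p + 1) → ℝ) (α : Coef K p t) (o : Obs d K)
    (k : {k : Fin K // k ≠ t}) : ℝ :=
  o.1 - lin α (f o.2.2) k

variable (f : (Fin d → ℝ) → Fin (p + 1) → ℝ)

lemma weight_nonneg (γ : Coef K p t) (o : Obs d K) (k : {k : Fin K // k ≠ t}) :
    0 ≤ weight f γ o k := mul_nonneg (ind_nonneg _ _) (Real.exp_pos _).le

lemma ratio_eq_exp (γ : Coef K p t) (v : Fin (p + 1) → ℝ) (k : {k : Fin K // k ≠ t}) :
    ratio γ v k = Real.exp (lin γ v k) := by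
  have h1 : linAll γ v t = 0 := by simp [linAll]
  have h2 : linAll γ v k = lin γ v k := by
    have := k.2
    simp [linAll, this]
  have hs : 0 < ∑ s : Fin K, Real.exp (linAll γ v s) :=
    Finset.sum_pos (fun _ _ => Real.exp_pos _) ⟨t, Finset.mem_univ t⟩
  rw [ratio, propScore, propScore, h1, h2, Real.exp_zero]
  field_simp

/-- Turns overlap into a bound on the sum over k of the exponential weights, by B₁ − 1 at the
target. Bounding the sum rather than each weight keeps the number of treatments out of the
constants. -/
lemma inv_propScore (γ : Coef K p t) (v : Fin (p + 1) → ℝ) :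
    (propScore γ v t)⁻¹ = 1 + ∑ k : {k : Fin K // k ≠ t}, Real.exp (lin γ v k) := by
  classical
  have h1 : linAll γ v t = 0 := by simp [linAll]
  rw [propScore, h1, Real.exp_zero, one_div, inv_inv, ← Finset.add_sum_erase _ _
    (Finset.mem_univ t), h1, Real.exp_zero]
  congr 1
  refine (Finset.sum_bij' (fun (k : {k : Fin K // k ≠ t}) _ => (k : Fin K))
    (fun (k : Fin K) hk => (⟨k, Finset.ne_of_mem_erase hk⟩ : {k : Fin K // k ≠ t}))
    ?_ ?_ ?_ ?_ ?_).symm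
  · intro k _; simpa using k.2
  · simp
  · simp
  · simp
  · intro k _
    have := k.2
    simp [linAll, this]

/-! ### First-order conditions -/

/-- Only the one-sided slopes on (0, 1] are needed. Minimality along a single segment is enough,
which later allows minimizers over a ball. -/
lemma nonneg_add_of_hasDerivAt {Φ : ℝ → ℝ} {Φ' P : ℝ} (h : HasDerivAt Φ Φ' 0)
    (hmin : ∀ s ∈ Set.Ioc (0 : ℝ) 1, Φ 0 ≤ Φ s + s * P) : 0 ≤ Φ' + P := by
  have h1 : HasDerivAt (fun s => Φ s + s * P) (Φ' + P) 0 := by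
    simpa using h.fun_add ((hasDerivAt_id (0 : ℝ)).mul_const P)
  have h2 := h1.hasDerivWithinAt (s := Set.Ioi 0)
  rw [hasDerivWithinAt_iff_tendsto_slope' (by simp)] at h2
  refine ge_of_tendsto h2 ?_
  filter_upwards [Ioc_mem_nhdsGT (show (0 : ℝ) < 1 by norm_num)] with s hs
  rw [slope_def_field]
  have := hmin s hs
  exact div_nonneg (by simp; linarith) (by linarith [hs.1])

/-- Directional derivative of the empirical calibration loss. -/
noncomputable def calGrad (D : Fin n → Obs d K) (γ b : Coef K p t) : ℝ :=
  avg D fun o => ∑ k : {k : Fin K // k ≠ t},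
    (weight f γ o k - ind o.2.1 k) * lin b (f o.2.2) k

lemma hasDerivAt_avg {D : Fin n → Obs d K} {g : ℝ → Obs d K → ℝ} {g' : Obs d K → ℝ} {x : ℝ}
    (h : ∀ o, HasDerivAt (fun s => g s o) (g' o) x) :
    HasDerivAt (fun s => avg D (g s)) (avg D g') x := by
  unfold avg
  exact (HasDerivAt.fun_sum fun i _ => h (D i)).div_const _

lemma hasDerivAt_calLoss (D : Fin n → Obs d K) (γ b : Coef K p t) :
    HasDerivAt (fun s : ℝ => avg D (calLoss f (γ + s • b))) (calGrad f D γ b) 0 := by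
  refine hasDerivAt_avg fun o => ?_
  simp only [calLoss]
  refine HasDerivAt.fun_sum fun k _ => ?_
  simp only [lin_add, lin_smul]
  have h1 : HasDerivAt (fun s : ℝ => lin γ (f o.2.2) k + s * lin b (f o.2.2) k)
      (lin b (f o.2.2) k) 0 := by
    simpa using ((hasDerivAt_id (0 : ℝ)).mul_const (lin b (f o.2.2) k)).const_add
      (lin γ (f o.2.2) k)
  refine ((h1.exp.const_mul _).sub (h1.const_mul _)).congr_deriv ?_
  simp [weight]; ring

/-- The increment P of the penalty is left open for two uses: the difference of the penalties along
a segment towards the target gives the basic inequality, and the penalty of the direction itself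
gives the bound on the gradient at the optimum. -/
lemma cal_first_order {D : Fin n → Obs d K} {lam : ℝ} (hlam : 0 ≤ lam) {γ b : Coef K p t} {P : ℝ}
    (hmin : ∀ s ∈ Set.Ioc (0 : ℝ) 1, avg D (calLoss f γ) + lam * penalty γ ≤
      avg D (calLoss f (γ + s • b)) + lam * penalty (γ + s • b))
    (hP : ∀ s ∈ Set.Ioc (0 : ℝ) 1, penalty (γ + s • b) ≤ penalty γ + s * P) :
    0 ≤ calGrad f D γ b + lam * P := by
  refine nonneg_add_of_hasDerivAt (hasDerivAt_calLoss f D γ b) fun s hs => ?_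
  have h1 := hmin s hs
  have h2 := mul_le_mul_of_nonneg_left (hP s hs) hlam
  simp only [zero_smul, add_zero]
  linarith

lemma penalty_segment_le (γ γ' : Coef K p t) {s : ℝ} (hs : s ∈ Set.Ioc (0 : ℝ) 1) :
    penalty (γ + s • (γ' - γ)) ≤ penalty γ + s * (penalty γ' - penalty γ) := by
  have h : γ + s • (γ' - γ) = (1 - s) • γ + s • γ' := by module
  rw [h]
  refine (penalty_add_le _ _).trans ?_
  rw [penalty_smul (by linarith [hs.2]), penalty_smul hs.1.le]
  linarith

lemma penalty_add_smul_le (γ b : Coef K p t) {s : ℝ} (hs : s ∈ Set.Ioc (0 : ℝ) 1) :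
    penalty (γ + s • b) ≤ penalty γ + s * penalty b := by
  refine (penalty_add_le _ _).trans ?_
  rw [penalty_smul hs.1.le]

/-- Negative directional derivative of the empirical weighted least squares loss. -/
noncomputable def wlGrad (D : Fin n → Obs d K) (γ α a : Coef K p t) : ℝ :=
  avg D fun o => ∑ k : {k : Fin K // k ≠ t},
    weight f γ o k * resid f α o k * lin a (f o.2.2) k

lemma hasDerivAt_wlLoss (D : Fin n → Obs d K) (γ α a : Coef K p t) :
    HasDerivAt (fun s : ℝ => avg D (wlLoss f γ (α + s • a))) (-wlGrad f D γ α a) 0 := by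
  rw [wlGrad, ← avg_neg]
  refine hasDerivAt_avg fun o => ?_
  simp only [wlLoss, ← Finset.sum_neg_distrib]
  refine HasDerivAt.fun_sum fun k _ => ?_
  simp only [lin_add, lin_smul]
  have h1 : HasDerivAt (fun s : ℝ => o.1 - (lin α (f o.2.2) k + s * lin a (f o.2.2) k))
      (-lin a (f o.2.2) k) 0 := by
    simpa using (((hasDerivAt_id (0 : ℝ)).mul_const (lin a (f o.2.2) k)).const_add
      (lin α (f o.2.2) k)).const_sub o.1
  refine (((h1.pow 2).const_mul _).div_const 2).congr_deriv ?_
  simp [weight, resid]; ring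

lemma wl_first_order {D : Fin n → Obs d K} {lam : ℝ} (hlam : 0 ≤ lam) {γ α a : Coef K p t} {P : ℝ}
    (hmin : ∀ s ∈ Set.Ioc (0 : ℝ) 1, avg D (wlLoss f γ α) + lam * penalty α ≤
      avg D (wlLoss f γ (α + s • a)) + lam * penalty (α + s • a))
    (hP : ∀ s ∈ Set.Ioc (0 : ℝ) 1, penalty (α + s • a) ≤ penalty α + s * P) :
    0 ≤ -wlGrad f D γ α a + lam * P := by
  refine nonneg_add_of_hasDerivAt (hasDerivAt_wlLoss f D γ α a) fun s hs => ?_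
  have h1 := hmin s hs
  have h2 := mul_le_mul_of_nonneg_left (hP s hs) hlam
  simp only [zero_smul, add_zero]
  linarith

/-! ### Existence of minimizers -/

/-- A continuous convex function whose minimizers over a closed ball are interior has a global
minimizer. -/
lemma exists_forall_le_of_convexOn {V : Type*} [NormedAddCommGroup V] [NormedSpace ℝ V]
    [ProperSpace V] {F : V → ℝ} (hF : Continuous F) (hconv : ConvexOn ℝ Set.univ F) (x₀ : V)
    {r : ℝ} (hr : 0 ≤ r)
    (h : ∀ x ∈ Metric.closedBall x₀ r, (∀ y ∈ Metric.closedBall x₀ r, F x ≤ F y) →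
      ‖x - x₀‖ < r) : ∃ x, ∀ y, F x ≤ F y := by
  obtain ⟨x, hx, hmin⟩ := (isCompact_closedBall x₀ r).exists_isMinOn
    ⟨x₀, Metric.mem_closedBall_self hr⟩ hF.continuousOn
  have hlt := h x hx fun y hy => hmin hy
  have hloc : IsLocalMin F x := by
    refine hmin.isLocalMin (Metric.closedBall_mem_nhds_of_mem ?_)
    rwa [Metric.mem_ball, dist_eq_norm]
  exact ⟨x, fun y => IsMinOn.of_isLocalMin_of_convex_univ hloc hconv y⟩

lemma convexOn_avg {V : Type*} [AddCommGroup V] [Module ℝ V] (D : Fin n → Obs d K)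
    {g : V → Obs d K → ℝ} (h : ∀ o, ConvexOn ℝ Set.univ fun x => g x o) :
    ConvexOn ℝ Set.univ fun x => avg D (g x) := by
  refine ⟨convex_univ, fun x _ y _ a b ha hb hab => ?_⟩
  simp only [smul_eq_mul, ← avg_const_mul, ← avg_add]
  exact avg_mono fun i => (h (D i)).2 (Set.mem_univ x) (Set.mem_univ y) ha hb hab

lemma convexOn_penalty {lam : ℝ} (hlam : 0 ≤ lam) :
    ConvexOn ℝ Set.univ fun b : Coef K p t => lam * penalty b := by
  refine ⟨convex_univ, fun x _ y _ a b ha hb hab => ?_⟩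
  have h := penalty_add_le (a • x) (b • y)
  rw [penalty_smul ha, penalty_smul hb] at h
  have := mul_le_mul_of_nonneg_left h hlam
  simp only [smul_eq_mul]; linarith

lemma convexOn_calLoss (o : Obs d K) :
    ConvexOn ℝ Set.univ fun γ : Coef K p t => calLoss f γ o := by
  refine ⟨convex_univ, fun x _ y _ a b ha hb hab => ?_⟩
  simp only [smul_eq_mul, calLoss, Finset.mul_sum, ← Finset.sum_add_distrib]
  refine Finset.sum_le_sum fun k _ => ?_
  simp only [lin_add, lin_smul]
  have h := convexOn_exp.2 (Set.mem_univ (lin x (f o.2.2) k)) (Set.mem_univ (lin y (f o.2.2) k))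
    ha hb hab
  simp only [smul_eq_mul] at h
  have := mul_le_mul_of_nonneg_left h (ind_nonneg o.2.1 t)
  linarith

lemma convexOn_wlLoss (γ : Coef K p t) (o : Obs d K) :
    ConvexOn ℝ Set.univ fun α : Coef K p t => wlLoss f γ α o := by
  refine ⟨convex_univ, fun x _ y _ a b ha hb hab => ?_⟩
  simp only [smul_eq_mul, wlLoss, Finset.mul_sum, ← Finset.sum_add_distrib]
  refine Finset.sum_le_sum fun k _ => ?_
  simp only [lin_add, lin_smul]
  have h := weight_nonneg f γ o k
  rw [weight] at h
  set w := ind o.2.1 t * Real.exp (lin γ (f o.2.2) k)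
  have hsq : (o.1 - (a * lin x (f o.2.2) k + b * lin y (f o.2.2) k)) ^ 2 ≤
      a * (o.1 - lin x (f o.2.2) k) ^ 2 + b * (o.1 - lin y (f o.2.2) k) ^ 2 := by
    have := (convexOn_pow_two_real (o.1 - lin x (f o.2.2) k) (o.1 - lin y (f o.2.2) k) ha hb hab)
    refine le_trans (le_of_eq ?_) this
    congr 1
    linear_combination (-o.1) * hab
  have := mul_le_mul_of_nonneg_left hsq h
  linarith
where
  convexOn_pow_two_real (u v : ℝ) {a b : ℝ} (ha : 0 ≤ a) (hb : 0 ≤ b) (hab : a + b = 1) :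
      (a * u + b * v) ^ 2 ≤ a * u ^ 2 + b * v ^ 2 := by
    obtain rfl : b = 1 - a := by linarith
    nlinarith [mul_nonneg ha hb, sq_nonneg (u - v),
      mul_nonneg (mul_nonneg ha hb) (sq_nonneg (u - v))]

lemma continuous_avg_calLoss (D : Fin n → Obs d K) :
    Continuous fun γ : Coef K p t => avg D (calLoss f γ) := by
  unfold avg calLoss
  have := fun (v : Fin (p + 1) → ℝ) k => continuous_lin (t := t) v k
  fun_prop

lemma continuous_avg_wlLoss (D : Fin n → Obs d K) (γ : Coef K p t) :
    Continuous fun α : Coef K p t => avg D (wlLoss f γ α) := by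
  unfold avg wlLoss
  have := fun (v : Fin (p + 1) → ℝ) k => continuous_lin (t := t) v k
  fun_prop

end Basic

/-! ### The numerical constants -/

lemma Constants.one_sub_xi21 (c : Constants) : 1 - c.xi21 = 2 * c.A2 / c.xi22 := by
  have h2 : c.xi21 = 1 - 2 * c.A2 / c.xi22 := rfl
  rw [h2]; ring

namespace Constants.Admissible

variable {c : Constants}

lemma one_lt_A1 (hc : c.Admissible) : 1 < c.A1 := by
  have h1 := hc.ξ1
  have h2 := hc.A1
  refine lt_of_le_of_lt ?_ h2
  rw [le_div_iff₀ (by linarith)]; linarith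

lemma one_lt_A2 (hc : c.Admissible) : 1 < c.A2 := by
  have h1 := hc.ξ2
  have h2 := hc.A2
  refine lt_of_le_of_lt ?_ h2
  rw [le_div_iff₀ (by linarith)]; linarith

lemma two_mul_A1_lt (hc : c.Admissible) : 2 * c.A1 < c.xi11 := by
  have h1 := hc.ξ1
  have h2 := hc.A1
  rw [div_lt_iff₀ (by linarith)] at h2
  rw [Constants.xi11]; linarith

lemma two_mul_A2_lt (hc : c.Admissible) : 2 * c.A2 < c.xi22 := by
  have h1 := hc.ξ2
  have h2 := hc.A2
  rw [div_lt_iff₀ (by linarith)] at h2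
  rw [Constants.xi22]; linarith

lemma xi22_pos (hc : c.Admissible) : 0 < c.xi22 := by linarith [hc.two_mul_A2_lt, hc.one_lt_A2]

lemma xi21_pos (hc : c.Admissible) : 0 < c.xi21 := by
  have h := hc.two_mul_A2_lt
  have h2 : c.xi21 = 1 - 2 * c.A2 / c.xi22 := rfl
  rw [h2, sub_pos, div_lt_one hc.xi22_pos]; exact h

lemma nu11_sq (hc : c.Admissible) : c.nu11 ^ 2 = c.ν1 ^ 2 * (1 - c.η11) * (1 - c.η12) := by
  rw [Constants.nu11, mul_pow, mul_pow, Real.sq_sqrt (by linarith [hc.η11.2]),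
    Real.sq_sqrt (by linarith [hc.η12.2])]

lemma nu11_sq_pos (hc : c.Admissible) : 0 < c.nu11 ^ 2 := by
  rw [hc.nu11_sq]
  exact mul_pos (mul_pos (pow_pos hc.ν1 2) (by linarith [hc.η11.2])) (by linarith [hc.η12.2])

lemma nu21_sq (hc : c.Admissible) : c.nu21 ^ 2 = c.ν2 ^ 2 * (1 - c.η2) := by
  rw [Constants.nu21, mul_pow, Real.sq_sqrt (by linarith [hc.η2.2])]

lemma nu21_sq_pos (hc : c.Admissible) : 0 < c.nu21 ^ 2 := by
  rw [hc.nu21_sq]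
  exact mul_pos (pow_pos hc.ν2 2) (by linarith [hc.η2.2])

lemma M1_pos (hc : c.Admissible) : 0 < c.M1 := by
  have := hc.two_mul_A1_lt
  have := hc.one_lt_A1
  exact mul_pos (pow_pos (by linarith) 2) (inv_pos.2 hc.nu11_sq_pos)

end Constants.Admissible

/-! ### Real-variable steps of the Lasso analysis -/

/-- The error bound for a group Lasso with exponential loss: `D` is the symmetrized Bregman
divergence, `G` and `s` are the group norms of the error, in total and on the support, and `q` is
the quadratic form. -/
lemma cal_scalar_bound {A ξ ν2 B η N l D G s q : ℝ} (hA : 1 < A)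
    (hAξ : 2 * A ≤ (ξ + 1) * (A - 1)) (hν : 0 < ν2) (hB : 0 < B) (hη : η < 1) (hN : 0 ≤ N)
    (hl : 0 < l) (hD : 0 ≤ D) (hs : 0 ≤ s) (hsG : s ≤ G) (hξ : 0 < ξ)
    (h1 : D + (A - 1) * l * G ≤ 2 * A * l * s)
    (h2 : 0 < B * G → q * ((1 - Real.exp (-(B * G))) / (B * G)) ≤ D)
    (h3 : G ≤ (ξ + 1) * s → ν2 * s ^ 2 ≤ N * q)
    (h4 : B * (ξ + 1) ^ 2 * (A - 1) * N * l ≤ η * ν2) :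
    D + (A - 1) * l * G ≤ ((ξ + 1) * (A - 1)) ^ 2 / (ν2 * (1 - η)) * N * l ^ 2 := by
  set X := (ξ + 1) * (A - 1) with hX
  have hXpos : 0 < X := by linarith
  have hlA : 0 < l * (A - 1) := mul_pos hl (by linarith)
  -- Since D ≥ 0, passing from 2A to the larger X = (ξ + 1)(A − 1) makes this imply exactly the cone
  -- condition G ≤ (ξ + 1)s.
  have hT : D + (A - 1) * l * G ≤ X * l * s := by nlinarith [mul_nonneg hl.le hs]
  have hG : G ≤ (ξ + 1) * s := by
    have : l * (A - 1) * G ≤ l * (A - 1) * ((ξ + 1) * s) := by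
      rw [hX] at hT; nlinarith
    exact le_of_mul_le_mul_left this hlA
  rcases hs.eq_or_lt with h0 | h0
  · have : D + (A - 1) * l * G ≤ 0 := by rw [← h0] at hT; simpa using hT
    refine this.trans ?_
    have : 0 < ν2 * (1 - η) := mul_pos hν (by linarith)
    positivity
  have hGpos : 0 < G := h0.trans_le hsG
  have hδ : 0 < B * G := mul_pos hB hGpos
  set δ := B * G with hδdef
  set κ := (1 - Real.exp (-δ)) / δ with hκ
  have hκpos : 0 < κ := by
    refine div_pos ?_ hδ
    rw [sub_pos, Real.exp_lt_one_iff]; linarith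
  have h3' := h3 hG
  have h2' := h2 hδ
  have hDX : D ≤ X * l * s := by nlinarith [mul_pos hlA hGpos]
  have e1 : ν2 * s * κ ≤ N * X * l := by
    have : ν2 * s ^ 2 * κ ≤ N * (X * l * s) :=
      calc ν2 * s ^ 2 * κ ≤ N * q * κ := mul_le_mul_of_nonneg_right h3' hκpos.le
        _ = N * (q * κ) := by ring
        _ ≤ N * (X * l * s) := mul_le_mul_of_nonneg_left (h2'.trans hDX) hN
    refine le_of_mul_le_mul_right ?_ h0
    linarith
  have e2 : κ * δ = 1 - Real.exp (-δ) := by rw [hκ]; field_simp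
  -- Localization without an a priori bound on δ: κ is a quotient with denominator δ, and δ ≤ B(ξ +
  -- 1)s, so the bound on κs becomes one on 1 − e^{-δ}. Then κ ≥ e^{-δ} ≥ 1 − η.
  have e3 : 1 - Real.exp (-δ) ≤ η := by
    rw [← e2]
    refine le_of_mul_le_mul_right ?_ hν
    calc κ * δ * ν2 ≤ κ * (B * ((ξ + 1) * s)) * ν2 := by
          gcongr; exact mul_le_mul_of_nonneg_left hG hB.le
      _ = B * (ξ + 1) * (ν2 * s * κ) := by ring
      _ ≤ B * (ξ + 1) * (N * X * l) := by gcongr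
      _ = B * (ξ + 1) ^ 2 * (A - 1) * N * l := by rw [hX]; ring
      _ ≤ η * ν2 := h4
  have e4 : 1 - η ≤ κ := by
    have := exp_neg_le_one_sub_exp_neg_div hδ
    rw [← hκ] at this; linarith
  have hc0 : 0 < ν2 * (1 - η) := mul_pos hν (by linarith)
  set T := D + (A - 1) * l * G with hTdef
  have hTpos : 0 < T := by rw [hTdef]; nlinarith [mul_pos hlA hGpos]
  have e5 : ν2 * (1 - η) * s ^ 2 ≤ N * T :=
    calc ν2 * (1 - η) * s ^ 2 = ν2 * s ^ 2 * (1 - η) := by ring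
      _ ≤ ν2 * s ^ 2 * κ := by gcongr
      _ ≤ N * q * κ := mul_le_mul_of_nonneg_right h3' hκpos.le
      _ = N * (q * κ) := by ring
      _ ≤ N * T := by
        refine mul_le_mul_of_nonneg_left (h2'.trans ?_) hN
        rw [hTdef]; nlinarith [mul_pos hlA hGpos]
  have e6 : T * (ν2 * (1 - η)) ≤ X ^ 2 * N * l ^ 2 := by
    refine le_of_mul_le_mul_right ?_ hTpos
    calc T * (ν2 * (1 - η)) * T = (ν2 * (1 - η)) * T ^ 2 := by ring
      _ ≤ (ν2 * (1 - η)) * (X * l * s) ^ 2 := by gcongr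
      _ = X ^ 2 * l ^ 2 * (ν2 * (1 - η) * s ^ 2) := by ring
      _ ≤ X ^ 2 * l ^ 2 * (N * T) := by gcongr
      _ = X ^ 2 * N * l ^ 2 * T := by ring
  have : X ^ 2 / (ν2 * (1 - η)) * N * l ^ 2 = X ^ 2 * N * l ^ 2 / (ν2 * (1 - η)) := by ring
  rw [this, le_div_iff₀ hc0]
  exact e6

/-- The error bound for a group Lasso with quadratic loss and a first-stage perturbation `b` with
`b ^ 2 ≤ V * D`. -/
lemma wl_scalar_bound {A ξ ν2 x1 N l D G s b V w : ℝ} (hA : 1 < A)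
    (hX : 0 < (ξ + 1) * (A - 1)) (hx1 : 0 < x1) (hx : 1 - x1 = 2 * A / ((ξ + 1) * (A - 1)))
    (hν : 0 < ν2) (hN : 0 ≤ N) (hl : 0 < l) (hD : 0 ≤ D) (hG0 : 0 ≤ G) (hV : 0 ≤ V) (hw : 0 ≤ w)
    (h1 : D + (A - 1) * l * G ≤ 2 * A * l * s + b) (hb : b ^ 2 ≤ V * D)
    (h3 : G ≤ (ξ + 1) * s → ν2 * s ^ 2 ≤ N * (w * D)) :
    D + (A - 1) * l * G ≤
      (x1 ^ 2)⁻¹ * V + w * ((ξ + 1) * (A - 1)) ^ 2 * (ν2⁻¹ * N * l ^ 2) := by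
  set X := (ξ + 1) * (A - 1) with hXdef
  have hlA : 0 < l * (A - 1) := mul_pos hl (by linarith)
  set T := D + (A - 1) * l * G with hT
  have hDT : D ≤ T := by rw [hT]; nlinarith [mul_nonneg hlA.le hG0]
  have hT0 : 0 ≤ T := hD.trans hDT
  have hr1 : 0 ≤ (x1 ^ 2)⁻¹ * V := by positivity
  have hr2 : 0 ≤ w * X ^ 2 * (ν2⁻¹ * N * l ^ 2) := by positivity
  rcases hT0.eq_or_lt with h0 | h0
  · rw [← h0]; positivity
  -- Either the perturbation accounts for the fraction x1 of T, and b² ≤ VD bounds T directly, or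
  -- the Lasso term dominates. In the second case the choice of x1 gives the constant (ξ + 1)(A −
  -- 1), and hence the cone condition.
  by_cases hcase : x1 * T ≤ b
  · have e1 : (x1 * T) ^ 2 ≤ V * T :=
      (pow_le_pow_left₀ (by positivity) hcase 2).trans
        (hb.trans (mul_le_mul_of_nonneg_left hDT hV))
    have e2 : x1 ^ 2 * T ≤ V := by
      refine le_of_mul_le_mul_right ?_ h0
      linarith [e1, mul_pow x1 T 2, show x1 ^ 2 * T * T = x1 ^ 2 * T ^ 2 by ring]
    have : T ≤ (x1 ^ 2)⁻¹ * V := by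
      rw [inv_mul_eq_div, le_div_iff₀ (by positivity), mul_comm]; exact e2
    linarith
  · push Not at hcase
    have e1 : (1 - x1) * T ≤ 2 * A * l * s := by linarith
    rw [hx] at e1
    have e2 : T ≤ X * l * s := by
      have h2A : 0 < 2 * A := by linarith
      rw [div_mul_eq_mul_div, div_le_iff₀ hX] at e1
      refine le_of_mul_le_mul_left ?_ h2A
      linarith
    have hG : G ≤ (ξ + 1) * s := by
      have : l * (A - 1) * G ≤ l * (A - 1) * ((ξ + 1) * s) := by
        rw [hXdef] at e2; rw [hT] at e2; nlinarith
      exact le_of_mul_le_mul_left this hlA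
    have h3' := h3 hG
    have e5 : ν2 * s ^ 2 ≤ N * (w * T) := h3'.trans (by gcongr)
    have e6 : T * ν2 ≤ w * X ^ 2 * (N * l ^ 2) := by
      refine le_of_mul_le_mul_right ?_ h0
      calc T * ν2 * T = ν2 * T ^ 2 := by ring
        _ ≤ ν2 * (X * l * s) ^ 2 := by gcongr
        _ = X ^ 2 * l ^ 2 * (ν2 * s ^ 2) := by ring
        _ ≤ X ^ 2 * l ^ 2 * (N * (w * T)) := by gcongr
        _ = w * X ^ 2 * (N * l ^ 2) * T := by ring
    have : T ≤ w * X ^ 2 * (ν2⁻¹ * N * l ^ 2) := by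
      have e7 : w * X ^ 2 * (ν2⁻¹ * N * l ^ 2) = w * X ^ 2 * (N * l ^ 2) / ν2 := by
        field_simp
      rw [e7, le_div_iff₀ hν]; exact e6
    linarith

/-- On the cone the total norm G is at most (ξ + 1)s, so the deviation hG² of the quadratic forms
costs only a fraction η of the compatibility constant. -/
lemma compat_scalar {ν2 s N q q' h G ξ η : ℝ} (hG0 : 0 ≤ G) (hN : 0 ≤ N)
    (hh : 0 ≤ h)
    (hq : ν2 * s ^ 2 ≤ N * q) (hqq : |q' - q| ≤ h * G ^ 2) (hG : G ≤ (ξ + 1) * s)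
    (hη : (ξ + 1) ^ 2 * N * h ≤ η * ν2) : ν2 * (1 - η) * s ^ 2 ≤ N * q' := by
  have e1 : h * G ^ 2 ≤ h * ((ξ + 1) * s) ^ 2 := by gcongr
  have e2 : N * (q - q') ≤ N * (h * ((ξ + 1) * s) ^ 2) :=
    mul_le_mul_of_nonneg_left (by linarith [neg_abs_le (q' - q)]) hN
  have e3 : (ξ + 1) ^ 2 * N * h * s ^ 2 ≤ η * ν2 * s ^ 2 := by gcongr
  nlinarith

/-! ### Deterministic error bounds on a good sample -/

section Deterministic

variable {d K p n : ℕ} {t : Fin K} (f : (Fin d → ℝ) → Fin (p + 1) → ℝ)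

/-- The weighted empirical quadratic form. -/
noncomputable def empQuad (D : Fin n → Obs d K) (γ b : Coef K p t) : ℝ :=
  avg D fun o => ∑ k : {k : Fin K // k ≠ t}, weight f γ o k * lin b (f o.2.2) k ^ 2

/-- Samples in which all empirical quantities are close to their expectations; `quad` is the
population quadratic form. -/
structure IsGoodSample (D : Fin n → Obs d K) (γbar αbar : Coef K p t) (B0 σ l1 l2 : ℝ)
    (quad : Coef K p t → ℝ) : Prop where
  bounded : ∀ i j, |f (D i).2.2 j| ≤ B0
  score : ∀ b, |calGrad f D γbar b| ≤ l1 * groupNorm b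
  gram : ∀ b, |empQuad f D γbar b - quad b| ≤ l1 / 2 * groupNorm b ^ 2
  outcome : ∀ b, |wlGrad f D γbar αbar b| ≤ l2 * groupNorm b
  outcome_sq : ∀ b, (avg D fun o => ∑ k : {k : Fin K // k ≠ t},
      weight f γbar o k * resid f αbar o k ^ 2 * lin b (f o.2.2) k ^ 2) ≤
    σ ^ 2 * empQuad f D γbar b + 3 * σ ^ 2 * l1 * groupNorm b ^ 2

variable {f}

lemma weight_eq_mul_exp (γ γ' : Coef K p t) (o : Obs d K) (k : {k : Fin K // k ≠ t}) :
    weight f γ o k = weight f γ' o k * Real.exp (lin (γ - γ') (f o.2.2) k) := by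
  rw [weight, weight, mul_assoc, ← Real.exp_add, lin_sub]; congr 2; ring

lemma calGrad_neg (D : Fin n → Obs d K) (γ b : Coef K p t) :
    calGrad f D γ (-b) = -calGrad f D γ b := by
  simp only [calGrad, lin_neg, mul_neg, Finset.sum_neg_distrib, avg_neg]

lemma wlGrad_neg (D : Fin n → Obs d K) (γ α b : Coef K p t) :
    wlGrad f D γ α (-b) = -wlGrad f D γ α b := by
  simp only [wlGrad, lin_neg, mul_neg, Finset.sum_neg_distrib, avg_neg]

lemma empQuad_nonneg (D : Fin n → Obs d K) (γ b : Coef K p t) : 0 ≤ empQuad f D γ b :=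
  avg_nonneg fun i => Finset.sum_nonneg fun k _ =>
    mul_nonneg (weight_nonneg f γ (D i) k) (sq_nonneg _)

/-- The symmetrized Bregman divergence of the calibration loss. -/
noncomputable def bregman (f : (Fin d → ℝ) → Fin (p + 1) → ℝ) (D : Fin n → Obs d K)
    (γ b : Coef K p t) : ℝ :=
  avg D fun o => ∑ k : {k : Fin K // k ≠ t},
    weight f γ o k * (lin b (f o.2.2) k * (Real.exp (lin b (f o.2.2) k) - 1))

lemma calGrad_sub_calGrad (D : Fin n → Obs d K) (γ γ' : Coef K p t) :
    calGrad f D γ (γ - γ') - calGrad f D γ' (γ - γ') = bregman f D γ' (γ - γ') := by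
  rw [calGrad, calGrad, bregman, ← avg_sub]
  congr 1; funext o
  rw [← Finset.sum_sub_distrib]
  refine Finset.sum_congr rfl fun k _ => ?_
  rw [weight_eq_mul_exp γ γ']; ring

lemma bregman_nonneg (D : Fin n → Obs d K) (γ b : Coef K p t) : 0 ≤ bregman f D γ b := by
  refine avg_nonneg fun i => Finset.sum_nonneg fun k _ =>
    mul_nonneg (weight_nonneg f γ (D i) k) ?_
  have := sq_mul_exp_neg_le_mul_exp_sub_one (le_refl |lin b (f (D i).2.2) k|)
  exact (by positivity : (0 : ℝ) ≤ _).trans this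

/-- The curvature κ is left open: the chord slope serves to prove the error bound, and e^{-η₁₃} to
use it once the predictors are known to be bounded. -/
lemma empQuad_mul_le_bregman {D : Fin n → Obs d K} {γ b : Coef K p t} {δ κ : ℝ}
    (hδ : ∀ i k, |lin b (f (D i).2.2) k| ≤ δ)
    (hκ : ∀ x : ℝ, |x| ≤ δ → x ^ 2 * κ ≤ x * (Real.exp x - 1)) :
    empQuad f D γ b * κ ≤ bregman f D γ b := by
  rw [empQuad, mul_comm, ← avg_const_mul]
  refine avg_mono fun i => ?_
  rw [Finset.mul_sum]
  refine Finset.sum_le_sum fun k _ => ?_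
  have := mul_le_mul_of_nonneg_left (hκ _ (hδ i k)) (weight_nonneg f γ (D i) k)
  linarith

variable {c : Constants} {D : Fin n → Obs d K} {γbar αbar : Coef K p t} {l1 l2 : ℝ}
  {quad : Coef K p t → ℝ}

/-- Off the support the penalty drop contributes −Al and the noise at most l, so (A − 1)l times the
whole norm can move to the left. On the support both add up to 2Al after that move. -/
lemma penalized_le {b' : Coef K p t} {A l : ℝ} (hA : 0 ≤ A) (hl : 0 ≤ l) {X Z : ℝ}
    (bbar : Coef K p t)
    (h : X ≤ l * groupNorm (b' - bbar) + Z + A * l * (penalty bbar - penalty b')) :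
    X + (A - 1) * l * groupNorm (b' - bbar) ≤
      2 * A * l * ∑ j ∈ supp bbar, ‖(b' - bbar) j‖ + Z := by
  have h1 := mul_le_mul_of_nonneg_left (penalty_sub_penalty_le bbar b') (mul_nonneg hA hl)
  have h2 := groupNorm_eq_sum_add_sum_compl (supp bbar) (b' - bbar)
  have h3 : A * l * groupNorm (b' - bbar) = A * l * (∑ j ∈ supp bbar, ‖(b' - bbar) j‖ +
    ∑ j ∈ (supp bbar)ᶜ, ‖(b' - bbar) j‖) := by rw [h2]
  linarith

/-- The optimality condition minus the score at the target leaves the symmetrized Bregman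
divergence, which is bounded below by the empirical quadratic form. The factor 1 − η₁₁ pays for
replacing the population form by the empirical one, the factor 1 − η₁₂ for the curvature of the
exponential. -/
lemma cal_error_bound (hc : c.Admissible) (hl : 0 < l1)
    (hD : IsGoodSample f D γbar αbar c.B0 c.σ0 l1 l2 quad)
    (hcompat : ∀ b : Coef K p t, ∑ j ∈ (supp γbar)ᶜ, ‖b j‖ ≤ c.ξ1 * ∑ j ∈ supp γbar, ‖b j‖ →
      c.ν1 ^ 2 * (∑ j ∈ supp γbar, ‖b j‖) ^ 2 ≤ ((supp γbar).card : ℝ) * quad b)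
    (ha : (c.ξ1 + 1) ^ 2 * (c.ν1 ^ 2)⁻¹ * (supp γbar).card * l1 ≤ c.η11)
    (hb : c.B0 * (c.ξ1 + 1) ^ 2 * (c.A1 - 1) * (1 - c.η11)⁻¹ * (c.ν1 ^ 2)⁻¹ *
      (supp γbar).card * l1 ≤ c.η12)
    {γ : Coef K p t}
    (hopt : 0 ≤ calGrad f D γ (γbar - γ) + c.A1 * l1 * (penalty γbar - penalty γ)) :
    bregman f D γbar (γ - γbar) + (c.A1 - 1) * l1 * groupNorm (γ - γbar) ≤
      c.M1 * (supp γbar).card * l1 ^ 2 := by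
  have hA := hc.one_lt_A1
  have hν : 0 < c.ν1 ^ 2 := pow_pos hc.ν1 2
  have hν1 := hc.ν1.ne'
  have hξ := hc.ξ1
  have hB := hc.B0
  obtain ⟨h11, h11'⟩ := hc.η11
  set b := γ - γbar with hbdef
  set S := supp γbar
  have hs0 : 0 ≤ ∑ j ∈ S, ‖b j‖ := Finset.sum_nonneg fun _ _ => norm_nonneg _
  have hs1 : 0 ≤ ∑ j ∈ Sᶜ, ‖b j‖ := Finset.sum_nonneg fun _ _ => norm_nonneg _
  have hG := groupNorm_eq_sum_add_sum_compl S b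
  have hopt' : bregman f D γbar b ≤
      l1 * groupNorm b + 0 + c.A1 * l1 * (penalty γbar - penalty γ) := by
    rw [← neg_sub γ γbar, calGrad_neg] at hopt
    have h1 := calGrad_sub_calGrad (f := f) D γ γbar
    have h2 := (abs_le.1 (hD.score b)).1
    rw [← hbdef] at h1 hopt
    linarith
  have hmain := penalized_le (by linarith) hl.le γbar hopt'
  rw [add_zero] at hmain
  have hδ : ∀ i k, |lin b (f (D i).2.2) k| ≤ c.B0 * groupNorm b := fun i k =>
    abs_lin_le (hD.bounded i) b k
  have key := cal_scalar_bound (q := empQuad f D γbar b) (N := S.card) (η := c.η12) (ξ := c.ξ1)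
    (ν2 := c.ν1 ^ 2 * (1 - c.η11)) (B := c.B0) hA hc.two_mul_A1_lt.le
    (mul_pos hν (by linarith)) (by linarith) hc.η12.2 (Nat.cast_nonneg _) hl
    (bregman_nonneg D γbar b) hs0 (by linarith) (by linarith) hmain
    (fun hpos => empQuad_mul_le_bregman hδ fun x hx => sq_mul_le_mul_exp_sub_one hpos hx)
    (fun hcone => compat_scalar (groupNorm_nonneg b) (Nat.cast_nonneg _)
      (show 0 ≤ l1 / 2 by linarith) (hcompat b (by linarith)) (hD.gram b) hcone (by
        have h1 : (c.ξ1 + 1) ^ 2 * S.card * l1 ≤ c.η11 * c.ν1 ^ 2 := by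
          have := mul_le_mul_of_nonneg_right ha hν.le
          have e : (c.ξ1 + 1) ^ 2 * (c.ν1 ^ 2)⁻¹ * S.card * l1 * c.ν1 ^ 2 =
            (c.ξ1 + 1) ^ 2 * S.card * l1 := by field_simp
          rwa [e] at this
        have h2 : 0 ≤ (c.ξ1 + 1) ^ 2 * S.card * l1 := by positivity
        linarith))
    (by
      have h0 : 0 < c.ν1 ^ 2 * (1 - c.η11) := mul_pos hν (by linarith)
      have := mul_le_mul_of_nonneg_right hb h0.le
      have h1 : 1 - c.η11 ≠ 0 := by linarith
      have e : c.B0 * (c.ξ1 + 1) ^ 2 * (c.A1 - 1) * (1 - c.η11)⁻¹ * (c.ν1 ^ 2)⁻¹ * S.card * l1 *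
          (c.ν1 ^ 2 * (1 - c.η11)) = c.B0 * (c.ξ1 + 1) ^ 2 * (c.A1 - 1) * S.card * l1 := by
        field_simp
      rwa [e] at this)
  rw [Constants.M1, hc.nu11_sq, Constants.xi11, ← div_eq_mul_inv]
  exact key

lemma groupNorm_le_of_cal_bound (hc : c.Admissible) (hl : 0 < l1) {b : Coef K p t} {N : ℝ}
    (h : bregman f D γbar b + (c.A1 - 1) * l1 * groupNorm b ≤ c.M1 * N * l1 ^ 2) :
    groupNorm b ≤ (c.A1 - 1)⁻¹ * c.M1 * N * l1 := by
  have hA : 0 < c.A1 - 1 := by linarith [hc.one_lt_A1]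
  have h0 := bregman_nonneg (f := f) D γbar b
  have h1 : (c.A1 - 1) * l1 * groupNorm b ≤ (c.A1 - 1) * l1 * ((c.A1 - 1)⁻¹ * c.M1 * N * l1) := by
    have e : (c.A1 - 1) * l1 * ((c.A1 - 1)⁻¹ * c.M1 * N * l1) = c.M1 * N * l1 ^ 2 := by
      field_simp
    rw [e]; linarith
  exact le_of_mul_le_mul_left h1 (mul_pos hA hl)

/-- Cauchy–Schwarz inequality for weighted double averages. -/
lemma avg_sum_mul_sq_le {w u v : Obs d K → {k : Fin K // k ≠ t} → ℝ}
    (hw : ∀ i k, 0 ≤ w (D i) k) :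
    (avg D fun o => ∑ k, w o k * u o k * v o k) ^ 2 ≤
      (avg D fun o => ∑ k, w o k * u o k ^ 2) * avg D fun o => ∑ k, w o k * v o k ^ 2 := by
  have h : ∀ x : ℝ, 0 ≤ (avg D fun o => ∑ k, w o k * u o k ^ 2) * (x * x) +
      (-2 * avg D fun o => ∑ k, w o k * u o k * v o k) * x +
      avg D fun o => ∑ k, w o k * v o k ^ 2 := by
    intro x
    have e : (avg D fun o => ∑ k, w o k * u o k ^ 2) * (x * x) +
        (-2 * avg D fun o => ∑ k, w o k * u o k * v o k) * x +
        (avg D fun o => ∑ k, w o k * v o k ^ 2) =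
        avg D fun o => ∑ k, w o k * (x * u o k - v o k) ^ 2 := by
      rw [mul_comm _ (x * x), mul_right_comm (-2), ← avg_const_mul, ← avg_const_mul, ← avg_add,
        ← avg_add]
      congr 1; funext o
      simp only [Finset.mul_sum, ← Finset.sum_add_distrib]
      exact Finset.sum_congr rfl fun k _ => by ring
    rw [e]
    exact avg_nonneg fun i => Finset.sum_nonneg fun k _ => mul_nonneg (hw i k) (sq_nonneg _)
  have := discrim_le_zero h
  rw [discrim] at this
  nlinarith

end Deterministic

section Deterministic

variable {d K p n : ℕ} {t : Fin K} {f : (Fin d → ℝ) → Fin (p + 1) → ℝ}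
  {c : Constants} {D : Fin n → Obs d K} {γbar αbar : Coef K p t} {l1 l2 : ℝ}
  {quad : Coef K p t → ℝ}

/-- The conclusions on the error `b` of the first stage that are used in the second one. -/
structure FirstStage (f : (Fin d → ℝ) → Fin (p + 1) → ℝ) (c : Constants) (D : Fin n → Obs d K)
    (γbar b : Coef K p t) (l1 N : ℝ) : Prop where
  groupNorm_le : groupNorm b ≤ (c.A1 - 1)⁻¹ * c.M1 * N * l1
  abs_lin_le : ∀ i k, |lin b (f (D i).2.2) k| ≤ c.eta13
  empQuad_le : empQuad f D γbar b ≤ Real.exp c.eta13 * c.M1 * (N * l1 ^ 2)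
  sq_le : l1 * groupNorm b ^ 2 ≤ c.eta14 * (N * l1 ^ 2)

/-- Boundedness of the regressors turns the norm bound into a uniform bound on the predictors, after
which the Bregman divergence controls the quadratic form up to e^{η₁₃}. The hypothesis on N·l1 keeps
all constants free of the sample. -/
lemma firstStage_of_cal_bound (hc : c.Admissible) (hl : 0 < l1) {N : ℝ} (hN : 0 ≤ N)
    (hη1 : N * l1 ≤ c.η1) (hf : ∀ i j, |f (D i).2.2 j| ≤ c.B0) {b : Coef K p t}
    (h : bregman f D γbar b + (c.A1 - 1) * l1 * groupNorm b ≤ c.M1 * N * l1 ^ 2) :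
    FirstStage f c D γbar b l1 N := by
  have hA : 0 < c.A1 - 1 := by linarith [hc.one_lt_A1]
  have hM := hc.M1_pos
  have hB : 0 < c.B0 := by linarith [hc.B0]
  have hG := groupNorm_le_of_cal_bound hc hl h
  have hG0 := groupNorm_nonneg b
  have hlin : ∀ i k, |lin b (f (D i).2.2) k| ≤ c.eta13 := fun i k =>
    calc |lin b (f (D i).2.2) k| ≤ c.B0 * groupNorm b := abs_lin_le (hf i) b k
      _ ≤ c.B0 * ((c.A1 - 1)⁻¹ * c.M1 * N * l1) := by gcongr
      _ = (c.A1 - 1)⁻¹ * c.M1 * (N * l1) * c.B0 := by ring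
      _ ≤ (c.A1 - 1)⁻¹ * c.M1 * c.η1 * c.B0 := by gcongr
  refine ⟨hG, hlin, ?_, ?_⟩
  · have h1 := empQuad_mul_le_bregman (γ := γbar) hlin
      fun x hx => sq_mul_exp_neg_le_mul_exp_sub_one hx
    have h2 : bregman f D γbar b ≤ c.M1 * N * l1 ^ 2 := by
      nlinarith [mul_nonneg (mul_nonneg hA.le hl.le) hG0]
    have h3 : Real.exp c.eta13 * Real.exp (-c.eta13) = 1 := by rw [← Real.exp_add]; simp
    calc empQuad f D γbar b = Real.exp c.eta13 * (empQuad f D γbar b * Real.exp (-c.eta13)) := by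
          linear_combination (-empQuad f D γbar b) * h3
      _ ≤ Real.exp c.eta13 * (c.M1 * N * l1 ^ 2) :=
          mul_le_mul_of_nonneg_left (h1.trans h2) (Real.exp_pos _).le
      _ = _ := by ring
  · calc l1 * groupNorm b ^ 2 ≤ l1 * ((c.A1 - 1)⁻¹ * c.M1 * N * l1) ^ 2 := by gcongr
      _ = ((c.A1 - 1) ^ 2)⁻¹ * c.M1 ^ 2 * (N * l1) * (N * l1 ^ 2) := by
        rw [mul_pow, mul_pow, mul_pow, inv_pow]; ring
      _ ≤ ((c.A1 - 1) ^ 2)⁻¹ * c.M1 ^ 2 * c.η1 * (N * l1 ^ 2) := by gcongr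
      _ = _ := by rw [Constants.eta14]

lemma eta14_nonneg (hη1 : 0 ≤ c.η1) : 0 ≤ c.eta14 := by
  rw [Constants.eta14]; positivity

lemma avg_sq_resid_le
    (hD : IsGoodSample f D γbar αbar c.B0 c.σ0 l1 l2 quad) {N : ℝ} {b : Coef K p t}
    (hb : FirstStage f c D γbar b l1 N) :
    (avg D fun o => ∑ k : {k : Fin K // k ≠ t},
      weight f γbar o k * resid f αbar o k ^ 2 * lin b (f o.2.2) k ^ 2) ≤
      c.σ0 ^ 2 * Real.exp c.eta13 * c.M1 * (N * l1 ^ 2) +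
        3 * c.σ0 ^ 2 * c.eta14 * (N * l1 ^ 2) := by
  have h1 := hD.outcome_sq b
  have h2 := mul_le_mul_of_nonneg_left hb.empQuad_le (sq_nonneg c.σ0)
  have h3 := mul_le_mul_of_nonneg_left hb.sq_le (sq_nonneg c.σ0)
  linarith

lemma wlGrad_eq_sub (D : Fin n → Obs d K) (γ αbar α : Coef K p t) :
    wlGrad f D γ α (α - αbar) =
      wlGrad f D γ αbar (α - αbar) - empQuad f D γ (α - αbar) := by
  rw [wlGrad, wlGrad, empQuad, ← avg_sub]
  congr 1; funext o
  rw [← Finset.sum_sub_distrib]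
  refine Finset.sum_congr rfl fun k _ => ?_
  rw [resid, resid, lin_sub]; ring

/-- Isolates the effect of estimated weights: the second term is the perturbation that the first
stage induces in the second. -/
lemma wlGrad_eq_add (D : Fin n → Obs d K) (γ γ' α a : Coef K p t) :
    wlGrad f D γ α a = wlGrad f D γ' α a +
      avg D fun o => ∑ k : {k : Fin K // k ≠ t}, weight f γ' o k *
        (resid f α o k * (Real.exp (lin (γ - γ') (f o.2.2) k) - 1)) * lin a (f o.2.2) k := by
  rw [wlGrad, wlGrad, ← avg_add]
  congr 1; funext o
  rw [← Finset.sum_add_distrib]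
  refine Finset.sum_congr rfl fun k _ => ?_
  rw [weight_eq_mul_exp γ γ']; ring

lemma empQuad_le_exp_mul {γ γ' : Coef K p t} (a : Coef K p t) {η : ℝ}
    (h : ∀ i k, |lin (γ - γ') (f (D i).2.2) k| ≤ η) :
    empQuad f D γ' a ≤ Real.exp η * empQuad f D γ a := by
  rw [empQuad, empQuad, ← avg_const_mul]
  refine avg_mono fun i => ?_
  rw [Finset.mul_sum]
  refine Finset.sum_le_sum fun k _ => ?_
  rw [weight_eq_mul_exp γ γ']
  have h1 : 1 ≤ Real.exp η * Real.exp (lin (γ - γ') (f (D i).2.2) k) := by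
    rw [← Real.exp_add]
    exact Real.one_le_exp (by linarith [neg_abs_le (lin (γ - γ') (f (D i).2.2) k), h i k])
  have h2 : 0 ≤ weight f γ' (D i) k * lin a (f (D i).2.2) k ^ 2 :=
    mul_nonneg (weight_nonneg f γ' _ k) (sq_nonneg _)
  have := mul_le_mul_of_nonneg_left h1 h2
  linarith

lemma exp_sub_one_sq_le {x η : ℝ} (hx : |x| ≤ η) :
    (Real.exp x - 1) ^ 2 ≤ Real.exp (2 * η) * x ^ 2 := by
  have h1 := abs_exp_sub_one_le_mul_exp x
  have h2 : |Real.exp x - 1| ≤ |x| * Real.exp η := h1.trans (by gcongr)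
  have h3 := pow_le_pow_left₀ (abs_nonneg _) h2 2
  rw [sq_abs, mul_pow, sq_abs, ← Real.exp_nat_mul] at h3
  push_cast at h3; linarith

/-- A group Lasso bound for a quadratic loss whose weights involve the estimated γ. Cauchy–Schwarz
splits the perturbation: (e^x − 1)² ≤ e^{2η₁₃}x² and the change of weights in the quadratic form,
another e^{η₁₃}, give e^{3η₁₃}. Transferring compatibility to the estimated weights costs e^{η₁₃}.
One further factor e^{η₁₃} multiplies the final inequality, to match the form in which M₂ is
defined. -/
lemma wl_error_bound (hc : c.Admissible) (hl1 : 0 < l1) (hl12 : l1 ≤ l2) (hη1 : 0 ≤ c.η1)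
    (hD : IsGoodSample f D γbar αbar c.B0 c.σ0 l1 l2 quad)
    (hcompat : ∀ b : Coef K p t, ∑ j ∈ (supp αbar)ᶜ, ‖b j‖ ≤ c.ξ2 * ∑ j ∈ supp αbar, ‖b j‖ →
      c.ν2 ^ 2 * (∑ j ∈ supp αbar, ‖b j‖) ^ 2 ≤ ((supp αbar).card : ℝ) * quad b)
    (ha : (1 + c.ξ2 ^ 2) * (c.ν2 ^ 2)⁻¹ * (supp αbar).card * l2 ≤ c.η2)
    {γ α : Coef K p t} {N : ℝ} (hN : 0 ≤ N) (hγ : FirstStage f c D γbar (γ - γbar) l1 N)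
    (hopt : 0 ≤ -wlGrad f D γ α (αbar - α) + c.A2 * l2 * (penalty αbar - penalty α)) :
    Real.exp c.eta13 * ((c.A2 - 1) * l2 * groupNorm (α - αbar)) ≤
      Real.exp (4 * c.eta13) * (c.xi21 ^ 2)⁻¹ * (c.M11 * N * l1 ^ 2) +
        Real.exp (2 * c.eta13) * c.xi22 ^ 2 *
          ((c.nu21 ^ 2)⁻¹ * (supp αbar).card * l2 ^ 2) := by
  have hA := hc.one_lt_A2
  have hl2 : 0 < l2 := hl1.trans_le hl12
  have hν2 := hc.ν2.ne'
  have hν : 0 < c.ν2 ^ 2 := pow_pos hc.ν2 2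
  have hξ := hc.ξ2
  have hM1 := hc.M1_pos
  set a := α - αbar with hadef
  set S := supp αbar
  set w := Real.exp c.eta13 with hwdef
  have hw : 0 < w := Real.exp_pos _
  have hs0 : 0 ≤ ∑ j ∈ S, ‖a j‖ := Finset.sum_nonneg fun _ _ => norm_nonneg _
  have hG := groupNorm_eq_sum_add_sum_compl S a
  set pert := avg D fun o => ∑ k : {k : Fin K // k ≠ t}, weight f γbar o k *
        (resid f αbar o k * (Real.exp (lin (γ - γbar) (f o.2.2) k) - 1)) * lin a (f o.2.2) k
    with hpert
  have hopt' : empQuad f D γ a ≤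
      l2 * groupNorm a + pert + c.A2 * l2 * (penalty αbar - penalty α) := by
    rw [← neg_sub α αbar, ← hadef, wlGrad_neg, neg_neg, hadef, wlGrad_eq_sub, ← hadef,
      wlGrad_eq_add D γ γbar αbar a] at hopt
    have h2 := (abs_le.1 (hD.outcome a)).2
    linarith
  have hmain := penalized_le (by linarith) hl2.le αbar hopt'
  have hM11 : 0 ≤ c.M11 := by rw [Constants.M11]; positivity
  have hpert2 : pert ^ 2 ≤ Real.exp (3 * c.eta13) * (c.M11 * N * l1 ^ 2) * empQuad f D γ a := by
    have h1 := avg_sum_mul_sq_le (D := D) (w := weight f γbar)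
      (u := fun o k => resid f αbar o k * (Real.exp (lin (γ - γbar) (f o.2.2) k) - 1))
      (v := fun o k => lin a (f o.2.2) k) fun i k => weight_nonneg f γbar (D i) k
    have h2 : (avg D fun o => ∑ k : {k : Fin K // k ≠ t}, weight f γbar o k *
        (resid f αbar o k * (Real.exp (lin (γ - γbar) (f o.2.2) k) - 1)) ^ 2) ≤
        Real.exp (2 * c.eta13) * (c.M11 * N * l1 ^ 2) := by
      have h3 := avg_sq_resid_le hD hγ
      -- `M11` contains the first summand twice; once suffices here.
      have h4 : c.σ0 ^ 2 * w * c.M1 * (N * l1 ^ 2) +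
          3 * c.σ0 ^ 2 * c.eta14 * (N * l1 ^ 2) ≤ c.M11 * N * l1 ^ 2 := by
        have : c.M11 * N * l1 ^ 2 = c.σ0 ^ 2 * w * c.M1 * (N * l1 ^ 2) +
          3 * c.σ0 ^ 2 * c.eta14 * (N * l1 ^ 2) + c.σ0 ^ 2 * w * c.M1 * (N * l1 ^ 2) := by
          rw [Constants.M11, Constants.eta14]; ring
        rw [this]
        have : 0 ≤ c.σ0 ^ 2 * w * c.M1 * (N * l1 ^ 2) := by positivity
        linarith
      refine le_trans ?_ (mul_le_mul_of_nonneg_left (h3.trans h4) (Real.exp_pos _).le)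
      rw [← avg_const_mul]
      refine avg_mono fun i => ?_
      rw [Finset.mul_sum]
      refine Finset.sum_le_sum fun k _ => ?_
      have h5 := exp_sub_one_sq_le (hγ.abs_lin_le i k)
      have h6 : 0 ≤ weight f γbar (D i) k * resid f αbar (D i) k ^ 2 :=
        mul_nonneg (weight_nonneg f γbar _ k) (sq_nonneg _)
      have := mul_le_mul_of_nonneg_left h5 h6
      rw [mul_pow]; linarith
    have h7 := empQuad_le_exp_mul (D := D) a hγ.abs_lin_le
    refine h1.trans ?_
    calc _ ≤ (Real.exp (2 * c.eta13) * (c.M11 * N * l1 ^ 2)) * (w * empQuad f D γ a) := by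
          gcongr
          · exact empQuad_nonneg D γbar a
          · exact h7
      _ = _ := by
        rw [show 3 * c.eta13 = 2 * c.eta13 + c.eta13 by ring, Real.exp_add]; ring
  have hl12' : l1 / 2 ≤ l2 / 2 := by linarith
  have key := wl_scalar_bound (x1 := c.xi21) (ξ := c.ξ2) (ν2 := c.nu21 ^ 2) (N := S.card)
    (V := Real.exp (3 * c.eta13) * (c.M11 * N * l1 ^ 2)) (w := w) hA hc.xi22_pos hc.xi21_pos
    c.one_sub_xi21 hc.nu21_sq_pos (Nat.cast_nonneg _) hl2 (empQuad_nonneg D γ a)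
    (groupNorm_nonneg a) (by positivity) hw.le hmain hpert2
    (fun hcone => by
      have h1 := compat_scalar (η := c.η2) (groupNorm_nonneg a) (Nat.cast_nonneg S.card)
        (show 0 ≤ l1 / 2 by linarith) (hcompat a (by linarith)) (hD.gram a) hcone (by
          have h1 : (1 + c.ξ2 ^ 2) * S.card * l2 ≤ c.η2 * c.ν2 ^ 2 := by
            have := mul_le_mul_of_nonneg_right ha hν.le
            have e : (1 + c.ξ2 ^ 2) * (c.ν2 ^ 2)⁻¹ * S.card * l2 * c.ν2 ^ 2 =
              (1 + c.ξ2 ^ 2) * S.card * l2 := by field_simp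
            rwa [e] at this
          -- The inequality (ξ + 1)² ≤ 2(1 + ξ²) loses a factor 2, which the deviation l1/2 of the
          -- quadratic form compensates.
          calc (c.ξ2 + 1) ^ 2 * (S.card : ℝ) * (l1 / 2)
              ≤ (2 * (1 + c.ξ2 ^ 2)) * (S.card : ℝ) * (l2 / 2) := by
                gcongr
                nlinarith [sq_nonneg (c.ξ2 - 1)]
            _ = (1 + c.ξ2 ^ 2) * S.card * l2 := by ring
            _ ≤ _ := h1)
      rw [hc.nu21_sq]
      exact h1.trans (mul_le_mul_of_nonneg_left (empQuad_le_exp_mul a hγ.abs_lin_le)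
        (Nat.cast_nonneg _)))
  have h8 := mul_le_mul_of_nonneg_left
    ((le_add_of_nonneg_left (empQuad_nonneg D γ a)).trans key) hw.le
  refine h8.trans (le_of_eq ?_)
  rw [show 4 * c.eta13 = c.eta13 + 3 * c.eta13 by ring, Real.exp_add c.eta13 (3 * c.eta13),
    show 2 * c.eta13 = c.eta13 + c.eta13 by ring, Real.exp_add c.eta13 c.eta13, Constants.xi22,
    ← hwdef]
  ring

/-- Expansion of the difference of the estimators of the treatment mean. -/
lemma avg_phi_sub (D : Fin n → Obs d K) (α αbar γ γbar : Coef K p t) :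
    avg D (phi f α γ) - avg D (phi f αbar γbar) =
      -calGrad f D γ (α - αbar) + wlGrad f D γbar αbar (γ - γbar) +
        avg D fun o => ∑ k : {k : Fin K // k ≠ t}, weight f γbar o k * (resid f αbar o k *
          (Real.exp (lin (γ - γbar) (f o.2.2) k) - 1 - lin (γ - γbar) (f o.2.2) k)) := by
  rw [calGrad, wlGrad, ← avg_sub, ← avg_neg, ← avg_add, ← avg_add]
  congr 1; funext o
  simp only [phi, add_sub_add_left_eq_sub]
  rw [← Finset.sum_sub_distrib, ← Finset.sum_neg_distrib, ← Finset.sum_add_distrib,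
    ← Finset.sum_add_distrib]
  refine Finset.sum_congr rfl fun k _ => ?_
  -- With w, w̄ the weights at γ, γ̄ and x the predictor of γ − γ̄, each summand is −(w − R^{(k)})
  -- lin(α − ᾱ) + (w − w̄)(Y − lin ᾱ). Finally w − w̄ = w̄x + w̄(e^x − 1 − x).
  have h1 := weight_eq_mul_exp (f := f) γ γbar o k
  have h2 : ind o.2.1 t * ratio γ (f o.2.2) k = weight f γ o k := by rw [ratio_eq_exp, weight]
  have h3 : ind o.2.1 t * ratio γbar (f o.2.2) k = weight f γbar o k := by
    rw [ratio_eq_exp, weight]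
  rw [mul_right_comm, h2, mul_right_comm, h3, h1, resid, lin_sub α αbar]
  ring

/-- The Taylor remainder is at most (x²/2)e^{η₁₃}. Splitting |ρ| ≤ σ/2 + ρ²/(2σ) reduces the
residual factor to the quadratic forms without and with squared residuals, both known from the first
stage. -/
lemma abs_remainder_le (hc : c.Admissible)
    (hD : IsGoodSample f D γbar αbar c.B0 c.σ0 l1 l2 quad) {N : ℝ} (hN : 0 ≤ N)
    (hη1 : 0 ≤ c.η1) {b : Coef K p t} (hb : FirstStage f c D γbar b l1 N) :
    |avg D fun o => ∑ k : {k : Fin K // k ≠ t}, weight f γbar o k * (resid f αbar o k *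
        (Real.exp (lin b (f o.2.2) k) - 1 - lin b (f o.2.2) k))| ≤
      ((√2 + 1) * c.σ0 * c.eta14 * Real.exp c.eta13 / 2 +
        √2 * c.σ0 * c.M1 * Real.exp (2 * c.eta13) / 2) * (N * l1 ^ 2) := by
  have hσ := hc.σ0
  have hM := hc.M1_pos
  have h14 := eta14_nonneg hη1
  have h2s : (1 : ℝ) ≤ √2 := Real.one_le_sqrt.2 (by norm_num)
  set w := Real.exp c.eta13 with hw
  have hwpos : 0 < w := Real.exp_pos _
  have e2 : Real.exp (2 * c.eta13) = w * w := by rw [two_mul, Real.exp_add]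
  have hU := avg_sq_resid_le hD hb
  have hQ := hb.empQuad_le
  rw [← hw] at hU hQ
  have h1 : |avg D fun o => ∑ k : {k : Fin K // k ≠ t}, weight f γbar o k * (resid f αbar o k *
        (Real.exp (lin b (f o.2.2) k) - 1 - lin b (f o.2.2) k))| ≤
      w / 2 * (c.σ0 / 2 * empQuad f D γbar b + 1 / (2 * c.σ0) *
        avg D fun o => ∑ k : {k : Fin K // k ≠ t},
          weight f γbar o k * resid f αbar o k ^ 2 * lin b (f o.2.2) k ^ 2) := by
    refine (abs_avg_le D _).trans ?_
    rw [empQuad, ← avg_const_mul, ← avg_const_mul, ← avg_add, ← avg_const_mul]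
    refine avg_mono fun i => (Finset.abs_sum_le_sum_abs _ _).trans ?_
    simp only [Finset.mul_sum, ← Finset.sum_add_distrib]
    refine Finset.sum_le_sum fun k _ => ?_
    have hwt := weight_nonneg f γbar (D i) k
    have ha := abs_exp_sub_one_sub_le_half_sq_mul_exp (lin b (f (D i).2.2) k)
    have hb' : Real.exp |lin b (f (D i).2.2) k| ≤ w := Real.exp_le_exp.2 (hb.abs_lin_le i k)
    set x := lin b (f (D i).2.2) k
    set ρ := resid f αbar (D i) k
    set v := weight f γbar (D i) k
    have h3 : |ρ| ≤ c.σ0 / 2 + 1 / (2 * c.σ0) * ρ ^ 2 := by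
      have : c.σ0 / 2 + 1 / (2 * c.σ0) * ρ ^ 2 - |ρ| = (c.σ0 - |ρ|) ^ 2 / (2 * c.σ0) := by
        rw [← sq_abs ρ]; field_simp; ring
      have h0 : 0 ≤ (c.σ0 - |ρ|) ^ 2 / (2 * c.σ0) := by positivity
      linarith
    rw [abs_mul, abs_mul, abs_of_nonneg hwt]
    calc v * (|ρ| * |Real.exp x - 1 - x|)
        ≤ v * ((c.σ0 / 2 + 1 / (2 * c.σ0) * ρ ^ 2) * (x ^ 2 / 2 * w)) := by
          gcongr
          exact ha.trans (by gcongr)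
      _ = _ := by ring
  refine h1.trans ?_
  have h4 : 1 / (2 * c.σ0) * (avg D fun o => ∑ k : {k : Fin K // k ≠ t},
      weight f γbar o k * resid f αbar o k ^ 2 * lin b (f o.2.2) k ^ 2) ≤
      c.σ0 / 2 * w * c.M1 * (N * l1 ^ 2) + 3 / 2 * c.σ0 * c.eta14 * (N * l1 ^ 2) := by
    refine (mul_le_mul_of_nonneg_left hU (by positivity)).trans (le_of_eq ?_)
    field_simp
  have h5 := mul_le_mul_of_nonneg_left hQ (show 0 ≤ c.σ0 / 2 by positivity)
  set Z := N * l1 ^ 2 with hZdef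
  have hZ : 0 ≤ Z := by positivity
  calc w / 2 * (c.σ0 / 2 * empQuad f D γbar b + _)
      ≤ w / 2 * (c.σ0 / 2 * (w * c.M1 * Z) +
        (c.σ0 / 2 * w * c.M1 * Z + 3 / 2 * c.σ0 * c.eta14 * Z)) := by gcongr
    _ = (3 / 2 * c.σ0 * c.eta14 * w / 2 + 1 * c.σ0 * c.M1 * (w * w) / 2) * Z := by ring
    -- The argument yields the constants 3/2 and 1, which are below √2 + 1 and √2.
    _ ≤ ((√2 + 1) * c.σ0 * c.eta14 * w / 2 + √2 * c.σ0 * c.M1 * (w * w) / 2) * Z := by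
      gcongr; linarith
    _ = _ := by rw [e2]

end Deterministic

/-! ### Existence of the estimates and the deviation bound on a good sample -/

section Problem

variable {Ω₀ : Type u} {Ω : Type v} [MeasurableSpace Ω₀] [MeasurableSpace Ω] {d K p n : ℕ}
  {Q : Problem Ω₀ Ω d K p n} {c : Constants} {ε : ℝ}

lemma segment_mem_closedBall {b b₀ : Coef K p Q.t} {r s : ℝ} (hr : 0 ≤ r)
    (hb : b ∈ Metric.closedBall b₀ r) (hs : s ∈ Set.Ioc (0 : ℝ) 1) :
    b + s • (b₀ - b) ∈ Metric.closedBall b₀ r := by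
  have h := (convex_closedBall b₀ r) hb (Metric.mem_closedBall_self hr)
    (show 0 ≤ 1 - s by linarith [hs.2]) hs.1.le (by ring)
  convert h using 1
  module

/-- On a good sample the estimators exist and the deviation bound holds. -/
theorem deviationLE_of_isGoodSample (hc : c.Admissible) (hQ : Q.Conditions c ε)
    (hl1 : 0 < c.lam1 K p n ε) {quad : Coef K p Q.t → ℝ}
    (hquad : ∀ b, quad b = ∑ k : {k : Fin K // k ≠ Q.t},
        (fun j => b j k) ⬝ᵥ (Q.gram k).mulVec (fun j => b j k)) {M2 : ℝ}
    (hM2 : Q.outcomeBound c ε ≤ Real.exp c.eta13 * M2 *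
      (Q.Sγ.card * c.lam1 K p n ε * c.lam2 K p n ε + Q.Sα.card * c.lam2 K p n ε ^ 2)) {ω : Ω}
    (hD : IsGoodSample Q.f (Q.sample ω) Q.γbar Q.αbar c.B0 c.σ0 (c.lam1 K p n ε)
      (c.lam2 K p n ε) quad) :
    Q.DeviationLE c ε
      (c.M21 M2 * Q.Sγ.card * c.lam1 K p n ε ^ 2 +
        c.M22 * Q.Sγ.card * c.lam1 K p n ε * c.lam2 K p n ε +
        c.M23 M2 * Q.Sα.card * c.lam1 K p n ε * c.lam2 K p n ε) ω := by
  have hl12 : c.lam1 K p n ε ≤ c.lam2 K p n ε := le_max_left _ _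
  have hη1 := hQ.η1_bound
  rw [Problem.outcomeBound] at hM2
  set l1 := c.lam1 K p n ε with hl1def
  set l2 := c.lam2 K p n ε with hl2def
  have hl2 : 0 < l2 := hl1.trans_le hl12
  have hA1 := hc.one_lt_A1
  have hA2 := hc.one_lt_A2
  have hM1 := hc.M1_pos
  have hNγ : (0 : ℝ) ≤ Q.Sγ.card := Nat.cast_nonneg _
  have hNα : (0 : ℝ) ≤ Q.Sα.card := Nat.cast_nonneg _
  have hη0 : 0 ≤ c.η1 := le_trans (by positivity) hη1
  have hpen1 : 0 ≤ c.A1 * l1 := by positivity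
  have hpen2 : 0 ≤ c.A2 * l2 := by positivity
  -- Minimality is required only along the segment to the target. A minimizer over a ball centered
  -- at the target qualifies, so the error bound is available before existence is known.
  have hfirst : ∀ γ : Coef K p Q.t, (∀ s ∈ Set.Ioc (0 : ℝ) 1,
      avg (Q.sample ω) (calLoss Q.f γ) + c.A1 * l1 * penalty γ ≤
        avg (Q.sample ω) (calLoss Q.f (γ + s • (Q.γbar - γ))) +
          c.A1 * l1 * penalty (γ + s • (Q.γbar - γ))) →
      FirstStage Q.f c (Q.sample ω) Q.γbar (γ - Q.γbar) l1 Q.Sγ.card := fun γ hmin =>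
    firstStage_of_cal_bound hc hl1 hNγ hη1 hD.bounded
      (cal_error_bound hc hl1 hD (fun b hb => by rw [hquad]; exact hQ.compat_γ b hb)
        hQ.sparse_γ_a hQ.sparse_γ_b
        (cal_first_order Q.f hpen1 hmin fun s hs => penalty_segment_le _ _ hs))
  have hsecond : ∀ γ α : Coef K p Q.t,
      FirstStage Q.f c (Q.sample ω) Q.γbar (γ - Q.γbar) l1 Q.Sγ.card →
      (∀ s ∈ Set.Ioc (0 : ℝ) 1, avg (Q.sample ω) (wlLoss Q.f γ α) + c.A2 * l2 * penalty α ≤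
        avg (Q.sample ω) (wlLoss Q.f γ (α + s • (Q.αbar - α))) +
          c.A2 * l2 * penalty (α + s • (Q.αbar - α))) →
      groupNorm (α - Q.αbar) ≤
        (c.A2 - 1)⁻¹ * M2 * (Q.Sγ.card * l1 + Q.Sα.card * l2) := by
    intro γ α hγ hmin
    have h1 := (wl_error_bound hc hl1 hl12 hη0 hD
      (fun b hb => by rw [hquad]; exact hQ.compat_α b hb) hQ.sparse_α hNγ hγ
      (wl_first_order Q.f hpen2 hmin fun s hs => penalty_segment_le _ _ hs)).trans hM2
    have h2 : Real.exp c.eta13 * ((c.A2 - 1) * l2) * groupNorm (α - Q.αbar) ≤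
        Real.exp c.eta13 * ((c.A2 - 1) * l2) *
          ((c.A2 - 1)⁻¹ * M2 * (Q.Sγ.card * l1 + Q.Sα.card * l2)) := by
      have h3 : c.A2 - 1 ≠ 0 := by linarith
      have e : Real.exp c.eta13 * ((c.A2 - 1) * l2) *
          ((c.A2 - 1)⁻¹ * M2 * (Q.Sγ.card * l1 + Q.Sα.card * l2)) =
          Real.exp c.eta13 * M2 * (Q.Sγ.card * l1 * l2 + Q.Sα.card * l2 ^ 2) := by
        field_simp
      rw [e]; linarith
    exact le_of_mul_le_mul_left h2
      (mul_pos (Real.exp_pos _) (mul_pos (by linarith) hl2))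
  refine ⟨?_, fun γ hγ => ?_⟩
  -- The extra 1 makes the a priori error bound strictly smaller than the radius.
  · set r := (c.A1 - 1)⁻¹ * c.M1 * Q.Sγ.card * l1 + 1 with hr
    have hr0 : 0 ≤ r := by
      have : 0 ≤ (c.A1 - 1)⁻¹ := inv_nonneg.2 (by linarith)
      positivity
    refine exists_forall_le_of_convexOn
      ((continuous_avg_calLoss Q.f _).add (continuous_const.mul continuous_penalty))
      ((convexOn_avg _ (convexOn_calLoss Q.f)).add (convexOn_penalty hpen1)) Q.γbar hr0
      fun γ hγ hmin => ?_
    have h := (hfirst γ fun s hs => hmin _ (segment_mem_closedBall hr0 hγ hs)).groupNorm_le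
    linarith [norm_le_groupNorm (γ - Q.γbar)]
  · have hγ1 := hfirst γ fun s _ => hγ _
    refine ⟨?_, fun α hα => ?_⟩
    · set r := |(c.A2 - 1)⁻¹ * M2 * (Q.Sγ.card * l1 + Q.Sα.card * l2)| + 1 with hr
      have hr0 : 0 ≤ r := by positivity
      refine exists_forall_le_of_convexOn
        ((continuous_avg_wlLoss Q.f _ γ).add (continuous_const.mul continuous_penalty))
        ((convexOn_avg _ (convexOn_wlLoss Q.f γ)).add (convexOn_penalty hpen2)) Q.αbar hr0
        fun α hα hmin => ?_
      have h := hsecond γ α hγ1 fun s hs => hmin _ (segment_mem_closedBall hr0 hα hs)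
      linarith [norm_le_groupNorm (α - Q.αbar),
        le_abs_self ((c.A2 - 1)⁻¹ * M2 * (Q.Sγ.card * l1 + Q.Sα.card * l2))]
    · have hα1 := hsecond γ α hγ1 fun s _ => hα _
      -- Applied in the directions a and −a, this bounds the calibration gradient at the estimate
      -- itself by the tuning parameter times the norm of a, which no concentration at an estimated
      -- parameter could give as directly.
      have hkkt : ∀ a : Coef K p Q.t,
          0 ≤ calGrad Q.f (Q.sample ω) γ a + c.A1 * l1 * penalty a := fun a =>
        cal_first_order Q.f hpen1 (fun s _ => hγ _) fun s hs => penalty_add_smul_le _ _ hs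
      have h1 : |calGrad Q.f (Q.sample ω) γ (α - Q.αbar)| ≤
          c.A1 * l1 * ((c.A2 - 1)⁻¹ * M2 * (Q.Sγ.card * l1 + Q.Sα.card * l2)) := by
        have hp := mul_le_mul_of_nonneg_left
          ((penalty_le_groupNorm (α - Q.αbar)).trans hα1) hpen1
        have ha := hkkt (α - Q.αbar)
        have hb := hkkt (-(α - Q.αbar))
        rw [calGrad_neg, penalty_neg] at hb
        rw [abs_le]; constructor <;> linarith
      have h2 : |wlGrad Q.f (Q.sample ω) Q.γbar Q.αbar (γ - Q.γbar)| ≤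
          l2 * ((c.A1 - 1)⁻¹ * c.M1 * Q.Sγ.card * l1) :=
        (hD.outcome _).trans (mul_le_mul_of_nonneg_left hγ1.groupNorm_le hl2.le)
      have h3 := abs_remainder_le hc hD hNγ hη0 hγ1
      rw [Problem.muHat, Problem.muHat, avg_phi_sub]
      refine (abs_add_le _ _).trans ((add_le_add ((abs_add_le _ _).trans
        (add_le_add ((abs_neg _).trans_le h1) h2)) h3).trans (le_of_eq ?_))
      rw [Constants.M21, Constants.M22, Constants.M23]
      ring

end Problem

/-! ### Conditioning on the covariates -/

section Conditioning

variable {Ω₀ : Type u} [MeasurableSpace Ω₀] {d : ℕ} {P : Measure Ω₀} [IsProbabilityMeasure P]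
  {X : Ω₀ → Fin d → ℝ}

/-- The tower property with an X-measurable multiplier pulled out; all later uses of sub-gaussianity
integrate against such multipliers. -/
lemma CondSubGaussian.integral_mul_le {Z : Ω₀ → ℝ} {σ : ℝ} (h : CondSubGaussian P X Z σ)
    (hX : Measurable X) {g : Ω₀ → ℝ}
    (hg : StronglyMeasurable[MeasurableSpace.comap X inferInstance] g) {C : ℝ}
    (h0 : ∀ᵐ w ∂P, 0 ≤ g w) (hC : ∀ᵐ w ∂P, g w ≤ C) :
    Integrable (fun w => g w * Real.exp (Z w ^ 2 / σ ^ 2)) P ∧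
      ∫ w, g w * Real.exp (Z w ^ 2 / σ ^ 2) ∂P ≤ 2 * ∫ w, g w ∂P := by
  have hm : MeasurableSpace.comap X inferInstance ≤ (inferInstance : MeasurableSpace Ω₀) :=
    hX.comap_le
  have hgm : AEStronglyMeasurable g P := (hg.mono hm).aestronglyMeasurable
  have hgC : ∀ᵐ w ∂P, ‖g w‖ ≤ C := by
    filter_upwards [h0, hC] with w h0 h1
    rwa [Real.norm_of_nonneg h0]
  have hgi : Integrable g P := Integrable.of_bound hgm C hgC
  have hint : Integrable (g * fun w => Real.exp (Z w ^ 2 / σ ^ 2)) P := h.1.bdd_mul hgm hgC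
  refine ⟨hint, ?_⟩
  have hce := condExp_mul_of_stronglyMeasurable_left hg hint h.1
  have e1 := integral_condExp hm (f := g * fun w => Real.exp (Z w ^ 2 / σ ^ 2)) (μ := P)
  have e2 : ∫ w, g w * Real.exp (Z w ^ 2 / σ ^ 2) ∂P =
      ∫ w, (g * P[fun w => Real.exp (Z w ^ 2 / σ ^ 2) |
        MeasurableSpace.comap X inferInstance]) w ∂P := by
    rw [← integral_congr_ae hce, e1]; rfl
  rw [e2, ← integral_const_mul]
  refine integral_mono_ae (integrable_condExp.congr hce) (hgi.const_mul 2) ?_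
  filter_upwards [h0, h.2] with w h0 h2
  simp only [Pi.mul_apply]
  nlinarith

/-- Under conditional independence, the event can be replaced by its conditional probability. -/
lemma CondIndepGiven.lintegral_eq {A : Set Ω₀} {Z : Ω₀ → ℝ} (h : CondIndepGiven P X A Z)
    (hX : Measurable X) (hA : MeasurableSet A) (hZ : Measurable Z)
    {Φ : (Fin d → ℝ) × ℝ → ENNReal} (hΦ : Measurable Φ) :
    ∫⁻ w in A, Φ (X w, Z w) ∂P = ∫⁻ w, ENNReal.ofReal ((P[A.indicator (fun _ => (1 : ℝ)) |
      MeasurableSpace.comap X inferInstance]) w) * Φ (X w, Z w) ∂P := by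
  have hm : MeasurableSpace.comap X inferInstance ≤ (inferInstance : MeasurableSpace Ω₀) :=
    hX.comap_le
  set π := P[A.indicator (fun _ => (1 : ℝ)) | MeasurableSpace.comap X inferInstance] with hπ
  have hπm : StronglyMeasurable[MeasurableSpace.comap X inferInstance] π :=
    stronglyMeasurable_condExp
  have hπm' : Measurable π := (hπm.mono hm).measurable
  have hXZ : Measurable fun w => (X w, Z w) := hX.prodMk hZ
  have hone : ∀ B : Set Ω₀, MeasurableSet B → Integrable (B.indicator fun _ => (1 : ℝ)) P :=
    fun B hB => (integrable_const _).indicator hB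
  have hπ0 : 0 ≤ᵐ[P] π := condExp_nonneg (ae_of_all _ fun w =>
    Set.indicator_nonneg (fun _ _ => zero_le_one) w)
  have hπi : Integrable π P := integrable_condExp
  -- On the joint law of (X, Z), restricting to A is the same as taking π as density. Finite
  -- measures on a product are determined by rectangles, where the identity is conditional
  -- independence.
  have key : (P.restrict A).map (fun w => (X w, Z w)) =
      (P.withDensity fun w => ENNReal.ofReal (π w)).map (fun w => (X w, Z w)) := by
    have : IsFiniteMeasure ((P.restrict A).map fun w => (X w, Z w)) :=
      Measure.isFiniteMeasure_map _ _
    refine Measure.ext_prod fun {s u} hs hu => ?_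
    have hXs : MeasurableSet[MeasurableSpace.comap X inferInstance] (X ⁻¹' s) := ⟨s, hs, rfl⟩
    have hZu : MeasurableSet (Z ⁻¹' u) := hZ hu
    have hpre : (fun w => (X w, Z w)) ⁻¹' (s ×ˢ u) = X ⁻¹' s ∩ Z ⁻¹' u := rfl
    rw [Measure.map_apply hXZ (hs.prod hu), Measure.map_apply hXZ (hs.prod hu), hpre,
      Measure.restrict_apply ((hm _ hXs).inter hZu),
      withDensity_apply _ ((hm _ hXs).inter hZu),
      ← ofReal_integral_eq_lintegral_ofReal hπi.integrableOn (ae_restrict_of_ae hπ0)]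
    have hpu : Integrable (π * (Z ⁻¹' u).indicator fun _ => (1 : ℝ)) P := by
      have : (π * (Z ⁻¹' u).indicator fun _ => (1 : ℝ)) = (Z ⁻¹' u).indicator π := by
        funext w; by_cases hw : w ∈ Z ⁻¹' u <;> simp [hw]
      rw [this]; exact hπi.indicator hZu
    have e1 : ∫ w in X ⁻¹' s ∩ Z ⁻¹' u, π w ∂P =
        ∫ w in X ⁻¹' s, (π * (Z ⁻¹' u).indicator fun _ => (1 : ℝ)) w ∂P := by
      rw [← setIntegral_indicator hZu]
      refine integral_congr_ae (ae_of_all _ fun w => ?_)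
      by_cases hw : w ∈ Z ⁻¹' u <;> simp [hw]
    have e2 := setIntegral_condExp hm hpu hXs
    -- The factor π is X-measurable and comes out of the conditional expectation; the product of
    -- conditional probabilities is then that of the intersection.
    have e3 : ∫ w in X ⁻¹' s, (P[π * (Z ⁻¹' u).indicator fun _ => (1 : ℝ) |
        MeasurableSpace.comap X inferInstance]) w ∂P =
        ∫ w in X ⁻¹' s, (P[(A ∩ Z ⁻¹' u).indicator (fun _ => (1 : ℝ)) |
          MeasurableSpace.comap X inferInstance]) w ∂P := by
      refine integral_congr_ae (ae_restrict_of_ae ?_)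
      refine (condExp_mul_of_stronglyMeasurable_left hπm hpu (hone _ hZu)).trans ?_
      exact (h u hu).symm
    have e4 := setIntegral_condExp hm (hone _ (hA.inter hZu)) hXs
    rw [e1, ← e2, e3, e4, setIntegral_indicator (hA.inter hZu)]
    simp only [integral_const, smul_eq_mul, mul_one, measureReal_restrict_apply_univ]
    rw [ofReal_measureReal]
    congr 1
    ext w; simp only [Set.mem_inter_iff]; tauto
  calc ∫⁻ w in A, Φ (X w, Z w) ∂P
      = ∫⁻ q, Φ q ∂((P.restrict A).map fun w => (X w, Z w)) := (lintegral_map hΦ hXZ).symm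
    _ = ∫⁻ w, Φ (X w, Z w) ∂(P.withDensity fun w => ENNReal.ofReal (π w)) := by
        rw [key, lintegral_map hΦ hXZ]
    _ = _ := by
        exact lintegral_withDensity_eq_lintegral_mul _ hπm'.ennreal_ofReal (hΦ.comp hXZ)

/-- The conditional second moment of the residual, on an event that is conditionally independent
of the outcome. -/
lemma CondIndepGiven.setIntegral_sq_le {A : Set Ω₀} {Z : Ω₀ → ℝ} (h : CondIndepGiven P X A Z)
    (hX : Measurable X) (hA : MeasurableSet A) (hZ : Measurable Z) {m g : (Fin d → ℝ) → ℝ}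
    (hm : Measurable m) (hg : Measurable g) (hg0 : ∀ x, 0 ≤ g x) {C : ℝ}
    (hgC : ∀ᵐ w ∂P, g (X w) ≤ C) {σ : ℝ} (hσ : 0 < σ)
    (hsub : CondSubGaussian P X (fun w => Z w - m (X w)) σ) :
    ∫ w in A, g (X w) * (Z w - m (X w)) ^ 2 ∂P ≤ σ ^ 2 * ∫ w in A, g (X w) ∂P := by
  have hcm : MeasurableSpace.comap X inferInstance ≤ (inferInstance : MeasurableSpace Ω₀) :=
    hX.comap_le
  set π := P[A.indicator (fun _ => (1 : ℝ)) | MeasurableSpace.comap X inferInstance] with hπ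
  have hπm : StronglyMeasurable[MeasurableSpace.comap X inferInstance] π :=
    stronglyMeasurable_condExp
  have hπ0 : 0 ≤ᵐ[P] π := condExp_nonneg (ae_of_all _ fun w =>
    Set.indicator_nonneg (fun _ _ => zero_le_one) w)
  have hπ1 : ∀ᵐ w ∂P, π w ≤ 1 := by
    have h1 := condExp_mono (m := MeasurableSpace.comap X inferInstance) (μ := P)
      ((integrable_const (1 : ℝ)).indicator hA) (integrable_const (1 : ℝ))
      (ae_of_all _ fun w => Set.indicator_le_self' (fun _ _ => zero_le_one) w)
    rw [condExp_const hcm] at h1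
    exact h1
  have hgX : StronglyMeasurable[MeasurableSpace.comap X inferInstance] fun w => g (X w) :=
    (hg.comp (comap_measurable X)).stronglyMeasurable
  have hgX' : Measurable fun w => g (X w) := hg.comp hX
  have hπX' : Measurable π := (hπm.mono hcm).measurable
  have hρ : Measurable fun w => Z w - m (X w) := hZ.sub (hm.comp hX)
  have hb0 : ∀ᵐ w ∂P, 0 ≤ π w * g (X w) := by
    filter_upwards [hπ0] with w hw using mul_nonneg hw (hg0 _)
  have hbC : ∀ᵐ w ∂P, π w * g (X w) ≤ C := by
    filter_upwards [hπ1, hgC] with w h1 h2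
    nlinarith [hg0 (X w)]
  obtain ⟨hi, hle⟩ := hsub.integral_mul_le hX (hπm.mul hgX) hb0 hbC
  simp only [Pi.mul_apply] at hi hle
  have hpgi : Integrable (fun w => π w * g (X w)) P := by
    refine Integrable.of_bound (hπX'.mul hgX').aestronglyMeasurable C ?_
    filter_upwards [hb0, hbC] with w h0 h1
    rwa [Real.norm_of_nonneg h0]
  have htrans : ∀ φ : (Fin d → ℝ) × ℝ → ℝ, Measurable φ → (∀ q, 0 ≤ φ q) →
      ∫ w in A, φ (X w, Z w) ∂P = ∫ w, π w * φ (X w, Z w) ∂P := by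
    intro φ hφ hφ0
    have hφm : Measurable fun w => φ (X w, Z w) := hφ.comp (hX.prodMk hZ)
    have hm2 : AEStronglyMeasurable (fun w => π w * φ (X w, Z w)) P :=
      (hπX'.mul hφm).aestronglyMeasurable
    rw [integral_eq_lintegral_of_nonneg_ae (ae_of_all _ fun w => hφ0 _)
      hφm.aestronglyMeasurable,
      integral_eq_lintegral_of_nonneg_ae (by
        filter_upwards [hπ0] with w hw using mul_nonneg hw (hφ0 _)) hm2,
      h.lintegral_eq hX hA hZ hφ.ennreal_ofReal]
    congr 1
    refine lintegral_congr_ae ?_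
    filter_upwards [hπ0] with w hw
    rw [ENNReal.ofReal_mul hw]
  have e1 := htrans (fun q => g q.1 * (q.2 - m q.1) ^ 2)
    ((hg.comp measurable_fst).mul ((measurable_snd.sub (hm.comp measurable_fst)).pow_const 2))
    (fun q => mul_nonneg (hg0 _) (sq_nonneg _))
  have e2 := htrans (fun q => g q.1) (hg.comp measurable_fst) (fun q => hg0 _)
  simp only at e1 e2
  rw [e1, e2]
  -- From y ≤ e^y − 1 with y = ρ²/σ². The −1 matters: an exponential moment of at most 2 then gives
  -- a second moment of at most σ², without a factor 2.
  have hbound : ∀ᵐ w ∂P, π w * (g (X w) * (Z w - m (X w)) ^ 2) ≤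
      σ ^ 2 * (π w * g (X w) * Real.exp ((Z w - m (X w)) ^ 2 / σ ^ 2) - π w * g (X w)) := by
    filter_upwards [hb0] with w hw
    have h1 := Real.add_one_le_exp ((Z w - m (X w)) ^ 2 / σ ^ 2)
    have h2 : (Z w - m (X w)) ^ 2 = σ ^ 2 * ((Z w - m (X w)) ^ 2 / σ ^ 2) := by field_simp
    have h3 : (Z w - m (X w)) ^ 2 ≤
        σ ^ 2 * (Real.exp ((Z w - m (X w)) ^ 2 / σ ^ 2) - 1) := by
      have := mul_le_mul_of_nonneg_left (show (Z w - m (X w)) ^ 2 / σ ^ 2 ≤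
        Real.exp ((Z w - m (X w)) ^ 2 / σ ^ 2) - 1 by linarith) (sq_nonneg σ)
      linarith
    have := mul_le_mul_of_nonneg_left h3 hw
    linarith
  have hmono := integral_mono_of_nonneg (by
      filter_upwards [hπ0] with w hw
      exact mul_nonneg hw (mul_nonneg (hg0 _) (sq_nonneg _)))
    ((hi.sub hpgi).const_mul (σ ^ 2)) hbound
  refine hmono.trans ?_
  have e3 : ∫ w, σ ^ 2 * ((fun w => π w * g (X w) * Real.exp ((Z w - m (X w)) ^ 2 / σ ^ 2)) -
      fun w => π w * g (X w)) w ∂P = σ ^ 2 * (∫ w, π w * g (X w) *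
        Real.exp ((Z w - m (X w)) ^ 2 / σ ^ 2) ∂P - ∫ w, π w * g (X w) ∂P) := by
    rw [integral_const_mul]; congr 1; exact integral_sub hi hpgi
  rw [e3]
  exact mul_le_mul_of_nonneg_left (by linarith) (sq_nonneg σ)

end Conditioning

/-! ### Population quantities -/

section Measurability

variable {d K p : ℕ} {t : Fin K} {f : (Fin d → ℝ) → Fin (p + 1) → ℝ}

lemma measurable_lin (b : Coef K p t) (k : {k : Fin K // k ≠ t}) :
    Measurable fun v : Fin (p + 1) → ℝ => lin b v k := by
  unfold lin; fun_prop

lemma measurable_lin_comp (hf : Measurable f) (b : Coef K p t) (k : {k : Fin K // k ≠ t}) :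
    Measurable fun o : Obs d K => lin b (f o.2.2) k :=
  (measurable_lin b k).comp (hf.comp measurable_snd.snd)

lemma measurable_coord (hf : Measurable f) (j : Fin (p + 1)) :
    Measurable fun o : Obs d K => f o.2.2 j :=
  (measurable_pi_apply j).comp (hf.comp measurable_snd.snd)

lemma measurable_ind (k : Fin K) : Measurable fun o : Obs d K => ind o.2.1 k :=
  (measurable_of_finite fun T => ind T k).comp measurable_snd.fst

lemma measurable_weight (hf : Measurable f) (γ : Coef K p t) (k : {k : Fin K // k ≠ t}) :
    Measurable fun o : Obs d K => weight f γ o k :=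
  (measurable_ind t).mul (measurable_lin_comp hf γ k).exp

lemma measurable_resid (hf : Measurable f) (α : Coef K p t) (k : {k : Fin K // k ≠ t}) :
    Measurable fun o : Obs d K => resid f α o k :=
  measurable_fst.sub (measurable_lin_comp hf α k)

lemma measurable_calLoss (hf : Measurable f) (γ : Coef K p t) :
    Measurable (calLoss (d := d) f γ) := by
  unfold calLoss
  exact Finset.measurable_fun_sum _ fun k _ =>
    ((measurable_ind t).mul (measurable_lin_comp hf γ k).exp).sub
      ((measurable_ind k).mul (measurable_lin_comp hf γ k))

end Measurability

lemma nonneg_of_forall_small {G C s₀ : ℝ} (hs₀ : 0 < s₀)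
    (h : ∀ s, 0 < s → s ≤ s₀ → 0 ≤ s * G + s ^ 2 * C) : 0 ≤ G := by
  have hcont : Tendsto (fun s : ℝ => G + s * C) (𝓝[>] 0) (𝓝 G) := by
    have : Continuous fun s : ℝ => G + s * C := by fun_prop
    simpa using (this.tendsto 0).mono_left nhdsWithin_le_nhds
  refine ge_of_tendsto hcont ?_
  filter_upwards [Ioc_mem_nhdsGT hs₀] with s hs
  have h1 := h s hs.1 hs.2
  have h2 : s * G + s ^ 2 * C = s * (G + s * C) := by ring
  rw [h2] at h1
  exact nonneg_of_mul_nonneg_right h1 hs.1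

/-- First-order condition at a minimum from a quadratic upper bound on the increment in both
directions. It replaces differentiation under the integral for the two population losses. -/
lemma eq_zero_of_forall_small {G C s₀ : ℝ} (hs₀ : 0 < s₀)
    (h : ∀ s, |s| ≤ s₀ → 0 ≤ s * G + s ^ 2 * C) : G = 0 := by
  refine le_antisymm ?_ (nonneg_of_forall_small hs₀ fun s hs hs' =>
    h s (by rwa [abs_of_pos hs]))
  have := nonneg_of_forall_small (G := -G) (C := C) hs₀ fun s hs hs' => by
    have := h (-s) (by rwa [abs_neg, abs_of_pos hs])
    linarith [this, show -s * G + (-s) ^ 2 * C = s * -G + s ^ 2 * C by ring]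
  linarith

namespace Problem

variable {Ω₀ : Type u} {Ω : Type v} [MeasurableSpace Ω₀] [MeasurableSpace Ω] {d K p n : ℕ}
  {Q : Problem Ω₀ Ω d K p n} {c : Constants} {ε : ℝ}

/-- The observed data of a member of the population. -/
def pop (Q : Problem Ω₀ Ω d K p n) (w : Ω₀) : Obs d K := (Q.Ypot (Q.T w) w, Q.T w, Q.X w)

lemma measurable_pop (Q : Problem Ω₀ Ω d K p n) : Measurable Q.pop := by
  have h : Measurable fun q : Fin K × Ω₀ => Q.Ypot q.1 q.2 :=
    measurable_from_prod_countable_right fun k => Q.measurable_Ypot k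
  exact (h.comp (Q.measurable_T.prodMk measurable_id)).prodMk
    (Q.measurable_T.prodMk Q.measurable_X)

/-- The residual of the potential outcome at the target value of the outcome model. -/
abbrev potResid (Q : Problem Ω₀ Ω d K p n) (w : Ω₀)
    (k : {k : Fin K // k ≠ Q.t}) : ℝ :=
  Q.Ypot Q.t w - lin Q.αbar (Q.f (Q.X w)) k

lemma measurable_potResid (Q : Problem Ω₀ Ω d K p n)
    (k : {k : Fin K // k ≠ Q.t}) : Measurable fun w => Q.potResid w k :=
  (Q.measurable_Ypot _).sub
    ((measurable_lin Q.αbar k).comp (Q.measurable_f.comp Q.measurable_X))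

/-- The weight vanishes unless T = t, and there the observed outcome is the potential one. -/
lemma weight_mul_resid (Q : Problem Ω₀ Ω d K p n) (γ : Coef K p Q.t)
    (w : Ω₀) (k : {k : Fin K // k ≠ Q.t}) (φ : ℝ → ℝ) :
    weight Q.f γ (Q.pop w) k * φ (resid Q.f Q.αbar (Q.pop w) k) =
      weight Q.f γ (Q.pop w) k * φ (Q.potResid w k) := by
  by_cases h : Q.T w = Q.t
  · simp only [resid, pop, potResid, h]
  · simp [weight, pop, ind, h]

/-- The population quadratic form. -/
noncomputable def popQuad (Q : Problem Ω₀ Ω d K p n) (b : Coef K p Q.t) : ℝ :=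
  ∫ w, ∑ k : {k : Fin K // k ≠ Q.t},
    weight Q.f Q.γbar (Q.pop w) k * lin b (Q.f (Q.X w)) k ^ 2 ∂Q.P

namespace Conditions

lemma ae_bounded (hQ : Q.Conditions c ε) (hc : c.Admissible) :
    ∀ᵐ w ∂Q.P, ∀ j, |Q.f (Q.X w) j| ≤ c.B0 := by
  filter_upwards [hQ.bounded] with w hw j
  refine Fin.cases ?_ (fun j => hw j) j
  rw [Q.f_zero, abs_one]; exact hc.B0

lemma ae_sum_exp_le (hQ : Q.Conditions c ε) : ∀ᵐ w ∂Q.P,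
    ∑ k : {k : Fin K // k ≠ Q.t}, Real.exp (lin Q.γbar (Q.f (Q.X w)) k) ≤ c.B1 - 1 := by
  filter_upwards [hQ.overlap] with w hw
  rw [inv_propScore] at hw; linarith

lemma ae_sum_weight_le (hQ : Q.Conditions c ε) : ∀ᵐ w ∂Q.P,
    ∑ k : {k : Fin K // k ≠ Q.t}, weight Q.f Q.γbar (Q.pop w) k ≤ c.B1 - 1 := by
  filter_upwards [hQ.ae_sum_exp_le] with w hw
  refine le_trans (Finset.sum_le_sum fun k _ => ?_) hw
  exact mul_le_of_le_one_left (Real.exp_pos _).le (ind_le_one _ _)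

lemma ae_weight_le (hQ : Q.Conditions c ε) :
    ∀ᵐ w ∂Q.P, ∀ k, weight Q.f Q.γbar (Q.pop w) k ≤ c.B1 - 1 := by
  filter_upwards [hQ.ae_sum_weight_le] with w hw k
  exact (Finset.single_le_sum (f := fun k => weight Q.f Q.γbar (Q.pop w) k)
    (fun k _ => weight_nonneg _ _ _ _) (Finset.mem_univ k)).trans hw

lemma integrable_calLoss (hQ : Q.Conditions c ε) (hc : c.Admissible) (γ : Coef K p Q.t) :
    Integrable (fun w => calLoss Q.f γ (Q.pop w)) Q.P := by
  have := Q.isProb_P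
  refine Integrable.of_bound
    ((measurable_calLoss Q.measurable_f γ).comp Q.measurable_pop).aestronglyMeasurable
    (∑ _k : {k : Fin K // k ≠ Q.t}, (Real.exp (c.B0 * groupNorm γ) + c.B0 * groupNorm γ)) ?_
  filter_upwards [hQ.ae_bounded hc] with w hw
  refine (norm_sum_le _ _).trans (Finset.sum_le_sum fun k _ => (norm_sub_le _ _).trans ?_)
  have hl := abs_lin_le hw γ k
  rw [Real.norm_eq_abs, Real.norm_eq_abs, abs_mul, abs_mul, Real.abs_exp,
    abs_of_nonneg (ind_nonneg _ _), abs_of_nonneg (ind_nonneg _ _)]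
  have h1 : Real.exp (lin γ (Q.f (Q.X w)) k) ≤ Real.exp (c.B0 * groupNorm γ) :=
    Real.exp_le_exp.2 ((le_abs_self _).trans hl)
  exact add_le_add
    ((mul_le_of_le_one_left (Real.exp_pos _).le (ind_le_one _ _)).trans h1)
    ((mul_le_of_le_one_left (abs_nonneg _) (ind_le_one _ _)).trans hl)

lemma integrable_calScore (hQ : Q.Conditions c ε) (hc : c.Admissible) (b : Coef K p Q.t) :
    Integrable (fun w => ∑ k : {k : Fin K // k ≠ Q.t},
      (weight Q.f Q.γbar (Q.pop w) k - ind (Q.T w) k) * lin b (Q.f (Q.X w)) k) Q.P := by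
  have := Q.isProb_P
  refine integrable_finsetSum _ fun k _ => ?_
  refine Integrable.of_bound ((((measurable_weight Q.measurable_f Q.γbar k).sub
    (measurable_ind (k : Fin K))).mul (measurable_lin_comp Q.measurable_f b k)).comp
    Q.measurable_pop).aestronglyMeasurable ((c.B1 - 1 + 1) * (c.B0 * groupNorm b)) ?_
  filter_upwards [hQ.ae_bounded hc, hQ.ae_weight_le] with w hw hw'
  have hl := abs_lin_le hw b k
  rw [Real.norm_eq_abs, abs_mul]
  refine mul_le_mul ((abs_sub _ _).trans (add_le_add ?_ ?_)) hl (abs_nonneg _) ?_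
  · rw [abs_of_nonneg (weight_nonneg _ _ _ _)]; exact hw' k
  · rw [abs_of_nonneg (ind_nonneg _ _)]; exact ind_le_one _ _
  · linarith [hc.B1]

/-- First-order condition for the target value of the propensity score model. -/
lemma integral_calScore (hQ : Q.Conditions c ε) (hc : c.Admissible) (b : Coef K p Q.t) :
    ∫ w, ∑ k : {k : Fin K // k ≠ Q.t},
      (weight Q.f Q.γbar (Q.pop w) k - ind (Q.T w) k) * lin b (Q.f (Q.X w)) k ∂Q.P = 0 := by
  have := Q.isProb_P
  set M := c.B0 * groupNorm b with hM
  have hM0 : 0 ≤ M := mul_nonneg (by linarith [hc.B0]) (groupNorm_nonneg b)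
  -- This range keeps |s|·M ≤ 1, so that e^{sx} ≤ 1 + sx + (sx)² for every predictor x of the
  -- direction.
  refine eq_zero_of_forall_small (s₀ := 1 / (M + 1)) (C := (c.B1 - 1) * M ^ 2) (by positivity)
    fun s hs => ?_
  have hsM : |s| * M ≤ 1 := by
    rw [le_div_iff₀ (by positivity)] at hs
    nlinarith [abs_nonneg s]
  have hmin := Q.γbar_min (Q.γbar + s • b)
  have hG := hQ.integrable_calScore hc b
  have hle : ∀ᵐ w ∂Q.P, calLoss Q.f (Q.γbar + s • b) (Q.pop w) ≤
      calLoss Q.f Q.γbar (Q.pop w) + (s * (∑ k : {k : Fin K // k ≠ Q.t},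
        (weight Q.f Q.γbar (Q.pop w) k - ind (Q.T w) k) * lin b (Q.f (Q.X w)) k) +
        s ^ 2 * ((c.B1 - 1) * M ^ 2)) := by
    filter_upwards [hQ.ae_bounded hc, hQ.ae_sum_weight_le] with w hw hw'
    have h1 : ∀ k : {k : Fin K // k ≠ Q.t},
        ind (Q.T w) Q.t * Real.exp (lin (Q.γbar + s • b) (Q.f (Q.X w)) k) -
          ind (Q.T w) k * lin (Q.γbar + s • b) (Q.f (Q.X w)) k ≤
        (ind (Q.T w) Q.t * Real.exp (lin Q.γbar (Q.f (Q.X w)) k) -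
          ind (Q.T w) k * lin Q.γbar (Q.f (Q.X w)) k) +
        (s * ((weight Q.f Q.γbar (Q.pop w) k - ind (Q.T w) k) * lin b (Q.f (Q.X w)) k) +
          weight Q.f Q.γbar (Q.pop w) k * (s ^ 2 * M ^ 2)) := by
      intro k
      have hl := abs_lin_le hw b k
      rw [← hM] at hl
      rw [lin_add, lin_smul, Real.exp_add]
      set x := lin b (Q.f (Q.X w)) k
      have hx : |s * x| ≤ 1 := by
        rw [abs_mul]
        exact (mul_le_mul_of_nonneg_left hl (abs_nonneg s)).trans hsM
      have h2 := (abs_le.1 (Real.abs_exp_sub_one_sub_id_le hx)).2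
      have h3 : (s * x) ^ 2 ≤ s ^ 2 * M ^ 2 := by
        rw [mul_pow, ← sq_abs x]; gcongr
      have h4 : Real.exp (s * x) ≤ 1 + s * x + s ^ 2 * M ^ 2 := by linarith
      have h5 := mul_le_mul_of_nonneg_left h4 (weight_nonneg Q.f Q.γbar (Q.pop w) k)
      simp only [weight, pop] at h5 ⊢
      linarith
    have h6 := Finset.sum_le_sum fun k (_ : k ∈ Finset.univ) => h1 k
    rw [Finset.sum_add_distrib, Finset.sum_add_distrib, ← Finset.mul_sum, ← Finset.sum_mul] at h6
    have h7 := mul_le_mul_of_nonneg_right hw' (show 0 ≤ s ^ 2 * M ^ 2 by positivity)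
    simp only [calLoss]
    refine h6.trans ?_
    have e : s ^ 2 * ((c.B1 - 1) * M ^ 2) = (c.B1 - 1) * (s ^ 2 * M ^ 2) := by ring
    rw [e]
    exact add_le_add le_rfl (add_le_add le_rfl h7)
  have h8 := integral_mono_ae (hQ.integrable_calLoss hc (Q.γbar + s • b))
    ((hQ.integrable_calLoss hc Q.γbar).add ((hG.const_mul s).add (integrable_const _))) hle
  have h9 := integral_add (hQ.integrable_calLoss hc Q.γbar)
    ((hG.const_mul s).add (integrable_const (s ^ 2 * ((c.B1 - 1) * M ^ 2))))
  have h10 := integral_add (hG.const_mul s)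
    (integrable_const (μ := Q.P) (s ^ 2 * ((c.B1 - 1) * M ^ 2)))
  rw [integral_const_mul, integral_const, probReal_univ, one_smul] at h10
  simp only [Pi.add_apply] at h8 h9
  rw [h9, h10] at h8
  have h11 : ∫ w, calLoss Q.f Q.γbar (Q.pop w) ∂Q.P ≤
    ∫ w, calLoss Q.f (Q.γbar + s • b) (Q.pop w) ∂Q.P := hmin
  linarith

lemma integrable_sq_potResid (hQ : Q.Conditions c ε) (hc : c.Admissible)
    (k : {k : Fin K // k ≠ Q.t}) :
    Integrable (fun w => Q.potResid w k ^ 2) Q.P := by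
  have hσ := hc.σ0
  refine ((hQ.subGaussian k).1.const_mul (c.σ0 ^ 2)).mono'
    ((Q.measurable_potResid k).pow_const 2).aestronglyMeasurable (ae_of_all _ fun w => ?_)
  rw [Real.norm_of_nonneg (sq_nonneg _)]
  have h1 := Real.add_one_le_exp (Q.potResid w k ^ 2 / c.σ0 ^ 2)
  have h2 : Q.potResid w k ^ 2 = c.σ0 ^ 2 * (Q.potResid w k ^ 2 / c.σ0 ^ 2) := by field_simp
  have := mul_le_mul_of_nonneg_left (show Q.potResid w k ^ 2 / c.σ0 ^ 2 ≤
        Real.exp (Q.potResid w k ^ 2 / c.σ0 ^ 2) by linarith) (sq_nonneg c.σ0)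
  linarith

/-- A bounded multiple of a function of the residual that is at most quadratic is integrable. -/
lemma integrable_mul_potResid (hQ : Q.Conditions c ε) (hc : c.Admissible)
    {g : Ω₀ → ℝ} (hg : Measurable g) {C : ℝ}
    (hC : ∀ᵐ w ∂Q.P, |g w| ≤ C) (k : {k : Fin K // k ≠ Q.t}) {φ : ℝ → ℝ} (hφ : Measurable φ)
    (hφ2 : ∀ x, |φ x| ≤ 1 + x ^ 2) :
    Integrable (fun w => g w * φ (Q.potResid w k)) Q.P := by
  have := Q.isProb_P
  have h1 : Integrable (fun w => φ (Q.potResid w k)) Q.P :=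
    ((integrable_const 1).add (hQ.integrable_sq_potResid hc k)).mono'
      (hφ.comp (Q.measurable_potResid k)).aestronglyMeasurable
      (ae_of_all _ fun w => hφ2 _)
  exact h1.bdd_mul hg.aestronglyMeasurable hC

lemma integrable_wlScore (hQ : Q.Conditions c ε) (hc : c.Admissible) (a : Coef K p Q.t) :
    Integrable (fun w => ∑ k : {k : Fin K // k ≠ Q.t}, weight Q.f Q.γbar (Q.pop w) k *
      resid Q.f Q.αbar (Q.pop w) k * lin a (Q.f (Q.X w)) k) Q.P := by
  refine integrable_finsetSum _ fun k _ => ?_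
  have h := hQ.integrable_mul_potResid hc
    (g := fun w => lin a (Q.f (Q.X w)) k * weight Q.f Q.γbar (Q.pop w) k)
    (((measurable_lin_comp Q.measurable_f a k).mul
      (measurable_weight Q.measurable_f Q.γbar k)).comp Q.measurable_pop)
    (C := c.B0 * groupNorm a * (c.B1 - 1)) (by
      filter_upwards [hQ.ae_bounded hc, hQ.ae_weight_le] with w hw hw'
      rw [abs_mul, abs_of_nonneg (weight_nonneg _ _ _ _)]
      exact mul_le_mul (abs_lin_le hw a k) (hw' k) (weight_nonneg _ _ _ _)
        (mul_nonneg (by linarith [hc.B0]) (groupNorm_nonneg a))) k (φ := fun x => x)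
    measurable_id (fun x => by rw [abs_le]; constructor <;> nlinarith)
  refine h.congr (ae_of_all _ fun w => ?_)
  have := Q.weight_mul_resid Q.γbar w k fun x => x
  simp only at this ⊢
  rw [this]; ring

lemma integrable_quad (hQ : Q.Conditions c ε) (hc : c.Admissible) (a : Coef K p Q.t) :
    Integrable (fun w => ∑ k : {k : Fin K // k ≠ Q.t}, weight Q.f Q.γbar (Q.pop w) k *
      lin a (Q.f (Q.X w)) k ^ 2) Q.P := by
  have := Q.isProb_P
  refine integrable_finsetSum _ fun k _ => ?_
  refine Integrable.of_bound (((measurable_weight Q.measurable_f Q.γbar k).mul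
    ((measurable_lin_comp Q.measurable_f a k).pow_const 2)).comp
    Q.measurable_pop).aestronglyMeasurable ((c.B1 - 1) * (c.B0 * groupNorm a) ^ 2) ?_
  filter_upwards [hQ.ae_bounded hc, hQ.ae_weight_le] with w hw hw'
  rw [Real.norm_of_nonneg (mul_nonneg (weight_nonneg _ _ _ _) (sq_nonneg _)), ← sq_abs]
  exact mul_le_mul (hw' k) (pow_le_pow_left₀ (abs_nonneg _) (abs_lin_le hw a k) 2)
    (by positivity) (by linarith [hc.B1])

lemma integrable_wlLoss (hQ : Q.Conditions c ε) (hc : c.Admissible) :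
    Integrable (fun w => wlLoss Q.f Q.γbar Q.αbar (Q.pop w)) Q.P := by
  refine integrable_finsetSum _ fun k _ => ?_
  have h := hQ.integrable_mul_potResid hc
    (g := fun w => weight Q.f Q.γbar (Q.pop w) k)
    ((measurable_weight Q.measurable_f Q.γbar k).comp Q.measurable_pop)
    (C := c.B1 - 1) (by
      filter_upwards [hQ.ae_weight_le] with w hw'
      rw [abs_of_nonneg (weight_nonneg _ _ _ _)]
      exact hw' k) k (φ := fun x => x ^ 2 / 2)
    (by fun_prop) (fun x => by rw [abs_of_nonneg (by positivity)]; nlinarith [sq_nonneg x])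
  refine h.congr (ae_of_all _ fun w => ?_)
  have := Q.weight_mul_resid Q.γbar w k fun x => x ^ 2 / 2
  simp only at this ⊢
  rw [← this, weight, resid]; ring

/-- First-order condition for the target value of the outcome model. -/
lemma integral_wlScore (hQ : Q.Conditions c ε) (hc : c.Admissible) (a : Coef K p Q.t) :
    ∫ w, ∑ k : {k : Fin K // k ≠ Q.t}, weight Q.f Q.γbar (Q.pop w) k *
      resid Q.f Q.αbar (Q.pop w) k * lin a (Q.f (Q.X w)) k ∂Q.P = 0 := by
  have hG := hQ.integrable_wlScore hc a
  have hq := hQ.integrable_quad hc a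
  have hL := hQ.integrable_wlLoss hc
  rw [← neg_eq_zero]
  refine eq_zero_of_forall_small (s₀ := 1) (C := 1 / 2 * ∫ w, ∑ k : {k : Fin K // k ≠ Q.t},
    weight Q.f Q.γbar (Q.pop w) k * lin a (Q.f (Q.X w)) k ^ 2 ∂Q.P) one_pos fun s _ => ?_
  have hmin := Q.αbar_min (Q.αbar + s • a)
  -- The loss is quadratic in α, so the expansion is exact; it also supplies integrability at the
  -- perturbed point.
  have e : ∀ w, wlLoss Q.f Q.γbar (Q.αbar + s • a) (Q.pop w) =
      wlLoss Q.f Q.γbar Q.αbar (Q.pop w) +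
      ((-s) * (∑ k : {k : Fin K // k ≠ Q.t}, weight Q.f Q.γbar (Q.pop w) k *
        resid Q.f Q.αbar (Q.pop w) k * lin a (Q.f (Q.X w)) k) +
      s ^ 2 / 2 * ∑ k : {k : Fin K // k ≠ Q.t}, weight Q.f Q.γbar (Q.pop w) k *
        lin a (Q.f (Q.X w)) k ^ 2) := by
    intro w
    simp only [wlLoss, Finset.mul_sum, ← Finset.sum_add_distrib]
    refine Finset.sum_congr rfl fun k _ => ?_
    simp only [weight, resid, pop, lin_add, lin_smul]; ring
  have h1 : ∫ w, wlLoss Q.f Q.γbar Q.αbar (Q.pop w) ∂Q.P ≤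
    ∫ w, wlLoss Q.f Q.γbar (Q.αbar + s • a) (Q.pop w) ∂Q.P := hmin
  have h2 := integral_add hL ((hG.const_mul (-s)).add (hq.const_mul (s ^ 2 / 2)))
  have h3 := integral_add (hG.const_mul (-s)) (hq.const_mul (s ^ 2 / 2))
  rw [integral_const_mul, integral_const_mul] at h3
  simp only [Pi.add_apply] at h2
  simp only [e] at h1
  rw [h2, h3] at h1
  linarith

lemma integrable_gram (hQ : Q.Conditions c ε) (hc : c.Admissible)
    (k : {k : Fin K // k ≠ Q.t}) (i j : Fin (p + 1)) :
    Integrable (fun w => weight Q.f Q.γbar (Q.pop w) k * (Q.f (Q.X w) i * Q.f (Q.X w) j))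
      Q.P := by
  have := Q.isProb_P
  refine Integrable.of_bound (((measurable_weight Q.measurable_f Q.γbar k).mul
    ((measurable_coord Q.measurable_f i).mul (measurable_coord Q.measurable_f j))).comp
    Q.measurable_pop).aestronglyMeasurable ((c.B1 - 1) * (c.B0 * c.B0)) ?_
  filter_upwards [hQ.ae_bounded hc, hQ.ae_weight_le] with w hw hw'
  have hB := hc.B0
  rw [Real.norm_eq_abs, abs_mul, abs_mul, abs_of_nonneg (weight_nonneg _ _ _ _)]
  exact mul_le_mul (hw' k) (mul_le_mul (hw i) (hw j) (abs_nonneg _) (by linarith))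
    (by positivity) (by linarith [hc.B1])

lemma popQuad_eq_gram (hQ : Q.Conditions c ε) (hc : c.Admissible) (b : Coef K p Q.t) :
    Q.popQuad b = ∑ k : {k : Fin K // k ≠ Q.t},
        (fun j => b j k) ⬝ᵥ (Q.gram k).mulVec (fun j => b j k) := by
  have hint := fun k i j => hQ.integrable_gram hc k i j
  have e : ∀ w, ∑ k : {k : Fin K // k ≠ Q.t},
      weight Q.f Q.γbar (Q.pop w) k * lin b (Q.f (Q.X w)) k ^ 2 =
      ∑ k : {k : Fin K // k ≠ Q.t}, ∑ i, ∑ j, b i k * b j k *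
        (weight Q.f Q.γbar (Q.pop w) k * (Q.f (Q.X w) i * Q.f (Q.X w) j)) := by
    intro w
    refine Finset.sum_congr rfl fun k _ => ?_
    rw [lin, sq, Finset.sum_mul_sum, Finset.mul_sum]
    refine Finset.sum_congr rfl fun i _ => ?_
    rw [Finset.mul_sum]
    exact Finset.sum_congr rfl fun j _ => by ring
  rw [popQuad]
  simp only [e]
  rw [integral_finsetSum _ fun k _ => integrable_finsetSum _ fun i _ =>
    integrable_finsetSum _ fun j _ => (hint k i j).const_mul _]
  refine Finset.sum_congr rfl fun k _ => ?_
  rw [integral_finsetSum _ fun i _ =>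
    integrable_finsetSum _ fun j _ => (hint k i j).const_mul _]
  refine Finset.sum_congr rfl fun i _ => ?_
  rw [integral_finsetSum _ fun j _ => (hint k i j).const_mul _, Matrix.mulVec, dotProduct,
    Finset.mul_sum]
  refine Finset.sum_congr rfl fun j _ => ?_
  rw [integral_const_mul, gram, Matrix.of_apply]
  simp only [ratio_eq_exp, weight, pop]
  ring

/-- By unconfoundedness, weighting by squared residuals inflates the population quadratic form by
at most the sub-gaussian parameter. -/
lemma integral_sq_resid_le (hQ : Q.Conditions c ε) (hc : c.Admissible) (b : Coef K p Q.t) :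
    ∫ w, ∑ k : {k : Fin K // k ≠ Q.t}, weight Q.f Q.γbar (Q.pop w) k *
      resid Q.f Q.αbar (Q.pop w) k ^ 2 * lin b (Q.f (Q.X w)) k ^ 2 ∂Q.P ≤
      c.σ0 ^ 2 * Q.popQuad b := by
  have := Q.isProb_P
  have hB := hc.B0
  have hA : MeasurableSet {w | Q.T w = Q.t} := Q.measurable_T (measurableSet_singleton _)
  have hq : ∀ k : {k : Fin K // k ≠ Q.t}, Integrable (fun w => weight Q.f Q.γbar (Q.pop w) k *
      lin b (Q.f (Q.X w)) k ^ 2) Q.P := fun k => by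
    refine Integrable.of_bound (((measurable_weight Q.measurable_f Q.γbar k).mul
      ((measurable_lin_comp Q.measurable_f b k).pow_const 2)).comp
      Q.measurable_pop).aestronglyMeasurable ((c.B1 - 1) * (c.B0 * groupNorm b) ^ 2) ?_
    filter_upwards [hQ.ae_bounded hc, hQ.ae_weight_le] with w hw hw'
    rw [Real.norm_of_nonneg (mul_nonneg (weight_nonneg _ _ _ _) (sq_nonneg _)), ← sq_abs]
    exact mul_le_mul (hw' k) (pow_le_pow_left₀ (abs_nonneg _) (abs_lin_le hw b k) 2)
      (by positivity) (by linarith [hc.B1])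
  have hr : ∀ k : {k : Fin K // k ≠ Q.t}, Integrable (fun w => weight Q.f Q.γbar (Q.pop w) k *
      resid Q.f Q.αbar (Q.pop w) k ^ 2 * lin b (Q.f (Q.X w)) k ^ 2) Q.P := fun k => by
    have h := hQ.integrable_mul_potResid hc
      (g := fun w => lin b (Q.f (Q.X w)) k ^ 2 * weight Q.f Q.γbar (Q.pop w) k)
      ((((measurable_lin_comp Q.measurable_f b k).pow_const 2).mul
        (measurable_weight Q.measurable_f Q.γbar k)).comp Q.measurable_pop)
      (C := (c.B0 * groupNorm b) ^ 2 * (c.B1 - 1)) (by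
        filter_upwards [hQ.ae_bounded hc, hQ.ae_weight_le] with w hw hw'
        rw [abs_mul, abs_of_nonneg (weight_nonneg _ _ _ _), abs_pow]
        exact mul_le_mul (pow_le_pow_left₀ (abs_nonneg _) (abs_lin_le hw b k) 2) (hw' k)
          (weight_nonneg _ _ _ _) (by positivity)) k (φ := fun x => x ^ 2)
      (by fun_prop) (fun x => by rw [abs_of_nonneg (sq_nonneg x)]; linarith)
    refine h.congr (ae_of_all _ fun w => ?_)
    have := Q.weight_mul_resid Q.γbar w k fun x => x ^ 2
    simp only at this ⊢
    rw [this]; ring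
  rw [popQuad, integral_finsetSum _ fun k _ => hr k, integral_finsetSum _ fun k _ => hq k,
    Finset.mul_sum]
  refine Finset.sum_le_sum fun k _ => ?_
  set g : (Fin d → ℝ) → ℝ := fun x => Real.exp (lin Q.γbar (Q.f x) k) * lin b (Q.f x) k ^ 2
    with hg
  have hgm : Measurable g := ((measurable_lin Q.γbar k).comp Q.measurable_f).exp.mul
    (((measurable_lin b k).comp Q.measurable_f).pow_const 2)
  have hgC : ∀ᵐ w ∂Q.P, g (Q.X w) ≤ (c.B1 - 1) * (c.B0 * groupNorm b) ^ 2 := by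
    filter_upwards [hQ.ae_bounded hc, hQ.ae_sum_exp_le] with w hw hw'
    have h1 := (Finset.single_le_sum (f := fun k => Real.exp (lin Q.γbar (Q.f (Q.X w)) k))
      (fun k _ => (Real.exp_pos _).le) (Finset.mem_univ k)).trans hw'
    rw [hg]; simp only
    rw [← sq_abs (lin b _ _)]
    exact mul_le_mul h1 (pow_le_pow_left₀ (abs_nonneg _) (abs_lin_le hw b k) 2)
      (by positivity) (by linarith [hc.B1])
  have key := hQ.unconfounded.setIntegral_sq_le Q.measurable_X hA (Q.measurable_Ypot _)
    (m := fun x => lin Q.αbar (Q.f x) k) ((measurable_lin Q.αbar k).comp Q.measurable_f) hgm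
    (fun x => mul_nonneg (Real.exp_pos _).le (sq_nonneg _)) hgC hc.σ0 (hQ.subGaussian k)
  rw [← integral_indicator hA, ← integral_indicator hA] at key
  refine le_trans (le_of_eq ?_) (key.trans (le_of_eq ?_))
  · refine integral_congr_ae (ae_of_all _ fun w => ?_)
    by_cases h : Q.T w = Q.t <;> simp [h, hg, weight, resid, pop, ind]; ring
  · congr 1
    refine integral_congr_ae (ae_of_all _ fun w => ?_)
    by_cases h : Q.T w = Q.t <;> simp [h, hg, weight, pop, ind]

/-- The weighted mean of the squared residuals is sub-exponential. -/
lemma integral_exp_mean_sq_le (hQ : Q.Conditions c ε) :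
    Integrable (fun w => Real.exp ((∑ k : {k : Fin K // k ≠ Q.t},
      Real.exp (lin Q.γbar (Q.f (Q.X w)) k) * Q.potResid w k ^ 2) /
      (∑ k : {k : Fin K // k ≠ Q.t}, Real.exp (lin Q.γbar (Q.f (Q.X w)) k)) / c.σ0 ^ 2)) Q.P ∧
    ∫ w, Real.exp ((∑ k : {k : Fin K // k ≠ Q.t},
      Real.exp (lin Q.γbar (Q.f (Q.X w)) k) * Q.potResid w k ^ 2) /
      (∑ k : {k : Fin K // k ≠ Q.t}, Real.exp (lin Q.γbar (Q.f (Q.X w)) k)) / c.σ0 ^ 2) ∂Q.P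
      ≤ 2 := by
  have := Q.isProb_P
  have hne : (Finset.univ : Finset {k : Fin K // k ≠ Q.t}).Nonempty := by
    have h2 := hQ.two_le_K
    have : Nontrivial (Fin K) := Fin.nontrivial_iff_two_le.2 h2
    obtain ⟨k, hk⟩ := exists_ne Q.t
    exact ⟨⟨k, hk⟩, Finset.mem_univ _⟩
  set e : (Fin d → ℝ) → {k : Fin K // k ≠ Q.t} → ℝ :=
    fun x k => Real.exp (lin Q.γbar (Q.f x) k) with he
  have hem : ∀ k, Measurable fun x => e x k := fun k =>
    ((measurable_lin Q.γbar k).comp Q.measurable_f).exp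
  have he0 : ∀ x k, 0 < e x k := fun x k => Real.exp_pos _
  have hW : ∀ x, 0 < ∑ k, e x k := fun x => Finset.sum_pos (fun k _ => he0 x k) hne
  have hWm : Measurable fun x => ∑ k, e x k := Finset.measurable_fun_sum _ fun k _ => hem k
  have hu0 : ∀ x k, 0 ≤ e x k / ∑ k, e x k := fun x k => (div_pos (he0 x k) (hW x)).le
  have hu1 : ∀ x k, e x k / ∑ k, e x k ≤ 1 := fun x k => by
    rw [div_le_one (hW x)]
    exact Finset.single_le_sum (fun k _ => (he0 x k).le) (Finset.mem_univ k)
  have hsum : ∀ x, ∑ k, e x k / ∑ k, e x k = 1 := fun x => by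
    rw [← Finset.sum_div, div_self (hW x).ne']
  have hk := fun k => (hQ.subGaussian k).integral_mul_le Q.measurable_X
    (g := fun w => e (Q.X w) k / ∑ k, e (Q.X w) k) (C := 1)
    (((hem k).div hWm).comp (comap_measurable Q.X)).stronglyMeasurable
    (ae_of_all _ fun w => hu0 _ _) (ae_of_all _ fun w => hu1 _ _)
  have hui : ∀ k, Integrable (fun w => e (Q.X w) k / ∑ k, e (Q.X w) k) Q.P := fun k =>
    Integrable.of_bound (((hem k).div hWm).comp Q.measurable_X).aestronglyMeasurable 1
      (ae_of_all _ fun w => by rw [Real.norm_of_nonneg (hu0 _ _)]; exact hu1 _ _)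
  -- Jensen's inequality with weights that are functions of X and sum to 1. Each treatment's
  -- conditional moment bound is averaged, so the bound 2 survives whatever the number of
  -- treatments.
  have hJ : ∀ w, Real.exp ((∑ k, e (Q.X w) k * Q.potResid w k ^ 2) / (∑ k, e (Q.X w) k) /
      c.σ0 ^ 2) ≤ ∑ k, e (Q.X w) k / (∑ k, e (Q.X w) k) *
        Real.exp (Q.potResid w k ^ 2 / c.σ0 ^ 2) := by
    intro w
    have h := convexOn_exp.map_sum_le (t := Finset.univ)
      (w := fun k => e (Q.X w) k / ∑ k, e (Q.X w) k)
      (p := fun k => Q.potResid w k ^ 2 / c.σ0 ^ 2) (fun k _ => hu0 _ _) (hsum _)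
      (fun _ _ => Set.mem_univ _)
    simp only [smul_eq_mul] at h
    refine le_trans (le_of_eq ?_) h
    congr 1
    rw [Finset.sum_div, Finset.sum_div]
    exact Finset.sum_congr rfl fun k _ => by ring
  have hRi := integrable_finsetSum Finset.univ fun k _ => (hk k).1
  have hLm : Measurable fun w => Real.exp ((∑ k, e (Q.X w) k * Q.potResid w k ^ 2) /
      (∑ k, e (Q.X w) k) / c.σ0 ^ 2) :=
    (((Finset.measurable_fun_sum _ fun k _ => ((hem k).comp Q.measurable_X).mul
      ((Q.measurable_potResid k).pow_const 2)).div (hWm.comp Q.measurable_X)).div_const _).exp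
  refine ⟨hRi.mono' hLm.aestronglyMeasurable (ae_of_all _ fun w => ?_), ?_⟩
  · rw [Real.norm_of_nonneg (Real.exp_pos _).le]; exact hJ w
  · refine (integral_mono_of_nonneg (ae_of_all _ fun w => (Real.exp_pos _).le) hRi
      (ae_of_all _ hJ)).trans ?_
    rw [integral_finsetSum _ fun k _ => (hk k).1]
    refine (Finset.sum_le_sum fun k _ => (hk k).2).trans ?_
    rw [← Finset.mul_sum, ← integral_finsetSum _ fun k _ => hui k]
    simp [hsum]

end Conditions

end Problem

/-! ### Tail bounds for averages of random vectors -/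

section Tail

variable {E : Type*} [NormedAddCommGroup E] [InnerProductSpace ℝ E]
  [FiniteDimensional ℝ E] [MeasurableSpace E] [BorelSpace E]
  {Ω₀ Ω A : Type*} [MeasurableSpace Ω₀] [MeasurableSpace Ω] [MeasurableSpace A]
  {n : ℕ} {P : Measure Ω₀} {μ : Measure Ω} [IsProbabilityMeasure P] [IsProbabilityMeasure μ]
  {obs : Fin n → Ω → A} {O : Ω₀ → A} {g : A → E}

/-- Tail bound for bounded vectors in terms of the second moment. -/
lemma measure_norm_sum_ge_le_of_bounded (hobs : ∀ i, Measurable (obs i)) (hind : iIndepFun obs μ)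
    (hO : Measurable O) (hlaw : ∀ i, μ.map (obs i) = P.map O) (hg : Measurable g)
    (hmean : ∀ v : E, ∫ w, inner ℝ v (g (O w)) ∂P = 0) {B V l : ℝ} (hl : 0 < l)
    (hB : ∀ᵐ w ∂P, ‖g (O w)‖ ≤ B) (hV : ∫ w, ‖g (O w)‖ ^ 2 ∂P ≤ V) (τ : ℝ) :
    μ {ω | τ ≤ ‖∑ i, g (obs i ω)‖} ≤
      ENNReal.ofReal (2 * Real.exp (n * (l ^ 2 * V / 2 * Real.exp (l * B)) - l * τ)) := by
  have hgm : Measurable fun w => ‖g (O w)‖ := (hg.comp hO).norm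
  have hi1 : Integrable (fun w => Real.exp (l * ‖g (O w)‖)) P := by
    refine Integrable.of_bound (hgm.const_mul l).exp.aestronglyMeasurable (Real.exp (l * B)) ?_
    filter_upwards [hB] with w hw
    rw [Real.norm_of_nonneg (Real.exp_pos _).le]
    gcongr
  have hi2 : Integrable (fun w => ‖g (O w)‖ ^ 2) P := by
    refine Integrable.of_bound (hgm.pow_const 2).aestronglyMeasurable (B ^ 2) ?_
    filter_upwards [hB] with w hw
    rw [Real.norm_of_nonneg (sq_nonneg _)]
    gcongr
  refine measure_norm_sum_ge_le hobs hind hO hlaw hg hl hi1 hmean ?_ τ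
  have hle : ∀ᵐ w ∂P, Real.exp (l * ‖g (O w)‖) - l * ‖g (O w)‖ ≤
      1 + l ^ 2 / 2 * Real.exp (l * B) * ‖g (O w)‖ ^ 2 := by
    filter_upwards [hB] with w hw
    have h1 := exp_sub_one_sub_le_half_sq_mul_exp (mul_nonneg hl.le (norm_nonneg (g (O w))))
    have h2 : Real.exp (l * ‖g (O w)‖) ≤ Real.exp (l * B) := by gcongr
    have h3 : (l * ‖g (O w)‖) ^ 2 / 2 * Real.exp (l * ‖g (O w)‖) ≤
      (l * ‖g (O w)‖) ^ 2 / 2 * Real.exp (l * B) := by gcongr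
    rw [mul_pow] at h3 h1
    linarith
  have hnn : 0 ≤ᵐ[P] fun w => Real.exp (l * ‖g (O w)‖) - l * ‖g (O w)‖ :=
    ae_of_all _ fun w => by
      have := Real.add_one_le_exp (l * ‖g (O w)‖)
      simp only [Pi.zero_apply]; linarith
  refine (integral_mono_of_nonneg hnn ((integrable_const 1).add (hi2.const_mul _)) hle).trans ?_
  simp only [Pi.add_apply]
  rw [integral_add (integrable_const 1) (hi2.const_mul _), integral_const_mul, integral_const,
    probReal_univ, one_smul]
  have h4 := Real.add_one_le_exp (l ^ 2 * V / 2 * Real.exp (l * B))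
  have h5 := mul_le_mul_of_nonneg_left hV
    (show 0 ≤ l ^ 2 / 2 * Real.exp (l * B) by positivity)
  linarith

/-- Tail bound for sub-gaussian vectors. -/
lemma measure_norm_sum_ge_le_of_subGaussian (hobs : ∀ i, Measurable (obs i))
    (hind : iIndepFun obs μ) (hO : Measurable O) (hlaw : ∀ i, μ.map (obs i) = P.map O)
    (hg : Measurable g) (hmean : ∀ v : E, ∫ w, inner ℝ v (g (O w)) ∂P = 0) {y : Ω₀ → ℝ} {s l : ℝ}
    (hl : 0 < l) (hs : 0 ≤ s) (hls : l * s ≤ 1) (hy : ∀ᵐ w ∂P, ‖g (O w)‖ ^ 2 ≤ s ^ 2 * y w)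
    (hyi : Integrable (fun w => Real.exp (y w)) P) (hy2 : ∫ w, Real.exp (y w) ∂P ≤ 2) (τ : ℝ) :
    μ {ω | τ ≤ ‖∑ i, g (obs i ω)‖} ≤
      ENNReal.ofReal (2 * Real.exp (n * (l ^ 2 * s ^ 2 * Real.log 2) - l * τ)) := by
  have hgm : Measurable fun w => ‖g (O w)‖ := (hg.comp hO).norm
  set θ := l ^ 2 * s ^ 2 with hθ
  have hθ0 : 0 ≤ θ := by positivity
  have hθ1 : θ ≤ 1 := by
    have : θ = (l * s) ^ 2 := by rw [hθ]; ring
    rw [this]; exact pow_le_one₀ (by positivity) hls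
  -- The linear term permitted by centering cancels the one in e^x ≤ x + e^{x²}. What remains is
  -- e^{θy}, dominated by an affine function of e^y with mean at most 2^θ.
  have hle : ∀ᵐ w ∂P, Real.exp (l * ‖g (O w)‖) - l * ‖g (O w)‖ ≤
      2 ^ θ * (1 - θ + θ * (Real.exp (y w) / 2)) := by
    filter_upwards [hy] with w hw
    have h1 := exp_le_add_exp_sq (mul_nonneg hl.le (norm_nonneg (g (O w))))
    have h2 : Real.exp ((l * ‖g (O w)‖) ^ 2) ≤ Real.exp (θ * y w) := by
      refine Real.exp_le_exp.2 ?_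
      rw [mul_pow, hθ]
      have := mul_le_mul_of_nonneg_left hw (sq_nonneg l)
      linarith
    have h3 := exp_mul_le_one_sub_add (y := y w) hθ0 hθ1
    linarith
  have hRi : Integrable (fun w => 2 ^ θ * (1 - θ + θ * (Real.exp (y w) / 2))) P :=
    ((integrable_const _).add ((hyi.div_const 2).const_mul θ)).const_mul _
  have hli : Integrable (fun w => l * ‖g (O w)‖) P := by
    refine (hyi.const_mul (1 : ℝ) |>.add (integrable_const (1 : ℝ))).mono'
      (hgm.const_mul l).aestronglyMeasurable ?_
    filter_upwards [hy] with w hw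
    rw [Real.norm_of_nonneg (mul_nonneg hl.le (norm_nonneg _))]
    have h1 : (l * ‖g (O w)‖) ^ 2 ≤ θ * y w := by
      rw [mul_pow, hθ]
      have := mul_le_mul_of_nonneg_left hw (sq_nonneg l)
      linarith
    have h2 := Real.add_one_le_exp (y w)
    have h3 : θ * y w ≤ Real.exp (y w) := by
      rcases le_total 0 (y w) with h | h
      · nlinarith
      · have := mul_nonpos_of_nonneg_of_nonpos hθ0 h
        linarith [Real.exp_pos (y w)]
    simp only [Pi.add_apply, one_mul]
    nlinarith [sq_nonneg (l * ‖g (O w)‖ - 1), sq_nonneg (l * ‖g (O w)‖)]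
  have hnn : ∀ w, 0 ≤ Real.exp (l * ‖g (O w)‖) - l * ‖g (O w)‖ := fun w => by
    have := Real.add_one_le_exp (l * ‖g (O w)‖)
    linarith
  have hi1 : Integrable (fun w => Real.exp (l * ‖g (O w)‖)) P := by
    refine (hRi.add hli).mono' (hgm.const_mul l).exp.aestronglyMeasurable ?_
    filter_upwards [hle] with w hw
    rw [Real.norm_of_nonneg (Real.exp_pos _).le]
    simp only [Pi.add_apply]; linarith
  refine measure_norm_sum_ge_le hobs hind hO hlaw hg hl hi1 hmean ?_ τ
  refine (integral_mono_of_nonneg (ae_of_all _ hnn) hRi hle).trans ?_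
  rw [integral_const_mul, integral_add (integrable_const _) ((hyi.div_const 2).const_mul θ),
    integral_const_mul, integral_div, integral_const, probReal_univ, one_smul,
    mul_comm θ (Real.log 2), ← Real.rpow_def_of_pos (by norm_num)]
  refine mul_le_of_le_one_right (by positivity) ?_
  nlinarith

/-- Tail bound for sub-exponential vectors. -/
lemma measure_norm_sum_ge_le_of_subExponential (hobs : ∀ i, Measurable (obs i))
    (hind : iIndepFun obs μ) (hO : Measurable O) (hlaw : ∀ i, μ.map (obs i) = P.map O)
    (hg : Measurable g) (hmean : ∀ v : E, ∫ w, inner ℝ v (g (O w)) ∂P = 0) {y : Ω₀ → ℝ} {s l : ℝ}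
    (hl : 0 < l) (hs : 0 ≤ s) (hls : l * s ≤ 1 / 2)
    (hy : ∀ᵐ w ∂P, ‖g (O w)‖ ≤ s * (y w + 1)) (hy0 : ∀ w, 0 ≤ y w)
    (hyi : Integrable (fun w => Real.exp (y w)) P) (hy2 : ∫ w, Real.exp (y w) ∂P ≤ 2) (τ : ℝ) :
    μ {ω | τ ≤ ‖∑ i, g (obs i ω)‖} ≤
      ENNReal.ofReal (2 * Real.exp (n * (8 * Real.exp 1 * (l * s) ^ 2) - l * τ)) := by
  have hgm : Measurable fun w => ‖g (O w)‖ := (hg.comp hO).norm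
  set θ := l * s with hθ
  have hθ0 : 0 ≤ θ := by positivity
  have hb : ∀ᵐ w ∂P, l * ‖g (O w)‖ ≤ θ * (y w + 1) := by
    filter_upwards [hy] with w hw
    have := mul_le_mul_of_nonneg_left hw hl.le
    rw [hθ]; linarith
  have hi1 : Integrable (fun w => Real.exp (l * ‖g (O w)‖)) P := by
    refine (hyi.const_mul (Real.exp 1)).mono' (hgm.const_mul l).exp.aestronglyMeasurable ?_
    filter_upwards [hb] with w hw
    rw [Real.norm_of_nonneg (Real.exp_pos _).le, ← Real.exp_add]
    refine Real.exp_le_exp.2 ?_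
    nlinarith [hy0 w]
  refine measure_norm_sum_ge_le hobs hind hO hlaw hg hl hi1 hmean ?_ τ
  have hle : ∀ᵐ w ∂P, Real.exp (l * ‖g (O w)‖) - l * ‖g (O w)‖ ≤
      1 + 4 * θ ^ 2 * Real.exp 1 * Real.exp (y w) := by
    filter_upwards [hb] with w hw
    have hx0 : 0 ≤ l * ‖g (O w)‖ := mul_nonneg hl.le (norm_nonneg _)
    set u := y w + 1 with hu
    have hu0 : 0 ≤ u := by linarith [hy0 w]
    have h1 := exp_sub_one_sub_le_half_sq_mul_exp hx0
    have h2 : Real.exp (l * ‖g (O w)‖) ≤ Real.exp (u / 2) :=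
      Real.exp_le_exp.2 (hw.trans (by nlinarith))
    -- Since θ ≤ 1/2, only half of the exponential moment is used by e^{θu}; the other half absorbs
    -- the factor u² of the second-order remainder.
    have h3 : u ^ 2 / 8 ≤ Real.exp (u / 2) := by
      have := Real.quadratic_le_exp_of_nonneg (show 0 ≤ u / 2 by linarith)
      nlinarith
    have h4 : Real.exp 1 * Real.exp (y w) = Real.exp (u / 2) * Real.exp (u / 2) := by
      rw [← Real.exp_add, ← Real.exp_add]; congr 1; rw [hu]; ring
    have h5 : (l * ‖g (O w)‖) ^ 2 / 2 * Real.exp (l * ‖g (O w)‖) ≤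
        (θ * u) ^ 2 / 2 * Real.exp (u / 2) := by gcongr
    have h6 : (θ * u) ^ 2 / 2 * Real.exp (u / 2) ≤
        4 * θ ^ 2 * (Real.exp (u / 2) * Real.exp (u / 2)) := by
      have := mul_le_mul_of_nonneg_left h3
        (show 0 ≤ 4 * θ ^ 2 * Real.exp (u / 2) by positivity)
      linarith [this, show (θ * u) ^ 2 / 2 * Real.exp (u / 2) =
        4 * θ ^ 2 * Real.exp (u / 2) * (u ^ 2 / 8) by ring]
    rw [mul_assoc (4 * θ ^ 2), h4]
    linarith
  have hnn : ∀ w, 0 ≤ Real.exp (l * ‖g (O w)‖) - l * ‖g (O w)‖ := fun w => by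
    have := Real.add_one_le_exp (l * ‖g (O w)‖)
    linarith
  refine (integral_mono_of_nonneg (ae_of_all _ hnn)
    ((integrable_const 1).add (hyi.const_mul _)) hle).trans ?_
  simp only [Pi.add_apply]
  rw [integral_add (integrable_const 1) (hyi.const_mul _), integral_const_mul, integral_const,
    probReal_univ, one_smul]
  have h4 := Real.add_one_le_exp (8 * Real.exp 1 * θ ^ 2)
  have h5 := mul_le_mul_of_nonneg_left hy2
    (show 0 ≤ 4 * θ ^ 2 * Real.exp 1 by positivity)
  linarith

end Tail

/-! ### Linear and quadratic forms in coefficient matrices -/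

section Forms

variable {d K p n : ℕ} {t : Fin K}

/-- The vector of the sample averages of the components of `z`. -/
noncomputable def avgVec {κ : Type*} (D : Fin n → Obs d K) (z : Obs d K → κ → ℝ) :
    EuclideanSpace ℝ κ :=
  WithLp.toLp 2 fun k => avg D fun o => z o k

/-- Going through the ℓ¹ norm loses little here, because overlap bounds the sum over k of the
weights. -/
lemma norm_toLp_le_sum_abs {κ : Type*} [Fintype κ] (z : κ → ℝ) :
    ‖(WithLp.toLp 2 z : EuclideanSpace ℝ κ)‖ ≤ ∑ k, |z k| := by
  refine (le_abs_self _).trans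
    (abs_le_of_sq_le_sq ?_ (Finset.sum_nonneg fun _ _ => abs_nonneg _))
  rw [EuclideanSpace.real_norm_sq_eq, sq, Finset.sum_mul]
  refine Finset.sum_le_sum fun k _ => ?_
  rw [← sq_abs, sq]
  exact mul_le_mul_of_nonneg_left
    (Finset.single_le_sum (f := fun k => |z k|) (fun _ _ => abs_nonneg _) (Finset.mem_univ k))
    (abs_nonneg _)

lemma norm_sum_toLp {κ : Type*} [Fintype κ] (hn : 0 < n) (D : Fin n → Obs d K)
    (z : Obs d K → κ → ℝ) :
    ‖∑ i, (WithLp.toLp 2 (z (D i)) : EuclideanSpace ℝ κ)‖ = n * ‖avgVec D z‖ := by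
  have hn' : (n : ℝ) ≠ 0 := by positivity
  have : ∑ i, (WithLp.toLp 2 (z (D i)) : EuclideanSpace ℝ κ) = (n : ℝ) • avgVec D z := by
    ext k
    simp only [avgVec, avg, WithLp.ofLp_sum, Finset.sum_apply, PiLp.smul_apply, smul_eq_mul]
    field_simp
  rw [this, norm_smul, Real.norm_of_nonneg (Nat.cast_nonneg n)]

lemma avg_const (hn : 0 < n) (D : Fin n → Obs d K) (a : ℝ) : avg D (fun _ => a) = a := by
  have hn' : (n : ℝ) ≠ 0 := by positivity
  simp [avg, hn']

lemma abs_sum_mul_le {κ : Type*} [Fintype κ] (x y : EuclideanSpace ℝ κ) :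
    |∑ k, x k * y k| ≤ ‖x‖ * ‖y‖ := by
  have h := abs_real_inner_le_norm y x
  rw [PiLp.inner_apply] at h
  simpa [mul_comm] using h

lemma abs_sum_mul_mul_le {κ : Type*} [Fintype κ] (x y z : EuclideanSpace ℝ κ) :
    |∑ k, x k * y k * z k| ≤ ‖x‖ * ‖y‖ * ‖z‖ := by
  have h := abs_sum_mul_le x (WithLp.toLp 2 fun k => y k * z k)
  have h2 : ‖(WithLp.toLp 2 fun k => y k * z k : EuclideanSpace ℝ κ)‖ ≤ ‖y‖ * ‖z‖ := by
    refine (le_abs_self _).trans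
      (abs_le_of_sq_le_sq ?_ (mul_nonneg (norm_nonneg y) (norm_nonneg z)))
    rw [EuclideanSpace.real_norm_sq_eq, mul_pow, EuclideanSpace.real_norm_sq_eq y, Finset.sum_mul]
    refine Finset.sum_le_sum fun k _ => ?_
    simp only [mul_pow]
    refine mul_le_mul_of_nonneg_left ?_ (sq_nonneg _)
    have := PiLp.norm_apply_le z k
    rw [Real.norm_eq_abs] at this
    rw [← sq_abs]
    exact pow_le_pow_left₀ (abs_nonneg _) this 2
  simp only [mul_assoc] at h ⊢
  exact h.trans (mul_le_mul_of_nonneg_left h2 (norm_nonneg _))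

variable {f : (Fin d → ℝ) → Fin (p + 1) → ℝ}

/-- A linear form in a coefficient matrix is bounded by the row-wise norms of its coefficients. -/
lemma abs_avg_linear_le (D : Fin n → Obs d K) (s : Obs d K → {k : Fin K // k ≠ t} → ℝ) {C : ℝ}
    (h : ∀ j, ‖avgVec D fun o k => s o k * f o.2.2 j‖ ≤ C) (b : Coef K p t) :
    |avg D fun o => ∑ k, s o k * lin b (f o.2.2) k| ≤ C * groupNorm b := by
  have e : (avg D fun o => ∑ k, s o k * lin b (f o.2.2) k) =
      ∑ j, ∑ k, b j k * avgVec D (fun o k => s o k * f o.2.2 j) k := by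
    have e1 : (fun o => ∑ k, s o k * lin b (f o.2.2) k) =
        fun o : Obs d K => ∑ j, ∑ k, b j k * (s o k * f o.2.2 j) := by
      funext o
      rw [Finset.sum_comm]
      refine Finset.sum_congr rfl fun k _ => ?_
      rw [lin, Finset.mul_sum]
      exact Finset.sum_congr rfl fun j _ => by ring
    rw [e1, avg_sum]
    refine Finset.sum_congr rfl fun j _ => ?_
    rw [avg_sum]
    exact Finset.sum_congr rfl fun k _ => avg_const_mul D _ _
  rw [e, groupNorm, Finset.mul_sum]
  refine (Finset.abs_sum_le_sum_abs _ _).trans (Finset.sum_le_sum fun j _ => ?_)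
  refine (abs_sum_mul_le _ _).trans ?_
  rw [mul_comm]
  exact mul_le_mul_of_nonneg_right (h j) (norm_nonneg _)

/-- The deviation of a quadratic form from its expectation, in terms of centered averages. -/
lemma abs_avg_quadratic_sub_integral_le {Ω₀ : Type*} [MeasurableSpace Ω₀] {P : Measure Ω₀}
    {O : Ω₀ → Obs d K} (hn : 0 < n) (D : Fin n → Obs d K)
    (s : Obs d K → {k : Fin K // k ≠ t} → ℝ)
    (hint : ∀ k i j, Integrable (fun w => s (O w) k * (f (O w).2.2 i * f (O w).2.2 j)) P) {C : ℝ}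
    (h : ∀ i j, ‖avgVec D fun o k => s o k * (f o.2.2 i * f o.2.2 j) -
      ∫ w, s (O w) k * (f (O w).2.2 i * f (O w).2.2 j) ∂P‖ ≤ C) (b : Coef K p t) :
    |(avg D fun o => ∑ k, s o k * lin b (f o.2.2) k ^ 2) -
      ∫ w, ∑ k, s (O w) k * lin b (f (O w).2.2) k ^ 2 ∂P| ≤ C * groupNorm b ^ 2 := by
  have e0 : ∀ o : Obs d K, ∑ k, s o k * lin b (f o.2.2) k ^ 2 =
      ∑ i, ∑ j, ∑ k, b i k * b j k * (s o k * (f o.2.2 i * f o.2.2 j)) := by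
    intro o
    have e1 : ∀ k, s o k * lin b (f o.2.2) k ^ 2 =
        ∑ i, ∑ j, b i k * b j k * (s o k * (f o.2.2 i * f o.2.2 j)) := fun k => by
      rw [lin, sq, Finset.sum_mul_sum, Finset.mul_sum]
      refine Finset.sum_congr rfl fun i _ => ?_
      rw [Finset.mul_sum]
      exact Finset.sum_congr rfl fun j _ => by ring
    simp only [e1]
    rw [Finset.sum_comm]
    exact Finset.sum_congr rfl fun i _ => Finset.sum_comm
  have e : (avg D fun o => ∑ k, s o k * lin b (f o.2.2) k ^ 2) -
      ∫ w, ∑ k, s (O w) k * lin b (f (O w).2.2) k ^ 2 ∂P =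
      ∑ i, ∑ j, ∑ k, b i k * b j k * avgVec D (fun o k => s o k * (f o.2.2 i * f o.2.2 j) -
        ∫ w, s (O w) k * (f (O w).2.2 i * f (O w).2.2 j) ∂P) k := by
    simp only [e0]
    rw [integral_finsetSum _ fun i _ => integrable_finsetSum _ fun j _ =>
      integrable_finsetSum _ fun k _ => (hint k i j).const_mul _, avg_sum,
      ← Finset.sum_sub_distrib]
    refine Finset.sum_congr rfl fun i _ => ?_
    rw [integral_finsetSum _ fun j _ => integrable_finsetSum _ fun k _ =>
      (hint k i j).const_mul _, avg_sum, ← Finset.sum_sub_distrib]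
    refine Finset.sum_congr rfl fun j _ => ?_
    rw [integral_finsetSum _ fun k _ => (hint k i j).const_mul _, avg_sum,
      ← Finset.sum_sub_distrib]
    refine Finset.sum_congr rfl fun k _ => ?_
    rw [integral_const_mul, avg_const_mul, ← mul_sub, avgVec]
    simp only [avg_sub, avg_const hn]
  have e2 : C * groupNorm b ^ 2 = ∑ i, ∑ j, ‖b i‖ * ‖b j‖ * C := by
    rw [groupNorm, sq, Finset.sum_mul_sum, Finset.mul_sum]
    refine Finset.sum_congr rfl fun i _ => ?_
    rw [Finset.mul_sum]
    exact Finset.sum_congr rfl fun j _ => by ring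
  rw [e, e2]
  refine (Finset.abs_sum_le_sum_abs _ _).trans (Finset.sum_le_sum fun i _ => ?_)
  refine (Finset.abs_sum_le_sum_abs _ _).trans (Finset.sum_le_sum fun j _ => ?_)
  exact (abs_sum_mul_mul_le _ _ _).trans
    (mul_le_mul_of_nonneg_left (h i j) (by positivity))

end Forms

/-! ### Means of random vectors -/

section Mean

variable {Ω₀ κ : Type*} [Fintype κ] [MeasurableSpace Ω₀] {P : Measure Ω₀}
  {Z : Ω₀ → κ → ℝ}

lemma norm_mean_le (hZ : ∀ k, Integrable (fun w => Z w k) P) {Y : Ω₀ → ℝ} (hY : Integrable Y P)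
    (h : ∀ᵐ w ∂P, ∑ k, |Z w k| ≤ Y w) :
    ‖(WithLp.toLp 2 fun k => ∫ w, Z w k ∂P : EuclideanSpace ℝ κ)‖ ≤ ∫ w, Y w ∂P := by
  refine (norm_toLp_le_sum_abs _).trans ?_
  calc ∑ k, |∫ w, Z w k ∂P| ≤ ∑ k, ∫ w, |Z w k| ∂P :=
        Finset.sum_le_sum fun k _ => abs_integral_le_integral_abs
    _ = ∫ w, ∑ k, |Z w k| ∂P := (integral_finsetSum _ fun k _ => (hZ k).abs).symm
    _ ≤ _ := integral_mono_ae (integrable_finsetSum _ fun k _ => (hZ k).abs) hY h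

lemma norm_centered_le (hZ : ∀ k, Integrable (fun w => Z w k) P) {Y : Ω₀ → ℝ}
    (hY : Integrable Y P) (h : ∀ᵐ w ∂P, ∑ k, |Z w k| ≤ Y w) :
    ∀ᵐ w ∂P, ‖(WithLp.toLp 2 fun k => Z w k - ∫ w', Z w' k ∂P : EuclideanSpace ℝ κ)‖ ≤
      Y w + ∫ w', Y w' ∂P := by
  filter_upwards [h] with w hw
  have e : (WithLp.toLp 2 fun k => Z w k - ∫ w', Z w' k ∂P : EuclideanSpace ℝ κ) =
    WithLp.toLp 2 (Z w) - WithLp.toLp 2 fun k => ∫ w', Z w' k ∂P := rfl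
  rw [e]
  exact (norm_sub_le _ _).trans
    (add_le_add ((norm_toLp_le_sum_abs _).trans hw) (norm_mean_le hZ hY h))

variable [IsProbabilityMeasure P]

lemma integral_inner_centered (hZ : ∀ k, Integrable (fun w => Z w k) P)
    (v : EuclideanSpace ℝ κ) :
    ∫ w, inner ℝ v (WithLp.toLp 2 fun k => Z w k - ∫ w', Z w' k ∂P : EuclideanSpace ℝ κ) ∂P =
      0 := by
  simp only [PiLp.inner_apply, RCLike.inner_apply, conj_trivial]
  have h : ∀ k, Integrable (fun w => (Z w k - ∫ w', Z w' k ∂P) * v k) P := fun k =>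
    ((hZ k).sub (integrable_const _)).mul_const _
  rw [integral_finsetSum _ fun k _ => h k]
  refine Finset.sum_eq_zero fun k _ => ?_
  rw [integral_mul_const, integral_sub (hZ k) (integrable_const _)]
  simp

/-- Centering can double the sup bound but does not increase the second moment, so the variance
proxy stays B² rather than (2B)². -/
lemma integral_sq_norm_centered_le (hZm : ∀ k, AEStronglyMeasurable (fun w => Z w k) P) {B : ℝ}
    (h : ∀ᵐ w ∂P, ∑ k, |Z w k| ≤ B) :
    ∫ w, ‖(WithLp.toLp 2 fun k => Z w k - ∫ w', Z w' k ∂P : EuclideanSpace ℝ κ)‖ ^ 2 ∂P ≤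
      B ^ 2 := by
  have hb : ∀ k, ∀ᵐ w ∂P, ‖Z w k‖ ≤ B := fun k => by
    filter_upwards [h] with w hw
    exact (Finset.single_le_sum (f := fun k => |Z w k|) (fun _ _ => abs_nonneg _)
      (Finset.mem_univ k)).trans hw
  have hZ : ∀ k, Integrable (fun w => Z w k) P := fun k => Integrable.of_bound (hZm k) B (hb k)
  have hZ2 : ∀ k, Integrable (fun w => Z w k ^ 2) P := fun k => by
    refine Integrable.of_bound ((hZm k).pow 2) (B ^ 2) ?_
    filter_upwards [hb k] with w hw
    rw [norm_pow]
    exact pow_le_pow_left₀ (norm_nonneg _) hw 2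
  have e1 : ∀ k, ∫ w, (Z w k - ∫ w', Z w' k ∂P) ^ 2 ∂P ≤ ∫ w, Z w k ^ 2 ∂P := fun k => by
    have e : ∀ w, (Z w k - ∫ w', Z w' k ∂P) ^ 2 =
        Z w k ^ 2 - (2 * (∫ w', Z w' k ∂P) * Z w k - (∫ w', Z w' k ∂P) ^ 2) := fun w => by ring
    simp only [e]
    have h1 : Integrable (fun w => 2 * (∫ w', Z w' k ∂P) * Z w k - (∫ w', Z w' k ∂P) ^ 2) P :=
      ((hZ k).const_mul _).sub (integrable_const _)
    rw [integral_sub (hZ2 k) h1,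
      integral_sub ((hZ k).const_mul _) (integrable_const _), integral_const_mul, integral_const,
      probReal_univ, one_smul]
    nlinarith [sq_nonneg (∫ w', Z w' k ∂P)]
  have hi : ∀ k, Integrable (fun w => (Z w k - ∫ w', Z w' k ∂P) ^ 2) P := fun k => by
    refine Integrable.of_bound (((hZm k).sub aestronglyMeasurable_const).pow 2)
      ((B + |∫ w', Z w' k ∂P|) ^ 2) ?_
    filter_upwards [hb k] with w hw
    rw [norm_pow]
    exact pow_le_pow_left₀ (norm_nonneg _) ((norm_sub_le _ _).trans (add_le_add hw le_rfl)) 2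
  simp only [EuclideanSpace.real_norm_sq_eq]
  rw [integral_finsetSum _ fun k _ => hi k]
  refine (Finset.sum_le_sum fun k _ => e1 k).trans ?_
  rw [← integral_finsetSum _ fun k _ => hZ2 k]
  have hle : ∀ᵐ w ∂P, ∑ k, Z w k ^ 2 ≤ B ^ 2 := by
    filter_upwards [h] with w hw
    have h1 := norm_toLp_le_sum_abs (Z w)
    rw [← EuclideanSpace.real_norm_sq_eq (WithLp.toLp 2 (Z w))]
    exact pow_le_pow_left₀ (norm_nonneg _) (h1.trans hw) 2
  refine (integral_mono_ae (integrable_finsetSum _ fun k _ => hZ2 k)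
    (integrable_const _) hle).trans ?_
  simp

end Mean

/-! ### Concentration of the empirical quantities -/

/-- The rate `√((K - 1 + log((p + 1)/ε)) / n)`. -/
noncomputable def rate (K p n : ℕ) (ε : ℝ) : ℝ :=
  √(((K : ℝ) - 1) / n + Real.log (((p : ℝ) + 1) / ε) / n)

lemma Constants.lam1_eq (c : Constants) (K p n : ℕ) (ε : ℝ) :
    c.lam1 K p n ε = 4 * √2 * c.B0 ^ 2 * c.B1 * rate K p n ε := rfl

lemma Constants.lam2_ge (c : Constants) (K p n : ℕ) (ε : ℝ) :
    √3 * (c.B0 * (c.B1 - 1) * c.σ0) * rate K p n ε ≤ c.lam2 K p n ε :=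
  le_trans (le_of_eq (by rw [rate]; ring)) (le_max_right _ _)

lemma weight_le_exp {d K p : ℕ} (f : (Fin d → ℝ) → Fin (p + 1) → ℝ) {t : Fin K} (γ : Coef K p t)
    (o : Obs d K) (k : {k : Fin K // k ≠ t}) :
    weight f γ o k ≤ Real.exp (lin γ (f o.2.2) k) :=
  mul_le_of_le_one_left (Real.exp_pos _).le (ind_le_one _ _)

namespace Problem

variable {Ω₀ : Type u} {Ω : Type v} [MeasurableSpace Ω₀] [MeasurableSpace Ω] {d K p n : ℕ}
  {Q : Problem Ω₀ Ω d K p n} {c : Constants} {ε : ℝ}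

/-- The weighted mean over the treatments of the squared normalized residuals. -/
noncomputable def meanSq (Q : Problem Ω₀ Ω d K p n) (σ : ℝ) (w : Ω₀) : ℝ :=
  (∑ k : {k : Fin K // k ≠ Q.t}, Real.exp (lin Q.γbar (Q.f (Q.X w)) k) * Q.potResid w k ^ 2) /
    (∑ k : {k : Fin K // k ≠ Q.t}, Real.exp (lin Q.γbar (Q.f (Q.X w)) k)) / σ ^ 2

lemma meanSq_nonneg (Q : Problem Ω₀ Ω d K p n) (σ : ℝ) (w : Ω₀) :
    0 ≤ Q.meanSq σ w := by
  rw [meanSq]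
  exact div_nonneg (div_nonneg (Finset.sum_nonneg fun k _ =>
    mul_nonneg (Real.exp_pos _).le (sq_nonneg _)) (Finset.sum_nonneg fun k _ =>
    (Real.exp_pos _).le)) (sq_nonneg _)

namespace Conditions

lemma log_pos (hQ : Q.Conditions c ε) : 0 < Real.log (((p : ℝ) + 1) / ε) := by
  refine Real.log_pos ?_
  rw [lt_div_iff₀ hQ.ε_pos]
  have : (0 : ℝ) ≤ p := Nat.cast_nonneg p
  linarith [hQ.ε_lt_one]

lemma n_pos (hQ : Q.Conditions c ε) : 0 < n := hQ.one_le_n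

lemma n_mul_rate_sq (hQ : Q.Conditions c ε) :
    n * rate K p n ε ^ 2 = (K - 1) + Real.log (((p : ℝ) + 1) / ε) := by
  have hn : (0 : ℝ) < n := Nat.cast_pos.2 hQ.n_pos
  have hK : (2 : ℝ) ≤ K := by exact_mod_cast hQ.two_le_K
  have hL := hQ.log_pos
  rw [rate, Real.sq_sqrt (by
    have : 0 ≤ ((K : ℝ) - 1) / n := div_nonneg (by linarith) hn.le
    positivity)]
  field_simp

lemma rate_pos (hQ : Q.Conditions c ε) : 0 < rate K p n ε := by
  have hn : (0 : ℝ) < n := Nat.cast_pos.2 hQ.n_pos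
  have hK : (2 : ℝ) ≤ K := by exact_mod_cast hQ.two_le_K
  have hL := hQ.log_pos
  refine Real.sqrt_pos.2 (add_pos (div_pos (by linarith) hn) (div_pos hL hn))

lemma lam1_pos (hQ : Q.Conditions c ε) (hc : c.Admissible) : 0 < c.lam1 K p n ε := by
  have := hQ.rate_pos
  have h0 := hc.B0
  have h1 := hc.B1
  rw [Constants.lam1_eq]; positivity

/-- Compatibility tested on a single intercept entry gives ν₁² ≤ |S_γ|B₁, and sparsity gives (ξ₁ +
1)²|S_γ|λ̃₁ ≤ ν₁²; hence 4λ̃₁ ≤ B₁, which is an absolute bound on the rate. It makes the exponential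
factors in the tail bounds harmless. -/
lemma rate_le (hQ : Q.Conditions c ε) (hc : c.Admissible) : rate K p n ε ≤ 1 / 22 := by
  have := Q.isProb_P
  have hr := hQ.rate_pos
  have hB0 := hc.B0
  have hB1 := hc.B1
  have hξ := hc.ξ1
  have hν := hc.ν1
  have hl := hQ.lam1_pos hc
  obtain ⟨k, hk⟩ : ∃ k : Fin K, k ≠ Q.t := by
    have : Nontrivial (Fin K) := Fin.nontrivial_iff_two_le.2 hQ.two_le_K
    exact exists_ne Q.t
  classical
  set b : Coef K p Q.t := Pi.single 0 (EuclideanSpace.single ⟨k, hk⟩ (1 : ℝ)) with hb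
  have h0 : (0 : Fin (p + 1)) ∈ Q.Sγ := by simp [Sγ, supp]
  have hs : ∑ j ∈ Q.Sγ, ‖b j‖ = 1 := by
    rw [Finset.sum_eq_single_of_mem 0 h0 fun j _ hj => by simp [hb, hj]]
    simp [hb]
  have hs' : ∑ j ∈ Q.Sγᶜ, ‖b j‖ = 0 := by
    refine Finset.sum_eq_zero fun j hj => ?_
    have : j ≠ 0 := fun h => by rw [h] at hj; exact (Finset.mem_compl.1 hj) h0
    simp [hb, this]
  have h1 := hQ.compat_γ b (by rw [hs, hs']; linarith)
  rw [hs, ← hQ.popQuad_eq_gram hc] at h1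
  have hlin : ∀ w k', lin b (Q.f (Q.X w)) k' = if k' = ⟨k, hk⟩ then 1 else 0 := by
    intro w k'
    rw [lin, Finset.sum_eq_single_of_mem 0 (Finset.mem_univ _) fun j _ hj => by simp [hb, hj],
      Q.f_zero]
    simp [hb]
  have h2 : Q.popQuad b ≤ c.B1 := by
    refine (integral_mono_ae (hQ.integrable_quad hc b) (integrable_const c.B1) ?_).trans (by simp)
    filter_upwards [hQ.ae_weight_le] with w hw
    rw [Finset.sum_eq_single_of_mem ⟨k, hk⟩ (Finset.mem_univ _) fun k' _ hk' => by
      simp [hlin, hk']]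
    simp only [hlin, if_true]
    linarith [hw ⟨k, hk⟩]
  have hN : (0 : ℝ) < Q.Sγ.card := by exact_mod_cast Finset.card_pos.2 ⟨0, h0⟩
  have h3 : c.ν1 ^ 2 ≤ Q.Sγ.card * c.B1 := by
    have := mul_le_mul_of_nonneg_left h2 hN.le
    linarith
  have h4 : (c.ξ1 + 1) ^ 2 * Q.Sγ.card * c.lam1 K p n ε ≤ c.ν1 ^ 2 := by
    have h5 := mul_le_mul_of_nonneg_right (hQ.sparse_γ_a.trans hc.η11.2.le)
      (pow_pos hν 2).le
    have hν1 := hν.ne'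
    have e : (c.ξ1 + 1) ^ 2 * (c.ν1 ^ 2)⁻¹ * Q.Sγ.card * c.lam1 K p n ε * c.ν1 ^ 2 =
      (c.ξ1 + 1) ^ 2 * Q.Sγ.card * c.lam1 K p n ε := by field_simp
    rw [e] at h5; linarith
  have h6 : (c.ξ1 + 1) ^ 2 * c.lam1 K p n ε ≤ c.B1 := by
    refine le_of_mul_le_mul_left ?_ hN
    linarith
  have h7 : 4 * c.lam1 K p n ε ≤ c.B1 :=
    (mul_le_mul_of_nonneg_right (by nlinarith : (4 : ℝ) ≤ (c.ξ1 + 1) ^ 2) hl.le).trans h6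
  rw [Constants.lam1_eq] at h7
  have h8 : (1.4 : ℝ) ≤ √2 := Real.le_sqrt_of_sq_le (by norm_num)
  have h9 : 1 ≤ c.B0 ^ 2 := one_le_pow₀ hB0
  have h10 : 16 * √2 * rate K p n ε ≤ 1 := by
    have h11 : (16 * √2 * rate K p n ε) * c.B1 ≤ 1 * c.B1 := by
      have h12 : (16 * √2 * rate K p n ε) * c.B1 * 1 ≤
        (16 * √2 * rate K p n ε) * c.B1 * c.B0 ^ 2 := by gcongr
      linarith
    exact le_of_mul_le_mul_right h11 (by linarith)
  nlinarith

/-- The exponent contains K − 1 ≥ 1, and the resulting factor e^{-1} ≤ 1/2 absorbs the 2 of the tail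
bound. -/
lemma two_mul_exp_le (hQ : Q.Conditions c ε) {x : ℝ} (hx : x ≤ -(n * rate K p n ε ^ 2)) :
    2 * Real.exp x ≤ ε / (p + 1) := by
  have hK : (2 : ℝ) ≤ K := by exact_mod_cast hQ.two_le_K
  have hp : (0 : ℝ) < p + 1 := by positivity
  have hε := hQ.ε_pos
  rw [hQ.n_mul_rate_sq] at hx
  have h1 : Real.exp x ≤ Real.exp (-1) * Real.exp (-Real.log (((p : ℝ) + 1) / ε)) := by
    rw [← Real.exp_add]; exact Real.exp_le_exp.2 (by linarith)
  rw [Real.exp_neg (Real.log _), Real.exp_log (by positivity), inv_div] at h1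
  have h2 : 2 * Real.exp (-1) ≤ 1 := by
    rw [Real.exp_neg]
    have := Real.exp_one_gt_d9
    rw [mul_inv_le_iff₀ (Real.exp_pos 1)]; linarith
  have h3 : 0 ≤ ε / (p + 1) := by positivity
  nlinarith

/-- Doubling the exponent provides for a union over (p + 1)² pairs of regressors. -/
lemma two_mul_exp_le_sq (hQ : Q.Conditions c ε) {x : ℝ}
    (hx : x ≤ -(2 * (n * rate K p n ε ^ 2))) : 2 * Real.exp x ≤ (ε / (p + 1)) ^ 2 := by
  have h := hQ.two_mul_exp_le (x := x / 2) (by linarith)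
  have h1 : Real.exp x = Real.exp (x / 2) * Real.exp (x / 2) := by
    rw [← Real.exp_add]; congr 1; ring
  have h2 := Real.exp_pos (x / 2)
  have h3 := pow_le_pow_left₀ (by positivity) h 2
  rw [h1]
  nlinarith

lemma measurable_toLp_comp {κ : Type*} [Fintype κ] {z : Obs d K → κ → ℝ}
    (hz : ∀ k, Measurable fun o => z o k) :
    Measurable fun o => (WithLp.toLp 2 (z o) : EuclideanSpace ℝ κ) :=
  (WithLp.measurable_toLp 2 _).comp (measurable_pi_iff.2 hz)

lemma setOf_le_norm_avgVec (hn : 0 < n) (z : Obs d K → {k : Fin K // k ≠ Q.t} → ℝ) (x : ℝ) :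
    {ω | x ≤ ‖avgVec (Q.sample ω) z‖} = {ω | n * x ≤
      ‖∑ i, (WithLp.toLp 2 (z (Q.obs i ω)) : EuclideanSpace ℝ {k : Fin K // k ≠ Q.t})‖} := by
  ext ω
  have h := norm_sum_toLp hn (Q.sample ω) z
  have hn' : (0 : ℝ) < n := Nat.cast_pos.2 hn
  simp only [sample] at h
  simp only [Set.mem_ofPred_eq, h]
  exact (mul_le_mul_iff_right₀ hn').symm

/-- The score vectors have mean zero by the first-order condition at γ̄ and norm at most B₀B₁: the
weights sum to at most B₁ − 1 and the indicators to at most 1. -/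
lemma measure_score_le (hQ : Q.Conditions c ε) (hc : c.Admissible) (j : Fin (p + 1)) :
    Q.μ {ω | c.lam1 K p n ε ≤ ‖avgVec (Q.sample ω) fun o k =>
      (weight Q.f Q.γbar o k - ind o.2.1 k) * Q.f o.2.2 j‖} ≤ ENNReal.ofReal (ε / (p + 1)) := by
  have := Q.isProb_P
  have := Q.isProb_μ
  classical
  have hB0 := hc.B0
  have hB1 := hc.B1
  have hr := hQ.rate_pos
  have hr2 := hQ.rate_le hc
  have hn : (0 : ℝ) < n := Nat.cast_pos.2 hQ.n_pos
  set r := rate K p n ε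
  set B := c.B0 * c.B1 with hB
  have hBpos : 0 < B := by positivity
  have hbound : ∀ᵐ w ∂Q.P, ‖(WithLp.toLp 2 fun k => (weight Q.f Q.γbar (Q.pop w) k -
      ind (Q.pop w).2.1 k) * Q.f (Q.pop w).2.2 j : EuclideanSpace ℝ {k // k ≠ Q.t})‖ ≤ B := by
    filter_upwards [hQ.ae_bounded hc, hQ.ae_sum_weight_le] with w hw hw'
    refine (norm_toLp_le_sum_abs _).trans ?_
    simp only [abs_mul]
    rw [← Finset.sum_mul, mul_comm, hB]
    refine mul_le_mul (hw j) ?_ (Finset.sum_nonneg fun _ _ => abs_nonneg _) (by linarith)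
    have h1 : ∑ k : {k : Fin K // k ≠ Q.t}, ind (Q.T w) k ≤ 1 := by
      by_cases h : Q.T w = Q.t
      · refine (Finset.sum_eq_zero fun k _ => ?_).trans_le zero_le_one
        have hk : ¬ Q.t = k := fun h' => k.2 h'.symm
        simp [ind, h, hk]
      · rw [Finset.sum_eq_single_of_mem ⟨Q.T w, h⟩ (Finset.mem_univ _)]
        · exact ind_le_one _ _
        · intro k _ hk
          have : ¬ Q.T w = k := fun h' => hk (Subtype.ext h'.symm)
          simp [ind, this]
    calc ∑ k : {k : Fin K // k ≠ Q.t}, |weight Q.f Q.γbar (Q.pop w) k - ind (Q.T w) k|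
        ≤ ∑ k : {k : Fin K // k ≠ Q.t}, (weight Q.f Q.γbar (Q.pop w) k + ind (Q.T w) k) := by
          refine Finset.sum_le_sum fun k _ => (abs_sub _ _).trans ?_
          rw [abs_of_nonneg (weight_nonneg _ _ _ _), abs_of_nonneg (ind_nonneg _ _)]
      _ ≤ (c.B1 - 1) + 1 := by rw [Finset.sum_add_distrib]; exact add_le_add hw' h1
      _ = c.B1 := by ring
  have hV : ∫ w, ‖(WithLp.toLp 2 fun k => (weight Q.f Q.γbar (Q.pop w) k -
      ind (Q.pop w).2.1 k) * Q.f (Q.pop w).2.2 j : EuclideanSpace ℝ {k // k ≠ Q.t})‖ ^ 2 ∂Q.P ≤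
      B ^ 2 := by
    refine (integral_mono_of_nonneg (ae_of_all _ fun w => sq_nonneg _)
      (integrable_const (B ^ 2)) ?_).trans (by simp)
    filter_upwards [hbound] with w hw
    exact pow_le_pow_left₀ (norm_nonneg _) hw 2
  rw [setOf_le_norm_avgVec hQ.n_pos]
  -- With l = r/B and e^r ≤ 2 the moment term is at most nr², while lτ = 4√2·B₀·nr² ≥ 2nr².
  refine (measure_norm_sum_ge_le_of_bounded Q.measurable_obs Q.indep Q.measurable_pop Q.law
    (measurable_toLp_comp (z := fun o k => (weight Q.f Q.γbar o k - ind o.2.1 k) * Q.f o.2.2 j)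
      fun k => ((measurable_weight Q.measurable_f _ k).sub (measurable_ind _)).mul
        (measurable_coord Q.measurable_f j)) (fun v => ?_)
    (l := r / B) (by positivity) hbound hV _).trans (ENNReal.ofReal_le_ofReal
      (hQ.two_mul_exp_le ?_))
  · refine Eq.trans ?_ (hQ.integral_calScore hc (Pi.single j v))
    refine integral_congr_ae (ae_of_all _ fun w => ?_)
    simp only [PiLp.inner_apply, RCLike.inner_apply, conj_trivial]
    refine Finset.sum_congr rfl fun k _ => ?_
    have : lin (Pi.single j v : Coef K p Q.t) (Q.f (Q.X w)) k = v k * Q.f (Q.X w) j := by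
      rw [lin, Finset.sum_eq_single_of_mem j (Finset.mem_univ _) fun i _ hi => by simp [hi]]
      simp
    rw [this]; simp only [pop]; ring
  · rw [Constants.lam1_eq]
    have e1 : r / B * B = r := by field_simp
    have e2 : (r / B) ^ 2 * B ^ 2 = r ^ 2 := by field_simp
    have e3 : r / B * (n * (4 * √2 * c.B0 ^ 2 * c.B1 * r)) = n * r ^ 2 * (4 * √2 * c.B0) := by
      rw [hB]; field_simp
    rw [e1, e2]
    have h1 : Real.exp r ≤ 2 := by
      have h2 := Real.exp_bound_div_one_sub_of_interval hr.le (by linarith)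
      refine h2.trans ?_
      rw [div_le_iff₀ (by linarith)]; linarith
    have h8 : (1 : ℝ) ≤ √2 := Real.one_le_sqrt.2 (by norm_num)
    have h9 : 2 ≤ 4 * √2 * c.B0 := by nlinarith
    have h10 : 0 < n * r ^ 2 := by positivity
    have h11 : n * (r ^ 2 / 2 * Real.exp r) ≤ n * r ^ 2 := by
      have : r ^ 2 / 2 * Real.exp r ≤ r ^ 2 := by nlinarith [sq_nonneg r]
      gcongr
    have h12 := mul_le_mul_of_nonneg_left h9 h10.le
    rw [e3]; linarith

lemma measure_gram_le (hQ : Q.Conditions c ε) (hc : c.Admissible) (i j : Fin (p + 1)) :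
    Q.μ {ω | c.lam1 K p n ε / 2 ≤ ‖avgVec (Q.sample ω) fun o k =>
      weight Q.f Q.γbar o k * (Q.f o.2.2 i * Q.f o.2.2 j) - ∫ w, weight Q.f Q.γbar (Q.pop w) k *
        (Q.f (Q.pop w).2.2 i * Q.f (Q.pop w).2.2 j) ∂Q.P‖} ≤
      ENNReal.ofReal ((ε / (p + 1)) ^ 2) := by
  have := Q.isProb_P
  have := Q.isProb_μ
  have hB0 := hc.B0
  have hB1 := hc.B1
  have hr := hQ.rate_pos
  have hr2 := hQ.rate_le hc
  have hn : (0 : ℝ) < n := Nat.cast_pos.2 hQ.n_pos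
  set r := rate K p n ε
  set B := c.B0 ^ 2 * c.B1 with hB
  have hBpos : 0 < B := by positivity
  have hint := fun k => hQ.integrable_gram hc k i j
  have hbound : ∀ᵐ w ∂Q.P, ∑ k, |weight Q.f Q.γbar (Q.pop w) k *
      (Q.f (Q.pop w).2.2 i * Q.f (Q.pop w).2.2 j)| ≤ B := by
    filter_upwards [hQ.ae_bounded hc, hQ.ae_sum_weight_le] with w hw hw'
    simp only [abs_mul, abs_of_nonneg (weight_nonneg _ _ _ _)]
    rw [← Finset.sum_mul, hB, mul_comm (c.B0 ^ 2), sq]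
    exact mul_le_mul (hw'.trans (by linarith))
      (mul_le_mul (hw i) (hw j) (abs_nonneg _) (by linarith)) (by positivity) (by linarith)
  have h2 := norm_centered_le hint (integrable_const B) hbound
  simp only [integral_const, probReal_univ, one_smul] at h2
  have hV := integral_sq_norm_centered_le (fun k => (hint k).aestronglyMeasurable) hbound
  rw [setOf_le_norm_avgVec hQ.n_pos]
  -- With l = √2·r/B the moment term is at most 2nr² and lτ = 4nr². The difference 2nr² is what a
  -- union over pairs requires.
  refine (measure_norm_sum_ge_le_of_bounded Q.measurable_obs Q.indep Q.measurable_pop Q.law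
    (measurable_toLp_comp (z := fun o k => weight Q.f Q.γbar o k * (Q.f o.2.2 i * Q.f o.2.2 j) -
      ∫ w, weight Q.f Q.γbar (Q.pop w) k *
        (Q.f (Q.pop w).2.2 i * Q.f (Q.pop w).2.2 j) ∂Q.P)
      fun k => ((measurable_weight Q.measurable_f _ k).mul
        ((measurable_coord Q.measurable_f i).mul (measurable_coord Q.measurable_f j))).sub
        measurable_const) (fun v => integral_inner_centered hint v)
    (l := √2 * r / B) (by positivity) h2 hV _).trans (ENNReal.ofReal_le_ofReal
      (hQ.two_mul_exp_le_sq ?_))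
  rw [Constants.lam1_eq]
  have hs2 : √2 ^ 2 = 2 := Real.sq_sqrt (by norm_num)
  have e1 : √2 * r / B * (B + B) = 2 * √2 * r := by field_simp; ring
  have e2 : (√2 * r / B) ^ 2 * B ^ 2 = 2 * r ^ 2 := by
    rw [div_pow, mul_pow, hs2]; field_simp
  have e3 : √2 * r / B * (n * (4 * √2 * c.B0 ^ 2 * c.B1 * r / 2)) = 4 * (n * r ^ 2) := by
    have : √2 * r / B * (n * (4 * √2 * c.B0 ^ 2 * c.B1 * r / 2)) =
        √2 ^ 2 * 2 * (n * r ^ 2) * (B / B) := by rw [hB]; ring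
    rw [this, hs2, div_self hBpos.ne']; ring
  rw [e1, e2, e3]
  have hs3 : √2 ≤ 1.5 := Real.sqrt_le_iff.2 ⟨by norm_num, by norm_num⟩
  have hx : 2 * √2 * r ≤ 1 / 2 := by nlinarith
  have h1 : Real.exp (2 * √2 * r) ≤ 2 := by
    have h2 := Real.exp_bound_div_one_sub_of_interval (x := 2 * √2 * r) (by positivity)
      (by linarith)
    refine h2.trans ?_
    rw [div_le_iff₀ (by linarith)]; linarith
  have h11 : n * (2 * r ^ 2 / 2 * Real.exp (2 * √2 * r)) ≤ n * (2 * r ^ 2) := by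
    have : 2 * r ^ 2 / 2 * Real.exp (2 * √2 * r) ≤ 2 * r ^ 2 := by nlinarith [sq_nonneg r]
    gcongr
  linarith

lemma ae_sum_mul_sq_le (hQ : Q.Conditions c ε) (hc : c.Admissible) : ∀ᵐ w ∂Q.P,
    ∑ k : {k : Fin K // k ≠ Q.t}, Real.exp (lin Q.γbar (Q.f (Q.X w)) k) * Q.potResid w k ^ 2 ≤
      (c.B1 - 1) * c.σ0 ^ 2 * Q.meanSq c.σ0 w := by
  have hσ := hc.σ0
  filter_upwards [hQ.ae_sum_exp_le] with w hw
  have h0 := Q.meanSq_nonneg c.σ0 w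
  have hne : (Finset.univ : Finset {k : Fin K // k ≠ Q.t}).Nonempty := by
    have : Nontrivial (Fin K) := Fin.nontrivial_iff_two_le.2 hQ.two_le_K
    obtain ⟨k, hk⟩ := exists_ne Q.t
    exact ⟨⟨k, hk⟩, Finset.mem_univ _⟩
  have hW : 0 < ∑ k : {k : Fin K // k ≠ Q.t}, Real.exp (lin Q.γbar (Q.f (Q.X w)) k) :=
    Finset.sum_pos (fun k _ => Real.exp_pos _) hne
  have e : ∑ k : {k : Fin K // k ≠ Q.t},
      Real.exp (lin Q.γbar (Q.f (Q.X w)) k) * Q.potResid w k ^ 2 =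
      (∑ k : {k : Fin K // k ≠ Q.t}, Real.exp (lin Q.γbar (Q.f (Q.X w)) k)) *
        (c.σ0 ^ 2 * Q.meanSq c.σ0 w) := by
    rw [meanSq]; field_simp
  rw [e, mul_assoc]
  exact mul_le_mul_of_nonneg_right hw (by positivity)

/-- The gradient vectors have mean zero by the first-order condition at ᾱ. A squared weight is at
most B₁ − 1 times the weight, so the squared norm is at most s² times the weighted mean square of
the residuals, whose exponential moment is at most 2. -/
lemma measure_outcome_le (hQ : Q.Conditions c ε) (hc : c.Admissible) (j : Fin (p + 1)) :
    Q.μ {ω | c.lam2 K p n ε ≤ ‖avgVec (Q.sample ω) fun o k =>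
      weight Q.f Q.γbar o k * resid Q.f Q.αbar o k * Q.f o.2.2 j‖} ≤
      ENNReal.ofReal (ε / (p + 1)) := by
  have := Q.isProb_P
  have := Q.isProb_μ
  classical
  have hB0 := hc.B0
  have hB1 := hc.B1
  have hσ := hc.σ0
  have hr := hQ.rate_pos
  have hr2 := hQ.rate_le hc
  have hn : (0 : ℝ) < n := Nat.cast_pos.2 hQ.n_pos
  have hlam := c.lam2_ge K p n ε
  set r := rate K p n ε
  set s := c.B0 * (c.B1 - 1) * c.σ0 with hs
  have hspos : 0 < s := mul_pos (mul_pos (by linarith) (by linarith)) hσ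
  obtain ⟨hyi, hy2⟩ := hQ.integral_exp_mean_sq_le
  have hbound : ∀ᵐ w ∂Q.P, ‖(WithLp.toLp 2 fun k => weight Q.f Q.γbar (Q.pop w) k *
      resid Q.f Q.αbar (Q.pop w) k * Q.f (Q.pop w).2.2 j :
        EuclideanSpace ℝ {k // k ≠ Q.t})‖ ^ 2 ≤ s ^ 2 * Q.meanSq c.σ0 w := by
    filter_upwards [hQ.ae_bounded hc, hQ.ae_sum_exp_le, hQ.ae_sum_mul_sq_le hc] with w hw hw' hw''
    rw [EuclideanSpace.real_norm_sq_eq]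
    have h1 : ∀ k, (weight Q.f Q.γbar (Q.pop w) k * resid Q.f Q.αbar (Q.pop w) k *
        Q.f (Q.pop w).2.2 j) ^ 2 ≤ c.B0 ^ 2 * (c.B1 - 1) *
          (Real.exp (lin Q.γbar (Q.f (Q.X w)) k) * Q.potResid w k ^ 2) := by
      intro k
      have e := Q.weight_mul_resid Q.γbar w k fun x => x
      rw [e]
      have h2 := weight_le_exp Q.f Q.γbar (Q.pop w) k
      have h3 := (Finset.single_le_sum (f := fun k => Real.exp (lin Q.γbar (Q.f (Q.X w)) k))
        (fun k _ => (Real.exp_pos _).le) (Finset.mem_univ k)).trans hw'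
      have h4 : Q.f (Q.X w) j ^ 2 ≤ c.B0 ^ 2 := by
        rw [← sq_abs]; exact pow_le_pow_left₀ (abs_nonneg _) (hw j) 2
      have h5 := weight_nonneg Q.f Q.γbar (Q.pop w) k
      simp only [pop] at h2 h5 ⊢
      calc (weight Q.f Q.γbar (Q.Ypot (Q.T w) w, Q.T w, Q.X w) k * Q.potResid w k *
            Q.f (Q.X w) j) ^ 2
          = Q.f (Q.X w) j ^ 2 * (weight Q.f Q.γbar (Q.Ypot (Q.T w) w, Q.T w, Q.X w) k *
            (weight Q.f Q.γbar (Q.Ypot (Q.T w) w, Q.T w, Q.X w) k * Q.potResid w k ^ 2)) := by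
              ring
        _ ≤ c.B0 ^ 2 * ((c.B1 - 1) *
            (Real.exp (lin Q.γbar (Q.f (Q.X w)) k) * Q.potResid w k ^ 2)) := by
            gcongr
            exact h2.trans h3
        _ = _ := by ring
    refine (Finset.sum_le_sum fun k _ => h1 k).trans ?_
    rw [← Finset.mul_sum]
    have h6 := mul_le_mul_of_nonneg_left hw''
      (show 0 ≤ c.B0 ^ 2 * (c.B1 - 1) from mul_nonneg (sq_nonneg _) (by linarith))
    refine h6.trans (le_of_eq ?_)
    rw [hs]; ring
  rw [setOf_le_norm_avgVec hQ.n_pos]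
  -- The choice ls = 5r/4 is close to optimal: the remaining numerical inequality is (25/16) log 2 +
  -- 1 ≤ (5/4)√3.
  refine (measure_norm_sum_ge_le_of_subGaussian Q.measurable_obs Q.indep Q.measurable_pop Q.law
    (measurable_toLp_comp (z := fun o k => weight Q.f Q.γbar o k * resid Q.f Q.αbar o k *
      Q.f o.2.2 j)
      fun k => ((measurable_weight Q.measurable_f _ k).mul
        (measurable_resid Q.measurable_f _ k)).mul (measurable_coord Q.measurable_f j)) (fun v => ?_)
    (l := 5 / 4 * r / s) (by positivity) hspos.le ?_ hbound hyi hy2 _).trans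
      (ENNReal.ofReal_le_ofReal (hQ.two_mul_exp_le ?_))
  · refine Eq.trans ?_ (hQ.integral_wlScore hc (Pi.single j v))
    refine integral_congr_ae (ae_of_all _ fun w => ?_)
    simp only [PiLp.inner_apply, RCLike.inner_apply, conj_trivial]
    refine Finset.sum_congr rfl fun k _ => ?_
    have : lin (Pi.single j v : Coef K p Q.t) (Q.f (Q.X w)) k = v k * Q.f (Q.X w) j := by
      rw [lin, Finset.sum_eq_single_of_mem j (Finset.mem_univ _) fun i _ hi => by simp [hi]]
      simp
    rw [this]; simp only [pop]; ring
  · have e1 : 5 / 4 * r / s * s = 5 / 4 * r := by field_simp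
    rw [e1]; linarith
  · have e2 : (5 / 4 * r / s) ^ 2 * s ^ 2 = 25 / 16 * r ^ 2 := by field_simp; ring
    rw [e2]
    have h1 : 5 / 4 * r / s * (n * (√3 * s * r)) ≤ 5 / 4 * r / s * (n * c.lam2 K p n ε) := by
      gcongr
    have e3 : 5 / 4 * r / s * (n * (√3 * s * r)) = 5 / 4 * √3 * (n * r ^ 2) := by field_simp
    have h3 : (1.73 : ℝ) ≤ √3 := Real.le_sqrt_of_sq_le (by norm_num)
    have h4 := Real.log_two_lt_d9
    have h5 : 0 < n * r ^ 2 := by positivity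
    rw [e3] at h1
    have h6 : n * r ^ 2 * (25 / 16 * Real.log 2) ≤ n * r ^ 2 * (5 / 4 * √3 - 1) := by
      refine mul_le_mul_of_nonneg_left ?_ h5.le
      linarith
    linarith

lemma integrable_gram_sq_resid (hQ : Q.Conditions c ε) (hc : c.Admissible)
    (k : {k : Fin K // k ≠ Q.t}) (i j : Fin (p + 1)) :
    Integrable (fun w => weight Q.f Q.γbar (Q.pop w) k * resid Q.f Q.αbar (Q.pop w) k ^ 2 *
      (Q.f (Q.pop w).2.2 i * Q.f (Q.pop w).2.2 j)) Q.P := by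
  have hB := hc.B0
  have h := hQ.integrable_mul_potResid hc
    (g := fun w => Q.f (Q.X w) i * Q.f (Q.X w) j * weight Q.f Q.γbar (Q.pop w) k)
    ((((measurable_coord Q.measurable_f i).mul (measurable_coord Q.measurable_f j)).mul
      (measurable_weight Q.measurable_f Q.γbar k)).comp Q.measurable_pop)
    (C := c.B0 * c.B0 * (c.B1 - 1)) (by
      filter_upwards [hQ.ae_bounded hc, hQ.ae_weight_le] with w hw hw'
      rw [abs_mul, abs_mul, abs_of_nonneg (weight_nonneg _ _ _ _)]
      exact mul_le_mul (mul_le_mul (hw i) (hw j) (abs_nonneg _) (by linarith)) (hw' k)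
        (weight_nonneg _ _ _ _) (by positivity)) k (φ := fun x => x ^ 2)
    (by fun_prop) (fun x => by rw [abs_of_nonneg (sq_nonneg x)]; linarith)
  refine h.congr (ae_of_all _ fun w => ?_)
  have := Q.weight_mul_resid Q.γbar w k fun x => x ^ 2
  simp only [pop] at this ⊢
  rw [this]; ring

/-- Squared residuals are only sub-exponential, but at the scale of the rate the tail is still of
gaussian type, since ls = r/3 is small. -/
lemma measure_gram_sq_resid_le (hQ : Q.Conditions c ε) (hc : c.Admissible) (i j : Fin (p + 1)) :
    Q.μ {ω | 5 / 2 * c.σ0 ^ 2 * c.lam1 K p n ε ≤ ‖avgVec (Q.sample ω) fun o k =>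
      weight Q.f Q.γbar o k * resid Q.f Q.αbar o k ^ 2 * (Q.f o.2.2 i * Q.f o.2.2 j) -
        ∫ w, weight Q.f Q.γbar (Q.pop w) k * resid Q.f Q.αbar (Q.pop w) k ^ 2 *
        (Q.f (Q.pop w).2.2 i * Q.f (Q.pop w).2.2 j) ∂Q.P‖} ≤
      ENNReal.ofReal ((ε / (p + 1)) ^ 2) := by
  have := Q.isProb_P
  have := Q.isProb_μ
  have hB0 := hc.B0
  have hB1 := hc.B1
  have hσ := hc.σ0
  have hr := hQ.rate_pos
  have hr2 := hQ.rate_le hc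
  have hn : (0 : ℝ) < n := Nat.cast_pos.2 hQ.n_pos
  set r := rate K p n ε
  set s := c.B0 ^ 2 * (c.B1 - 1) * c.σ0 ^ 2 with hs
  have hspos : 0 < s := mul_pos (mul_pos (by positivity) (by linarith)) (by positivity)
  have hint := fun k => hQ.integrable_gram_sq_resid hc k i j
  obtain ⟨hyi, hy2⟩ := hQ.integral_exp_mean_sq_le
  have hm : Measurable fun w => Q.meanSq c.σ0 w := by
    have he : ∀ k : {k : Fin K // k ≠ Q.t},
        Measurable fun w => Real.exp (lin Q.γbar (Q.f (Q.X w)) k) := fun k =>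
      ((measurable_lin Q.γbar k).comp (Q.measurable_f.comp Q.measurable_X)).exp
    exact ((Finset.measurable_fun_sum _ fun k _ => (he k).mul
      ((Q.measurable_potResid k).pow_const 2)).div
      (Finset.measurable_fun_sum _ fun k _ => he k)).div_const _
  have hmi : Integrable (fun w => Q.meanSq c.σ0 w) Q.P := by
    refine hyi.mono' hm.aestronglyMeasurable (ae_of_all _ fun w => ?_)
    rw [Real.norm_of_nonneg (Q.meanSq_nonneg _ w)]
    have := Real.add_one_le_exp (Q.meanSq c.σ0 w)
    rw [meanSq] at this ⊢
    linarith
  -- Integrating 1 + y ≤ e^y gives mean at most 1, so subtracting the mean vector adds at most s to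
  -- the norm.
  have hm1 : ∫ w, Q.meanSq c.σ0 w ∂Q.P ≤ 1 := by
    have h1 : ∫ w, (Q.meanSq c.σ0 w + 1) ∂Q.P ≤ 2 :=
      (integral_mono (hmi.add (integrable_const 1)) hyi fun w =>
        Real.add_one_le_exp (Q.meanSq c.σ0 w)).trans hy2
    rw [integral_add hmi (integrable_const 1)] at h1
    simp at h1; linarith
  have hbound : ∀ᵐ w ∂Q.P, ∑ k, |weight Q.f Q.γbar (Q.pop w) k *
      resid Q.f Q.αbar (Q.pop w) k ^ 2 * (Q.f (Q.pop w).2.2 i * Q.f (Q.pop w).2.2 j)| ≤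
      s * Q.meanSq c.σ0 w := by
    filter_upwards [hQ.ae_bounded hc, hQ.ae_sum_mul_sq_le hc] with w hw hw''
    have h1 : ∀ k, |weight Q.f Q.γbar (Q.pop w) k * resid Q.f Q.αbar (Q.pop w) k ^ 2 *
        (Q.f (Q.pop w).2.2 i * Q.f (Q.pop w).2.2 j)| ≤
        (Real.exp (lin Q.γbar (Q.f (Q.X w)) k) * Q.potResid w k ^ 2) * (c.B0 * c.B0) := by
      intro k
      have e := Q.weight_mul_resid Q.γbar w k fun x => x ^ 2
      rw [e, abs_mul, abs_mul (Q.f _ i), abs_of_nonneg (mul_nonneg (weight_nonneg _ _ _ _)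
        (sq_nonneg _))]
      exact mul_le_mul (mul_le_mul_of_nonneg_right (weight_le_exp _ _ _ _) (sq_nonneg _))
        (mul_le_mul (hw i) (hw j) (abs_nonneg _) (by linarith)) (by positivity) (by positivity)
    refine (Finset.sum_le_sum fun k _ => h1 k).trans ?_
    rw [← Finset.sum_mul]
    have h6 := mul_le_mul_of_nonneg_right hw'' (show 0 ≤ c.B0 * c.B0 by positivity)
    refine h6.trans (le_of_eq ?_)
    rw [hs]; ring
  have h2 := norm_centered_le hint (hmi.const_mul s) hbound
  have h2' : ∀ᵐ w ∂Q.P, ‖(WithLp.toLp 2 fun k => weight Q.f Q.γbar (Q.pop w) k *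
      resid Q.f Q.αbar (Q.pop w) k ^ 2 * (Q.f (Q.pop w).2.2 i * Q.f (Q.pop w).2.2 j) -
      ∫ w, weight Q.f Q.γbar (Q.pop w) k * resid Q.f Q.αbar (Q.pop w) k ^ 2 *
        (Q.f (Q.pop w).2.2 i * Q.f (Q.pop w).2.2 j) ∂Q.P :
          EuclideanSpace ℝ {k // k ≠ Q.t})‖ ≤ s * (Q.meanSq c.σ0 w + 1) := by
    filter_upwards [h2] with w hw
    refine hw.trans ?_
    rw [integral_const_mul]
    have := mul_le_mul_of_nonneg_left hm1 hspos.le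
    linarith
  rw [setOf_le_norm_avgVec hQ.n_pos]
  -- With ls = r/3 the moment term is (8e/9)nr² and lτ is at least (10√2/3)nr²; a margin of 2nr²
  -- remains for the union over pairs.
  refine (measure_norm_sum_ge_le_of_subExponential Q.measurable_obs Q.indep Q.measurable_pop Q.law
    (measurable_toLp_comp (z := fun o k => weight Q.f Q.γbar o k * resid Q.f Q.αbar o k ^ 2 *
      (Q.f o.2.2 i * Q.f o.2.2 j) -
      ∫ w, weight Q.f Q.γbar (Q.pop w) k * resid Q.f Q.αbar (Q.pop w) k ^ 2 *
        (Q.f (Q.pop w).2.2 i * Q.f (Q.pop w).2.2 j) ∂Q.P)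
      fun k => (((measurable_weight Q.measurable_f _ k).mul
        ((measurable_resid Q.measurable_f _ k).pow_const 2)).mul
        ((measurable_coord Q.measurable_f i).mul (measurable_coord Q.measurable_f j))).sub
        measurable_const) (fun v => integral_inner_centered hint v)
    (l := 1 / 3 * r / s) (by positivity) hspos.le ?_ h2' (Q.meanSq_nonneg _) hyi hy2 _).trans
      (ENNReal.ofReal_le_ofReal (hQ.two_mul_exp_le_sq ?_))
  · have e1 : 1 / 3 * r / s * s = 1 / 3 * r := by field_simp
    rw [e1]; linarith
  · have e1 : 1 / 3 * r / s * s = 1 / 3 * r := by field_simp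
    rw [e1, Constants.lam1_eq]
    have h8 : (1.414 : ℝ) ≤ √2 := Real.le_sqrt_of_sq_le (by norm_num)
    have h9 := Real.exp_one_lt_d9
    have h5 : 0 < n * r ^ 2 := by positivity
    have h10 : s * (10 * √2) ≤ 5 / 2 * c.σ0 ^ 2 * (4 * √2 * c.B0 ^ 2 * c.B1) := by
      rw [hs]
      have h11 : c.B0 ^ 2 * (c.B1 - 1) * c.σ0 ^ 2 * (10 * √2) ≤
          c.B0 ^ 2 * c.B1 * c.σ0 ^ 2 * (10 * √2) := by gcongr; linarith
      linarith
    have h12 : 1 / 3 * r / s * (n * (s * (10 * √2) * r)) ≤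
        1 / 3 * r / s * (n * (5 / 2 * c.σ0 ^ 2 * (4 * √2 * c.B0 ^ 2 * c.B1) * r)) := by gcongr
    have e3 : 1 / 3 * r / s * (n * (s * (10 * √2) * r)) = 10 / 3 * √2 * (n * r ^ 2) := by
      field_simp
    rw [e3] at h12
    have h13 : n * r ^ 2 * (8 / 9 * Real.exp 1) ≤ n * r ^ 2 * (10 / 3 * √2 - 2) := by
      refine mul_le_mul_of_nonneg_left ?_ h5.le
      linarith
    linarith

end Conditions

end Problem

/-! ### The main result -/

lemma measure_iUnion_le_card_mul {Ω ι : Type*} [MeasurableSpace Ω] [Fintype ι] {μ : Measure Ω}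
    {s : ι → Set Ω} {x : ℝ} (h : ∀ i, μ (s i) ≤ ENNReal.ofReal x) :
    μ (⋃ i, s i) ≤ ENNReal.ofReal (Fintype.card ι * x) := by
  refine (measure_iUnion_fintype_le μ s).trans ((Finset.sum_le_sum fun i _ => h i).trans ?_)
  rw [Finset.sum_const, Finset.card_univ, ENNReal.ofReal_mul (Nat.cast_nonneg _),
    ENNReal.ofReal_natCast, nsmul_eq_mul]

namespace Problem

variable {Ω₀ : Type u} {Ω : Type v} [MeasurableSpace Ω₀] [MeasurableSpace Ω] {d K p n : ℕ}
  {Q : Problem Ω₀ Ω d K p n} {c : Constants} {ε : ℝ}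

/-- The samples on which the deterministic error bounds hold. -/
def goodSet (Q : Problem Ω₀ Ω d K p n) (c : Constants) (ε : ℝ) : Set Ω :=
  {ω | IsGoodSample Q.f (Q.sample ω) Q.γbar Q.αbar c.B0 c.σ0 (c.lam1 K p n ε) (c.lam2 K p n ε)
    Q.popQuad}

namespace Conditions

lemma ae_bounded_sample (hQ : Q.Conditions c ε) (hc : c.Admissible) :
    ∀ᵐ ω ∂Q.μ, ∀ i j, |Q.f (Q.sample ω i).2.2 j| ≤ c.B0 := by
  refine ae_all_iff.2 fun i => ae_all_iff.2 fun j => ?_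
  have hm : MeasurableSet {o : Obs d K | |Q.f o.2.2 j| ≤ c.B0} :=
    (measurable_coord Q.measurable_f j).norm measurableSet_Iic
  have h : ∀ᵐ o ∂Q.P.map Q.pop, |Q.f o.2.2 j| ≤ c.B0 :=
    (ae_map_iff Q.measurable_pop.aemeasurable hm).2
      ((hQ.ae_bounded hc).mono fun w hw => hw j)
  have hlaw : Q.μ.map (Q.obs i) = Q.P.map Q.pop := Q.law i
  rw [← hlaw] at h
  exact ae_of_ae_map (Q.measurable_obs i).aemeasurable h

lemma isGoodSample (hQ : Q.Conditions c ε) (hc : c.Admissible) {ω : Ω}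
    (hbdd : ∀ i j, |Q.f (Q.sample ω i).2.2 j| ≤ c.B0)
    (hscore : ∀ j, ‖avgVec (Q.sample ω) fun o k =>
      (weight Q.f Q.γbar o k - ind o.2.1 k) * Q.f o.2.2 j‖ ≤ c.lam1 K p n ε)
    (hgram : ∀ i j, ‖avgVec (Q.sample ω) fun o k =>
      weight Q.f Q.γbar o k * (Q.f o.2.2 i * Q.f o.2.2 j) - ∫ w, weight Q.f Q.γbar (Q.pop w) k *
        (Q.f (Q.pop w).2.2 i * Q.f (Q.pop w).2.2 j) ∂Q.P‖ ≤ c.lam1 K p n ε / 2)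
    (hout : ∀ j, ‖avgVec (Q.sample ω) fun o k =>
      weight Q.f Q.γbar o k * resid Q.f Q.αbar o k * Q.f o.2.2 j‖ ≤ c.lam2 K p n ε)
    (hsq : ∀ i j, ‖avgVec (Q.sample ω) fun o k =>
      weight Q.f Q.γbar o k * resid Q.f Q.αbar o k ^ 2 * (Q.f o.2.2 i * Q.f o.2.2 j) -
        ∫ w, weight Q.f Q.γbar (Q.pop w) k * resid Q.f Q.αbar (Q.pop w) k ^ 2 *
        (Q.f (Q.pop w).2.2 i * Q.f (Q.pop w).2.2 j) ∂Q.P‖ ≤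
          5 / 2 * c.σ0 ^ 2 * c.lam1 K p n ε) :
    ω ∈ Q.goodSet c ε := by
  have hg : ∀ b, |empQuad Q.f (Q.sample ω) Q.γbar b - Q.popQuad b| ≤
      c.lam1 K p n ε / 2 * groupNorm b ^ 2 :=
    abs_avg_quadratic_sub_integral_le hQ.n_pos (Q.sample ω)
      (fun o k => weight Q.f Q.γbar o k) (hQ.integrable_gram hc) hgram
  refine ⟨hbdd, abs_avg_linear_le _ _ hscore, hg, abs_avg_linear_le _ _ hout, fun b => ?_⟩
  -- The factor 3 in `outcome_sq` is 5/2 + 1/2: the deviation of the form weighted by squared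
  -- residuals, and the return from the population form to the empirical one.
  have h1 := (abs_le.1 (abs_avg_quadratic_sub_integral_le hQ.n_pos (Q.sample ω)
    (fun o k => weight Q.f Q.γbar o k * resid Q.f Q.αbar o k ^ 2)
    (hQ.integrable_gram_sq_resid hc) hsq b)).2
  have h2 := hQ.integral_sq_resid_le hc b
  have h3 := mul_le_mul_of_nonneg_left (abs_le.1 (hg b)).1 (sq_nonneg c.σ0)
  simp only [pop] at h1 h2
  linarith

/-- Each of the four families of deviations contributes at most ε, and boundedness fails on a null
set, so 4ε would already do. -/
lemma measure_compl_goodSet_le (hQ : Q.Conditions c ε) (hc : c.Admissible) :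
    Q.μ (Q.goodSet c ε)ᶜ ≤ ENNReal.ofReal (8 * ε) := by
  have hε := hQ.ε_pos
  have h1 := measure_iUnion_le_card_mul (hQ.measure_score_le hc)
  have h2 := measure_iUnion_le_card_mul (fun q : Fin (p + 1) × Fin (p + 1) =>
    hQ.measure_gram_le hc q.1 q.2)
  have h3 := measure_iUnion_le_card_mul (hQ.measure_outcome_le hc)
  have h4 := measure_iUnion_le_card_mul (fun q : Fin (p + 1) × Fin (p + 1) =>
    hQ.measure_gram_sq_resid_le hc q.1 q.2)
  have h0 := ae_iff.1 (hQ.ae_bounded_sample hc)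
  have e1 : ((p : ℝ) + 1) * (ε / (p + 1)) = ε := by field_simp
  have e2 : ((p : ℝ) + 1) * (p + 1) * (ε / (p + 1)) ^ 2 ≤ ε := by
    have : ((p : ℝ) + 1) * (p + 1) * (ε / (p + 1)) ^ 2 = ε * ε := by field_simp
    rw [this]; nlinarith [hQ.ε_lt_one]
  simp only [Fintype.card_prod, Fintype.card_fin, Nat.cast_mul, Nat.cast_add, Nat.cast_one, e1]
    at h1 h2 h3 h4
  replace h2 := h2.trans (ENNReal.ofReal_le_ofReal e2)
  replace h4 := h4.trans (ENNReal.ofReal_le_ofReal e2)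
  refine le_trans (measure_mono (t := _ ∪ (_ ∪ (_ ∪ (_ ∪ _)))) fun ω hω => ?_)
    ((measure_union_le _ _).trans (add_le_add h0.le ((measure_union_le _ _).trans
      (add_le_add h1 ((measure_union_le _ _).trans (add_le_add h2
        ((measure_union_le _ _).trans (add_le_add h3 h4)))))))) |>.trans ?_
  · by_contra hcon
    simp only [Set.mem_union, Set.mem_iUnion, Set.mem_ofPred_eq, not_or, not_exists, not_le,
      not_not] at hcon
    obtain ⟨a0, a1, a2, a3, a4⟩ := hcon
    exact hω (hQ.isGoodSample hc a0 (fun j => (a1 j).le) (fun i j => (a2 (i, j)).le)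
      (fun j => (a3 j).le) fun i j => (a4 (i, j)).le)
  · rw [zero_add, ← ENNReal.ofReal_add hε.le hε.le, ← ENNReal.ofReal_add hε.le (by linarith),
      ← ENNReal.ofReal_add hε.le (by linarith)]
    exact ENNReal.ofReal_le_ofReal (by linarith)

end Conditions

lemma DeviationLE.mono {r r' : ℝ} (hr : r ≤ r') {ω : Ω} (h : Q.DeviationLE c ε r ω) :
    Q.DeviationLE c ε r' ω :=
  ⟨h.1, fun γ hγ => ⟨(h.2 γ hγ).1, fun α hα => ((h.2 γ hγ).2 α hα).trans hr⟩⟩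

end Problem

/-! ### Constants that serve a whole sequence of problems -/

namespace Constants

/-- A constant `M₂` that satisfies its defining inequality in all problems. -/
noncomputable def M2 (c : Constants) : ℝ :=
  Real.exp (3 * c.eta13) * ((c.xi21 ^ 2)⁻¹ * c.M11) +
    Real.exp c.eta13 * (c.xi22 ^ 2 * (c.nu21 ^ 2)⁻¹)

/-- The ratio of the two rates is at most this constant. -/
noncomputable def rateRatio (c : Constants) : ℝ := max 1 (√3 * c.B0 * (c.B1 - 1) * c.σ0)

/-- The constant in front of `(|S_γ| + |S_α|) λ̃₁²`. -/
noncomputable def totalBound (c : Constants) : ℝ :=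
  |c.M21 c.M2| + |c.M22| * c.rateRatio + |c.M23 c.M2| * c.rateRatio

lemma lam1_nonneg (c : Constants) (hc : c.Admissible) (K p n : ℕ) (ε : ℝ) :
    0 ≤ c.lam1 K p n ε := by
  have := hc.B1
  rw [lam1]; positivity

/-- Both rates are multiples of the same square root, and the factor 4√2·B₀²B₁ in λ̃₁ is at least 1.
-/
lemma lam2_le (c : Constants) (hc : c.Admissible) (K p n : ℕ) (ε : ℝ) :
    c.lam2 K p n ε ≤ c.rateRatio * c.lam1 K p n ε := by
  have hB0 := hc.B0
  have hB1 := hc.B1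
  have hσ := hc.σ0
  have hl := c.lam1_nonneg hc K p n ε
  refine max_le (le_mul_of_one_le_left hl (le_max_left _ _)) ?_
  have h0 : 0 ≤ √3 * c.B0 * (c.B1 - 1) * c.σ0 :=
    mul_nonneg (mul_nonneg (by positivity) (by linarith)) hσ.le
  refine le_trans ?_ (mul_le_mul_of_nonneg_right (le_max_right _ _) hl)
  refine mul_le_mul_of_nonneg_left ?_ h0
  rw [lam1_eq]
  refine le_mul_of_one_le_left (Real.sqrt_nonneg _) ?_
  have h1 : (1 : ℝ) ≤ √2 := Real.one_le_sqrt.2 (by norm_num)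
  have h2 : 1 ≤ c.B0 ^ 2 := one_le_pow₀ hB0
  exact one_le_mul_of_one_le_of_one_le
    (one_le_mul_of_one_le_of_one_le (by linarith) h2) hB1.le

end Constants

namespace Problem

variable {Ω₀ : Type u} {Ω : Type v} [MeasurableSpace Ω₀] [MeasurableSpace Ω] {d K p n : ℕ}
  {Q : Problem Ω₀ Ω d K p n} {c : Constants} {ε : ℝ}

namespace Conditions

/-- One factor λ̃₁ is raised to λ̃₂, and the two coefficients are added. The resulting M₂ depends
only on the fixed constants, as the asymptotic statement needs. -/
lemma outcomeBound_le (hQ : Q.Conditions c ε) (hc : c.Admissible) :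
    Q.outcomeBound c ε ≤ Real.exp c.eta13 * c.M2 *
      (Q.Sγ.card * c.lam1 K p n ε * c.lam2 K p n ε + Q.Sα.card * c.lam2 K p n ε ^ 2) := by
  have hl1 := c.lam1_nonneg hc K p n ε
  have hl : c.lam1 K p n ε ≤ c.lam2 K p n ε := le_max_left _ _
  have hη : 0 ≤ c.η1 := le_trans (by positivity) hQ.η1_bound
  have hM1 := hc.M1_pos
  have hM11 : 0 ≤ c.M11 := by rw [Constants.M11]; positivity
  set l1 := c.lam1 K p n ε
  set l2 := c.lam2 K p n ε
  have hl2 : 0 ≤ l2 := hl1.trans hl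
  set a := (c.xi21 ^ 2)⁻¹ * c.M11 with ha
  set b := c.xi22 ^ 2 * (c.nu21 ^ 2)⁻¹ with hb
  have ha0 : 0 ≤ a := by positivity
  have hb0 : 0 ≤ b := by positivity
  have e4 : Real.exp (4 * c.eta13) = Real.exp c.eta13 * Real.exp (3 * c.eta13) := by
    rw [← Real.exp_add]; ring_nf
  have e2 : Real.exp (2 * c.eta13) = Real.exp c.eta13 * Real.exp c.eta13 := by
    rw [← Real.exp_add]; ring_nf
  have h1 : Q.outcomeBound c ε = Real.exp c.eta13 * (Real.exp (3 * c.eta13) * a *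
      (Q.Sγ.card * l1 * l1) + Real.exp c.eta13 * b * (Q.Sα.card * l2 ^ 2)) := by
    rw [outcomeBound, e4, e2, ha, hb]; ring
  rw [h1, Constants.M2, ← ha, ← hb, mul_assoc (Real.exp c.eta13) (_ + _)]
  refine mul_le_mul_of_nonneg_left ?_ (Real.exp_pos _).le
  rw [add_mul]
  refine add_le_add (mul_le_mul_of_nonneg_left ?_ (by positivity))
    (mul_le_mul_of_nonneg_left ?_ (by positivity))
  · have : (Q.Sγ.card : ℝ) * l1 * l1 ≤ Q.Sγ.card * l1 * l2 := by gcongr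
    have : 0 ≤ (Q.Sα.card : ℝ) * l2 ^ 2 := by positivity
    linarith
  · have : 0 ≤ (Q.Sγ.card : ℝ) * l1 * l2 := by positivity
    linarith

lemma deviationLE_of_mem_goodSet (hQ : Q.Conditions c ε) (hc : c.Admissible) {ω : Ω}
    (hω : ω ∈ Q.goodSet c ε) :
    Q.DeviationLE c ε (c.totalBound * ((Q.Sγ.card + Q.Sα.card) * c.lam1 K p n ε ^ 2)) ω := by
  refine DeviationLE.mono ?_ (deviationLE_of_isGoodSample hc hQ (hQ.lam1_pos hc)
    (hQ.popQuad_eq_gram hc) (hQ.outcomeBound_le hc) hω)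
  have hl1 := c.lam1_nonneg hc K p n ε
  have hl := c.lam2_le hc K p n ε
  set l1 := c.lam1 K p n ε
  set l2 := c.lam2 K p n ε
  have hN : (0 : ℝ) ≤ Q.Sγ.card := Nat.cast_nonneg _
  have hN' : (0 : ℝ) ≤ Q.Sα.card := Nat.cast_nonneg _
  have hl12 : l1 * l2 ≤ c.rateRatio * l1 ^ 2 := by
    have := mul_le_mul_of_nonneg_left hl hl1
    linarith
  have hl2 : 0 ≤ l1 * l2 := mul_nonneg hl1 (hl1.trans (le_max_left _ _))
  have h1 : ∀ (m N x y : ℝ), 0 ≤ N → N ≤ Q.Sγ.card + Q.Sα.card → 0 ≤ x → x ≤ y →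
      m * N * x ≤ |m| * ((Q.Sγ.card + Q.Sα.card) * y) := fun m N x y h0 h1 h2 h3 => by
    rw [mul_assoc]
    exact mul_le_mul (le_abs_self m) (mul_le_mul h1 h3 h2 (h0.trans h1)) (mul_nonneg h0 h2)
      (abs_nonneg m)
  have a1 := h1 (c.M21 c.M2) Q.Sγ.card (l1 ^ 2) (l1 ^ 2) hN (by linarith) (sq_nonneg _) le_rfl
  have a2 := h1 c.M22 Q.Sγ.card (l1 * l2) _ hN (by linarith) hl2 hl12
  have a3 := h1 (c.M23 c.M2) Q.Sα.card (l1 * l2) _ hN' (by linarith) hl2 hl12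
  rw [Constants.totalBound]
  linarith

/-- The finite-sample bound for the deviation of the estimator of a treatment mean. -/
theorem exists_event_deviationLE (hQ : Q.Conditions c ε) (hc : c.Admissible) {M2 : ℝ}
    (hM2 : Q.outcomeBound c ε ≤ Real.exp c.eta13 * M2 *
      (Q.Sγ.card * c.lam1 K p n ε * c.lam2 K p n ε + Q.Sα.card * c.lam2 K p n ε ^ 2)) :
    ∃ E : Set Ω, MeasurableSet E ∧ ENNReal.ofReal (1 - 8 * ε) ≤ Q.μ E ∧
      ∀ ω ∈ E, Q.DeviationLE c ε
        (c.M21 M2 * Q.Sγ.card * c.lam1 K p n ε ^ 2 +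
          c.M22 * Q.Sγ.card * c.lam1 K p n ε * c.lam2 K p n ε +
          c.M23 M2 * Q.Sα.card * c.lam1 K p n ε * c.lam2 K p n ε) ω := by
  have := Q.isProb_μ
  -- The good set is not shown to be measurable; the complement of a measurable hull of its
  -- complement lies inside it and obeys the same probability bound.
  have hm := measurableSet_toMeasurable Q.μ (Q.goodSet c ε)ᶜ
  refine ⟨(toMeasurable Q.μ (Q.goodSet c ε)ᶜ)ᶜ, hm.compl, ?_, fun ω hω => ?_⟩
  · rw [prob_compl_eq_one_sub hm, measure_toMeasurable,
      ENNReal.ofReal_sub _ (by linarith [hQ.ε_pos]), ENNReal.ofReal_one]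
    exact tsub_le_tsub_left (hQ.measure_compl_goodSet_le hc) 1
  · exact deviationLE_of_isGoodSample hc hQ (hQ.lam1_pos hc) (hQ.popQuad_eq_gram hc) hM2
      (not_not.1 fun h => hω (subset_toMeasurable _ _ h))

end Conditions

/-- Under the sparsity condition the estimators of the treatment mean at the estimated and at the
target coefficients agree up to `o_p(n^{-1/2})`. -/
theorem tendsto_measure_not_deviationLE (hc : c.Admissible) {Ω₀ : ℕ → Type u} {Ω : ℕ → Type v}
    [∀ n, MeasurableSpace (Ω₀ n)] [∀ n, MeasurableSpace (Ω n)] {d K p : ℕ → ℕ}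
    {Q : ∀ n, Problem (Ω₀ n) (Ω n) (d n) (K n) (p n) n} {ε : ℕ → ℝ}
    (hQ : ∀ᶠ n in atTop, (Q n).Conditions c (ε n)) (hε : Tendsto ε atTop (𝓝 0))
    (hrate : Tendsto (fun n : ℕ => √(n : ℝ) * (((Q n).Sγ.card : ℝ) + (Q n).Sα.card) *
      c.lam1 (K n) (p n) n (ε n) ^ 2) atTop (𝓝 0)) {δ : ℝ} (hδ : 0 < δ) :
    Tendsto (fun n : ℕ => (Q n).μ {ω | ¬ (Q n).DeviationLE c (ε n) (δ / √(n : ℝ)) ω})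
      atTop (𝓝 0) := by
  have h8 : Tendsto (fun n => ENNReal.ofReal (8 * ε n)) atTop (𝓝 0) := by
    simpa using ENNReal.tendsto_ofReal (hε.const_mul 8)
  have hsmall : ∀ᶠ n : ℕ in atTop, c.totalBound * (√(n : ℝ) * (((Q n).Sγ.card : ℝ) +
      (Q n).Sα.card) * c.lam1 (K n) (p n) n (ε n) ^ 2) < δ := by
    have h := hrate.const_mul c.totalBound
    rw [mul_zero] at h
    exact h.eventually_lt_const hδ
  refine tendsto_of_tendsto_of_tendsto_of_le_of_le' tendsto_const_nhds h8
    (Eventually.of_forall fun _ => zero_le) ?_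
  filter_upwards [hQ, hsmall] with n hn hs
  refine (measure_mono fun ω hω => ?_).trans (hn.measure_compl_goodSet_le hc)
  by_contra hg
  refine hω ((hn.deviationLE_of_mem_goodSet hc (not_not.1 hg)).mono ?_)
  have hsqrt : 0 < √(n : ℝ) := Real.sqrt_pos.2 (Nat.cast_pos.2 hn.n_pos)
  -- Multiplying by √n turns the deterministic radius into the sequence assumed to vanish, times a
  -- constant independent of n.
  rw [le_div_iff₀ hsqrt]
  linarith

end Problem

end RCAL

theorem mainTheorem5 (c : RCAL.Constants) (hc : c.Admissible) :
    -- the finite-sample bound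
    (∀ (Ω₀ : Type u) (Ω : Type v) [MeasurableSpace Ω₀] [MeasurableSpace Ω] (d K p n : ℕ)
        (Q : RCAL.Problem Ω₀ Ω d K p n) (ε : ℝ), Q.Conditions c ε →
      ∀ M2 : ℝ,
        Q.outcomeBound c ε ≤ Real.exp c.eta13 * M2 *
          (Q.Sγ.card * c.lam1 K p n ε * c.lam2 K p n ε + Q.Sα.card * c.lam2 K p n ε ^ 2) →
        ∃ E : Set Ω, MeasurableSet E ∧ ENNReal.ofReal (1 - 8 * ε) ≤ Q.μ E ∧
          ∀ ω ∈ E, Q.DeviationLE c ε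
            (c.M21 M2 * Q.Sγ.card * c.lam1 K p n ε ^ 2 +
              c.M22 * Q.Sγ.card * c.lam1 K p n ε * c.lam2 K p n ε +
              c.M23 M2 * Q.Sα.card * c.lam1 K p n ε * c.lam2 K p n ε) ω) ∧
    -- the expansion up to `o_p(n^{-1/2})` along sequences of problems with the same constants
    (∀ (Ω₀ : ℕ → Type u) (Ω : ℕ → Type v) [∀ n, MeasurableSpace (Ω₀ n)]
        [∀ n, MeasurableSpace (Ω n)] (d K p : ℕ → ℕ)
        (Q : ∀ n, RCAL.Problem (Ω₀ n) (Ω n) (d n) (K n) (p n) n) (ε : ℕ → ℝ),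
      (∀ᶠ n in atTop, (Q n).Conditions c (ε n)) →
      Tendsto ε atTop (𝓝 0) →
      Tendsto (fun n : ℕ => √(n : ℝ) * (((Q n).Sγ.card : ℝ) + (Q n).Sα.card) *
        c.lam1 (K n) (p n) n (ε n) ^ 2) atTop (𝓝 0) →
      ∀ δ : ℝ, 0 < δ →
        Tendsto (fun n : ℕ => (Q n).μ {ω | ¬ (Q n).DeviationLE c (ε n) (δ / √(n : ℝ)) ω})
          atTop (𝓝 0)) :=
  ⟨fun _ _ _ _ _ _ _ _ _ _ hQ _ hM2 => hQ.exists_event_deviationLE hc hM2,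
    fun _ _ _ _ _ _ _ _ _ hQ hε hrate _ hδ =>
      RCAL.Problem.tendsto_measure_not_deviationLE hc hQ hε hrate hδ⟩
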